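/- There are an absolute constant $c>0$ and a single algorithm (a fixed program for a unit-cost random access machine with addition, subtraction and comparison of natural numbers, which reads the input coloring by asking for the color of one $k$-set at a time, at a cost of $k+1$ steps per question) such that the following holds for all integers $k\ge 2$, $\ell\ge 3$, $2\le r\le k$ and all integers $n$ with $$n\ \ge\ k(\ell+1)\,r\left(1+\frac{1}{k-r+1}+\ln\Bigl(1+\frac{r-2}{k-r+1}\Bigr)\right).$$ Given $k,\ell,r,n$ and any coloring with $r$ colors of the edges of $K_n^{(k)}$, the complete $k$-uniform hypergraph on $n$ vertices (whose edges are all $k$-element sets of vertices), the algorithm finds, in at most $c\,n^k$ steps, a monochromatic loose path of length $\ell$, that is, it outputs distinct vertices $v_1,\dots,v_{(k-1)\ell+1}$ such that the $\ell$ edges $\{v_{(i-1)(k-1)+q}:1\le q\le k\}$, $i=1,\dots,\ell$, all have the same color. For $r=2$ the same conclusion, with the same algorithm and the same $c$, already holds for all integers $n\ge(2k-2)\ell+k$. -/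

import Mathlib

namespace LoosePath

/-! ### Colorings of complete hypergraphs and loose paths -/

/-- An `r`-edge-coloring of the complete `k`-uniform hypergraph on the vertex set `Fin n`. -/
abbrev EdgeColoring (n k r : ℕ) : Type :=
  {e : Finset (Fin n) // e.card = k} → Fin r

/-- The `i`-th edge (`i` counted from `0`) of the `k`-uniform loose path of length `ℓ` on the
vertices `0, 1, …, (k - 1) ℓ`: it consists of the `k` consecutive vertices
`i (k - 1), …, i (k - 1) + k - 1`. -/
def pathEdge (k ℓ : ℕ) (i : Fin ℓ) : Finset (Fin ((k - 1) * ℓ + 1)) :=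
  Finset.univ.filter fun v => (i : ℕ) * (k - 1) ≤ (v : ℕ) ∧ (v : ℕ) < (i : ℕ) * (k - 1) + k

/-- The first `(k - 1) ℓ + 1` entries of the sequence `out` are the consecutive vertices of a copy
of the `k`-uniform loose path of length `ℓ`, all of whose edges have the same color under `χ`. -/
def IsMonoPath {n k r : ℕ} (χ : EdgeColoring n k r) (ℓ : ℕ) (out : ℕ → ℕ) : Prop :=
  ∃ φ : Fin ((k - 1) * ℓ + 1) ↪ Fin n,
    (∀ v : Fin ((k - 1) * ℓ + 1), out (v : ℕ) = (φ v : ℕ)) ∧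
    ∃ a : Fin r, ∀ i : Fin ℓ, ∃ h : ((pathEdge k ℓ i).map φ).card = k,
      χ ⟨(pathEdge k ℓ i).map φ, h⟩ = a

/-! ### A random access machine with unit-cost instructions

Programs are finite and are built from assignments, array accesses and structured control flow.
The only arithmetic is addition and truncated subtraction of natural numbers, and comparison.
The input coloring can only be accessed by asking for the color of one edge at a time. -/

/-- Memory: scalar registers, and arrays of natural numbers. -/
structure Memory where
  reg : ℕ → ℕ
  arr : ℕ → ℕ → ℕ

/-- Write the value `v` to register `x`. -/
def Memory.setReg (s : Memory) (x v : ℕ) : Memory :=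
  { s with reg := Function.update s.reg x v }

/-- Write the value `v` to cell `i` of array `a`. -/
def Memory.setArr (s : Memory) (a i v : ℕ) : Memory :=
  { s with arr := Function.update s.arr a (Function.update (s.arr a) i v) }

/-- Arithmetic expressions; `get a e` is the content of cell number `e` of array `a`. -/
inductive Expr : Type
  | const (c : ℕ)
  | reg (x : ℕ)
  | get (a : ℕ) (e : Expr)
  | add (e₁ e₂ : Expr)
  | sub (e₁ e₂ : Expr)
  | lt (e₁ e₂ : Expr)
  | eq (e₁ e₂ : Expr)

/-- The value of an expression. Comparisons have the values `0` (false) and `1` (true). -/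
def Expr.eval (s : Memory) : Expr → ℕ
  | .const c => c
  | .reg x => s.reg x
  | .get a e => s.arr a (e.eval s)
  | .add e₁ e₂ => e₁.eval s + e₂.eval s
  | .sub e₁ e₂ => e₁.eval s - e₂.eval s
  | .lt e₁ e₂ => if e₁.eval s < e₂.eval s then 1 else 0
  | .eq e₁ e₂ => if e₁.eval s = e₂.eval s then 1 else 0

/-- The time needed to evaluate an expression: one step for each of its nodes. -/
def Expr.cost : Expr → ℕ
  | .const _ => 1
  | .reg _ => 1
  | .get _ e => e.cost + 1
  | .add e₁ e₂ => e₁.cost + e₂.cost + 1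
  | .sub e₁ e₂ => e₁.cost + e₂.cost + 1
  | .lt e₁ e₂ => e₁.cost + e₂.cost + 1
  | .eq e₁ e₂ => e₁.cost + e₂.cost + 1

/-- Programs. A test succeeds if the value of the expression is not `0`. `query x a` asks for the
color of the edge that is written in the first `k` cells of array `a` and stores the answer in
register `x`. -/
inductive Program : Type
  | skip
  | assign (x : ℕ) (e : Expr)
  | store (a : ℕ) (i e : Expr)
  | query (x a : ℕ)
  | seq (p₁ p₂ : Program)
  | ite (e : Expr) (p₁ p₂ : Program)
  | while (e : Expr) (p : Program)

/-- The set of those vertices of `Fin n` that occur among the first `k` terms of `f`. -/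
def listedVertices (n k : ℕ) (f : ℕ → ℕ) : Finset (Fin n) :=
  Finset.univ.filter fun v => ∃ j < k, f j = (v : ℕ)

/-- The answer to a query: the color of the edge formed by the first `k` terms of `f`, a number
less than `r`. If these are not `k` distinct vertices, then the answer is `r`. -/
def answer {n k r : ℕ} (χ : EdgeColoring n k r) (f : ℕ → ℕ) : ℕ :=
  if h : (listedVertices n k f).card = k then (χ ⟨listedVertices n k f, h⟩ : ℕ) else r

/-- `Exec χ p s s' t`: on the input coloring `χ`, the program `p`, started with memory `s`, halts
with memory `s'` after exactly `t` steps. A query takes `k + 1` steps. -/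
inductive Exec {n k r : ℕ} (χ : EdgeColoring n k r) : Program → Memory → Memory → ℕ → Prop
  | skip (s : Memory) : Exec χ .skip s s 1
  | assign (x : ℕ) (e : Expr) (s : Memory) :
      Exec χ (.assign x e) s (s.setReg x (e.eval s)) (e.cost + 1)
  | store (a : ℕ) (i e : Expr) (s : Memory) :
      Exec χ (.store a i e) s (s.setArr a (i.eval s) (e.eval s)) (i.cost + e.cost + 1)
  | query (x a : ℕ) (s : Memory) :
      Exec χ (.query x a) s (s.setReg x (answer χ (s.arr a))) (k + 1)
  | seq {p₁ p₂ : Program} {s s' s'' : Memory} {t₁ t₂ : ℕ} :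
      Exec χ p₁ s s' t₁ → Exec χ p₂ s' s'' t₂ → Exec χ (.seq p₁ p₂) s s'' (t₁ + t₂)
  | ite_true {e : Expr} {p₁ p₂ : Program} {s s' : Memory} {t : ℕ} :
      e.eval s ≠ 0 → Exec χ p₁ s s' t → Exec χ (.ite e p₁ p₂) s s' (e.cost + 1 + t)
  | ite_false {e : Expr} {p₁ p₂ : Program} {s s' : Memory} {t : ℕ} :
      e.eval s = 0 → Exec χ p₂ s s' t → Exec χ (.ite e p₁ p₂) s s' (e.cost + 1 + t)
  | while_true {e : Expr} {p : Program} {s s' s'' : Memory} {t₁ t₂ : ℕ} :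
      e.eval s ≠ 0 → Exec χ p s s' t₁ → Exec χ (.while e p) s' s'' t₂ →
        Exec χ (.while e p) s s'' (e.cost + 1 + t₁ + t₂)
  | while_false {e : Expr} {p : Program} {s : Memory} :
      e.eval s = 0 → Exec χ (.while e p) s s (e.cost + 1)

/-- The initial memory: registers `0, 1, 2, 3` hold `k, ℓ, r, n`, all other memory is `0`. -/
def initialMemory (k ℓ r n : ℕ) : Memory where
  reg x := if x = 0 then k else if x = 1 then ℓ else if x = 2 then r else if x = 3 then n else 0
  arr _ _ := 0

/-- The program `A`, given `k`, `ℓ`, `r`, `n` and any `r`-edge-coloring of the complete `k`-uniform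
hypergraph on `n` vertices, halts after at most `c * n ^ k` steps, and then the first cells of
array `0` list the vertices of a monochromatic loose path of length `ℓ`. -/
def FindsMonoPath (A : Program) (c : ℝ) (k ℓ r n : ℕ) : Prop :=
  ∀ χ : EdgeColoring n k r, ∃ (s : Memory) (t : ℕ),
    Exec χ A (initialMemory k ℓ r n) s t ∧ (t : ℝ) ≤ c * (n : ℝ) ^ k ∧ IsMonoPath χ ℓ (s.arr 0)

end LoosePath

namespace LoosePath

open Finset

/-! For `t = r - 1, …, 1`, stage `t` grows a loose path of color `t` depth first. Class `0` is a
reservoir of free vertices, and the earlier stages have built the classes `t + 1, …, r - 1`. A new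
edge consists of the end vertex of the path, one vertex of each of these classes, and `k - r + t`
vertices of the reservoir. The latter become alive: each may serve as an end vertex later. If the
end vertex lies in no edge of color `t` of this shape, it is moved to class `t`. Then another alive
vertex of the last edge becomes the end vertex, or, if there is none, the last edge is dropped; an
exhausted path is started afresh from the reservoir.

The stage stops with a path of `ℓ` edges or with `threshold` many vertices in class `t`. In the
second case no edge with one vertex in each of the classes `t, …, r - 1` and the others in the
reservoir has color `t`, because the reservoir and the higher classes only lose vertices during the
stage (`Walk.finish`). If no stage succeeds, every edge with one vertex in each of the classes `1,
…, r - 1` and the others in the reservoir has color `0`. A path of such edges is then written down,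
with link vertices alternating between the classes `0` and `1` (`StageStart.isMonoPath`).

The vertices suffice by double counting. What an extension takes from the reservoir ends up alive or
in class `t`, and a path with fewer than `ℓ` edges has at most `(k - r + t) * (ℓ - 1) + 1` alive
vertices. So there are at most `(threshold + 1) / (k - r + t) + ℓ` extensions, each of which uses up
one vertex of every higher class. The resulting recursion `wasted` is solved by a harmonic sum
(`wasted_le`, `freeNeed_le`), which is compared with a logarithm (`partialHarmonic_le`).

For the time, a potential of at most `6 * n + 1` decreases in each iteration of a stage. An
iteration is dominated by one backtracking search through the sets of at most `k - 1` vertices, with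
`O(k)` steps for each (`runs_search`). The sum of these binomial coefficients is at most `k * n ^ (k
- 1) / (k - 1)!`, and the factorial absorbs all powers of `k` (`mul_sq_mul_smallSubsets_le`). -/

/-- A sequence of programs, executed one after the other. -/
def Program.block : List Program → Program
  | [] => .skip
  | p :: ps => .seq p (Program.block ps)

/-! ### Postconditions and running times of programs -/

/-- The program `p`, started with memory `s`, halts with some memory `s'` after `t` steps
such that `Q s' t` holds. -/
def Runs {n k r : ℕ} (χ : EdgeColoring n k r) (p : Program) (s : Memory)
    (Q : Memory → ℕ → Prop) : Prop :=
  ∃ s' t, Exec χ p s s' t ∧ Q s' t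

section Rules

variable {n k r : ℕ} {χ : EdgeColoring n k r}

theorem Runs.mono {p : Program} {s : Memory} {Q Q' : Memory → ℕ → Prop} (h : Runs χ p s Q)
    (hQ : ∀ s' t, Q s' t → Q' s' t) : Runs χ p s Q' := by
  obtain ⟨s', t, h, h'⟩ := h
  exact ⟨s', t, h, hQ _ _ h'⟩

theorem runs_skip {s : Memory} {Q : Memory → ℕ → Prop} : Runs χ .skip s Q ↔ Q s 1 :=
  ⟨fun ⟨_, _, h, hQ⟩ => by cases h; exact hQ, fun h => ⟨_, _, .skip s, h⟩⟩

theorem runs_assign {s : Memory} {x : ℕ} {e : Expr} {Q : Memory → ℕ → Prop} :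
    Runs χ (.assign x e) s Q ↔ Q (s.setReg x (e.eval s)) (e.cost + 1) :=
  ⟨fun ⟨_, _, h, hQ⟩ => by cases h; exact hQ, fun h => ⟨_, _, .assign x e s, h⟩⟩

theorem runs_store {s : Memory} {a : ℕ} {i e : Expr} {Q : Memory → ℕ → Prop} :
    Runs χ (.store a i e) s Q ↔ Q (s.setArr a (i.eval s) (e.eval s)) (i.cost + e.cost + 1) :=
  ⟨fun ⟨_, _, h, hQ⟩ => by cases h; exact hQ, fun h => ⟨_, _, .store a i e s, h⟩⟩

theorem runs_query {s : Memory} {x a : ℕ} {Q : Memory → ℕ → Prop} :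
    Runs χ (.query x a) s Q ↔ Q (s.setReg x (answer χ (s.arr a))) (k + 1) :=
  ⟨fun ⟨_, _, h, hQ⟩ => by cases h; exact hQ, fun h => ⟨_, _, .query x a s, h⟩⟩

theorem runs_seq {s : Memory} {p₁ p₂ : Program} {Q : Memory → ℕ → Prop} :
    Runs χ (.seq p₁ p₂) s Q ↔
      Runs χ p₁ s fun s' t₁ => Runs χ p₂ s' fun s'' t₂ => Q s'' (t₁ + t₂) := by
  constructor
  · rintro ⟨_, _, h, hQ⟩
    cases h with
    | seq h₁ h₂ => exact ⟨_, _, h₁, _, _, h₂, hQ⟩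
  · rintro ⟨_, _, h₁, _, _, h₂, hQ⟩
    exact ⟨_, _, .seq h₁ h₂, hQ⟩

theorem runs_ite {s : Memory} {e : Expr} {p₁ p₂ : Program} {Q : Memory → ℕ → Prop} :
    Runs χ (.ite e p₁ p₂) s Q ↔
      (e.eval s ≠ 0 → Runs χ p₁ s fun s' t => Q s' (e.cost + 1 + t)) ∧
      (e.eval s = 0 → Runs χ p₂ s fun s' t => Q s' (e.cost + 1 + t)) := by
  constructor
  · rintro ⟨_, _, h, hQ⟩
    cases h with
    | ite_true he h => exact ⟨fun _ => ⟨_, _, h, hQ⟩, fun h0 => absurd h0 he⟩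
    | ite_false he h => exact ⟨fun h0 => absurd he h0, fun _ => ⟨_, _, h, hQ⟩⟩
  · rintro ⟨h₁, h₂⟩
    by_cases he : e.eval s = 0
    · obtain ⟨_, _, h, hQ⟩ := h₂ he
      exact ⟨_, _, .ite_false he h, hQ⟩
    · obtain ⟨_, _, h, hQ⟩ := h₁ he
      exact ⟨_, _, .ite_true he h, hQ⟩

theorem runs_block_nil {s : Memory} {Q : Memory → ℕ → Prop} :
    Runs χ (.block []) s Q ↔ Q s 1 := runs_skip

theorem runs_block_cons {s : Memory} {p : Program} {ps : List Program}
    {Q : Memory → ℕ → Prop} :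
    Runs χ (.block (p :: ps)) s Q ↔
      Runs χ p s fun s' t₁ => Runs χ (.block ps) s' fun s'' t₂ => Q s'' (t₁ + t₂) := runs_seq

theorem runs_while_false {s : Memory} {e : Expr} {p : Program} {Q : Memory → ℕ → Prop}
    (he : e.eval s = 0) (hQ : Q s (e.cost + 1)) : Runs χ (.while e p) s Q :=
  ⟨_, _, .while_false he, hQ⟩

/-- A loop with invariant `I`, whose body decreases the variant `Φ` in at most `C` steps. -/
theorem runs_while {e : Expr} {p : Program} (I : Memory → Prop) (Φ : Memory → ℕ) (C : ℕ)
    (hstep : ∀ s, I s → e.eval s ≠ 0 → Runs χ p s fun s' t => I s' ∧ Φ s' < Φ s ∧ t ≤ C)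
    {s : Memory} (hs : I s) :
    Runs χ (.while e p) s fun s' t =>
      I s' ∧ e.eval s' = 0 ∧ t ≤ Φ s * (e.cost + 1 + C) + (e.cost + 1) := by
  induction h : Φ s using Nat.strong_induction_on generalizing s with
  | _ N ih =>
    by_cases he : e.eval s = 0
    · exact runs_while_false he ⟨hs, he, by omega⟩
    · obtain ⟨s', t, hex, hI, hlt, ht⟩ := hstep s hs he
      obtain ⟨s'', t', hex', hI', he', ht'⟩ := ih _ (h ▸ hlt) hI rfl
      refine ⟨s'', _, .while_true he hex hex', hI', he', ?_⟩
      have : (Φ s' + 1) * (e.cost + 1 + C) ≤ N * (e.cost + 1 + C) :=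
        Nat.mul_le_mul_right _ (by omega)
      rw [add_mul] at this
      omega

/-- Some number of iterations of a loop lead from `s` to a memory `s'` in `t` steps
such that `P s' t` holds. -/
def Reach {n k r : ℕ} (χ : EdgeColoring n k r) (e : Expr) (p : Program) (s : Memory)
    (P : Memory → ℕ → Prop) : Prop :=
  ∃ s' t, (∀ s'' t', Exec χ (.while e p) s' s'' t' → Exec χ (.while e p) s s'' (t + t')) ∧ P s' t

theorem Reach.refl {e : Expr} {p : Program} {s : Memory} {P : Memory → ℕ → Prop} (h : P s 0) :
    Reach χ e p s P :=
  ⟨s, 0, fun _ _ h => by simpa using h, h⟩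

/-- The search is one flat loop that imitates a recursion, so a recursive call is a segment of
consecutive iterations. Composing segments replaces composing calls. -/
theorem Reach.trans {e : Expr} {p : Program} {s : Memory} {P P' : Memory → ℕ → Prop}
    (h : Reach χ e p s P) (h' : ∀ s' t, P s' t → Reach χ e p s' fun s'' t' => P' s'' (t + t')) :
    Reach χ e p s P' := by
  obtain ⟨s', t, h, hP⟩ := h
  obtain ⟨s'', t', h'', hP'⟩ := h' _ _ hP
  exact ⟨s'', t + t', fun s₃ t₃ h₃ => by rw [add_assoc]; exact h _ _ (h'' _ _ h₃), hP'⟩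

theorem Reach.mono {e : Expr} {p : Program} {s : Memory} {P P' : Memory → ℕ → Prop}
    (h : Reach χ e p s P) (h' : ∀ s' t, P s' t → P' s' t) : Reach χ e p s P' := by
  obtain ⟨s', t, h, hP⟩ := h
  exact ⟨s', t, h, h' _ _ hP⟩

theorem Reach.step {e : Expr} {p : Program} {s : Memory} {P : Memory → ℕ → Prop}
    (he : e.eval s ≠ 0)
    (h : Runs χ p s fun s' t => Reach χ e p s' fun s'' t' => P s'' (e.cost + 1 + t + t')) :
    Reach χ e p s P := by
  obtain ⟨s', t, h, s'', t', h', hP⟩ := h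
  exact ⟨s'', _, fun s₃ t₃ h₃ => by rw [add_assoc]; exact .while_true he h (h' _ _ h₃), hP⟩

theorem Reach.runs {e : Expr} {p : Program} {s : Memory} {P Q : Memory → ℕ → Prop}
    (h : Reach χ e p s P)
    (h' : ∀ s' t, P s' t → e.eval s' = 0 ∧ Q s' (t + (e.cost + 1))) :
    Runs χ (.while e p) s Q := by
  obtain ⟨s', t, h, hP⟩ := h
  exact ⟨s', _, h _ _ (.while_false (h' _ _ hP).1), (h' _ _ hP).2⟩

end Rules

/-! ### Reading from a modified memory -/

section MemoryAccess

variable (s : Memory) (x y a b i v : ℕ)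

theorem setReg_reg : (s.setReg x v).reg y = if y = x then v else s.reg y :=
  Function.update_apply ..

theorem setReg_arr : (s.setReg x v).arr = s.arr := rfl

theorem setArr_reg : (s.setArr a i v).reg = s.reg := rfl

theorem setArr_arr :
    (s.setArr a i v).arr b = if b = a then Function.update (s.arr a) i v else s.arr b := by
  simp only [Memory.setArr, Function.update_apply]

end MemoryAccess

/-! ### Colors of sets of natural numbers, and class capacities -/

/-- The color of the set `E` of vertices, or `r` if `E` does not contain exactly `k` of them. -/
def colorOf {n k r : ℕ} (χ : EdgeColoring n k r) (E : Finset ℕ) : ℕ :=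
  if h : (univ.filter fun v : Fin n => (v : ℕ) ∈ E).card = k then (χ ⟨_, h⟩ : ℕ) else r

/-- The order in which a query lists its vertices is irrelevant, so all later bookkeeping is done
with sets of natural numbers. -/
theorem answer_eq_colorOf {n k r : ℕ} (χ : EdgeColoring n k r) (f : ℕ → ℕ) :
    answer χ f = colorOf χ ((range k).image f) := by
  have : listedVertices n k f = univ.filter fun v : Fin n => (v : ℕ) ∈ (range k).image f := by
    ext v; simp [listedVertices]
  unfold answer colorOf
  simp only [this]

/-- The set `E` contains at most `cap i` elements of class `i` for every `i`. -/
def Fits (st cap : ℕ → ℕ) (E : Finset ℕ) : Prop :=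
  ∀ i, (E.filter fun w => st w = i).card ≤ cap i

/-! ### Backtracking search for an edge of the current color -/

section Search

/-- Remove the last vertex of the query and continue with its successor. -/
def popProg : Program := .block [
  .assign 9 (.get 3 (.reg 8)),
  .store 2 (.get 1 (.reg 9)) (.add (.get 2 (.get 1 (.reg 9))) (.const 1)),
  .assign 9 (.add (.reg 9) (.const 1)),
  .assign 8 (.sub (.reg 8) (.const 1))]

/-- Append the current vertex to the query. -/
def pushProg : Program := .block [
  .store 3 (.add (.reg 8) (.const 1)) (.reg 9),
  .store 2 (.get 1 (.reg 9)) (.sub (.get 2 (.get 1 (.reg 9))) (.const 1)),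
  .assign 8 (.add (.reg 8) (.const 1)),
  .assign 9 (.add (.reg 9) (.const 1))]

/-- Array `3` is the stack of the recursion: cell `0` is the end of the path, and cells `1` to the
depth in register `8` are increasing vertices. Register `9` is the next candidate. Array `1` holds
the classes and array `2` the capacities that are left. Register `10` is `0` while the search runs,
`1` after success and `2` after failure. -/
def searchBody : Program :=
  .ite (.eq (.add (.reg 8) (.const 1)) (.reg 0))
    (.seq (.query 11 3)
      (.ite (.eq (.reg 11) (.reg 4)) (.assign 10 (.const 1)) popProg))
    (.ite (.lt (.reg 9) (.reg 3))
      (.ite (.get 2 (.get 1 (.reg 9))) pushProg (.assign 9 (.add (.reg 9) (.const 1))))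
      (.ite (.reg 8) popProg (.assign 10 (.const 2))))

abbrev searchCond : Expr := .eq (.reg 10) (.const 0)

/-- Search for an edge of the current color that contains the last vertex of the path. -/
def searchProg : Program := .block [
  .store 3 (.const 0) (.get 0 (.reg 6)),
  .assign 8 (.const 0),
  .assign 9 (.const 0),
  .assign 10 (.const 0),
  .while searchCond searchBody]

/-- Agreement of two memories outside of the working space of the search. -/
structure SearchFrame (s s' : Memory) : Prop where
  reg : ∀ x, x < 8 ∨ 11 < x → s'.reg x = s.reg x
  arr : ∀ a, a ≠ 2 → a ≠ 3 → s'.arr a = s.arr a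

theorem SearchFrame.trans {s s' s'' : Memory} (h : SearchFrame s s') (h' : SearchFrame s' s'') :
    SearchFrame s s'' :=
  ⟨fun x hx => (h'.reg x hx).trans (h.reg x hx),
    fun a h₂ h₃ => (h'.arr a h₂ h₃).trans (h.arr a h₂ h₃)⟩

/-- The memory `s'` differs from `s` only in that the current vertex is `x`. -/
structure SameQuery (s s' : Memory) (x : ℕ) : Prop where
  frame : SearchFrame s s'
  depth : s'.reg 8 = s.reg 8
  vertex : s'.reg 9 = x
  status : s'.reg 10 = 0
  cap : s'.arr 2 = s.arr 2
  query : ∀ p ≤ s.reg 8, s'.arr 3 p = s.arr 3 p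

theorem SameQuery.trans {s s' s'' : Memory} {x x' : ℕ} (h : SameQuery s s' x)
    (h' : SameQuery s' s'' x') : SameQuery s s'' x' where
  frame := h.frame.trans h'.frame
  depth := h'.depth.trans h.depth
  vertex := h'.vertex
  status := h'.status
  cap := h'.cap.trans h.cap
  query p hp := (h'.query p (h.depth ▸ hp)).trans (h.query p hp)

/-- The query contains increasing vertices; `s.arr 2` is the residual of the capacity `cap`. -/
structure QueryInv (cap : ℕ → ℕ) (s : Memory) : Prop where
  status : s.reg 10 = 0
  zero : s.arr 3 0 = s.arr 0 (s.reg 6)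
  lt : ∀ p ∈ Icc 1 (s.reg 8), s.arr 3 p < s.reg 9
  le : s.reg 9 ≤ s.reg 3
  inj : Set.InjOn (s.arr 3) (Icc 1 (s.reg 8))
  residual : ∀ i, s.arr 2 i + ((Icc 1 (s.reg 8)).filter fun p => s.arr 1 (s.arr 3 p) = i).card
    = cap i

theorem QueryInv.congr {cap : ℕ → ℕ} {s s' : Memory} {x : ℕ} (h : QueryInv cap s)
    (hs : SameQuery s s' x) (hx : s.reg 9 ≤ x) (hx' : x ≤ s.reg 3) : QueryInv cap s' where
  status := hs.status
  zero := by
    rw [hs.query 0 (Nat.zero_le _), hs.frame.arr 0 (by simp) (by simp), hs.frame.reg 6 (by simp)]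
    exact h.zero
  lt p hp := by
    rw [hs.depth] at hp
    rw [hs.query p (mem_Icc.1 hp).2, hs.vertex]
    exact (h.lt p hp).trans_le hx
  le := by rw [hs.vertex, hs.frame.reg 3 (by simp)]; exact hx'
  inj := by
    rw [hs.depth]
    refine h.inj.congr fun p hp => ?_
    rw [hs.query p (mem_Icc.1 hp).2]
  residual i := by
    rw [hs.cap, hs.depth, hs.frame.arr 1 (by simp) (by simp), ← h.residual i]
    congr 2
    refine filter_congr fun p hp => ?_
    rw [hs.query p (mem_Icc.1 hp).2]

variable {n k r : ℕ} {χ : EdgeColoring n k r}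

/-- The search has been successful. -/
structure SearchFound (χ : EdgeColoring n k r) (cap : ℕ → ℕ) (s s' : Memory) : Prop where
  frame : SearchFrame s s'
  status : s'.reg 10 = 1
  query_zero : s'.arr 3 0 = s.arr 0 (s.reg 6)
  lt : ∀ p ∈ Icc 1 (k - 1), s'.arr 3 p < s.reg 3
  inj : Set.InjOn (s'.arr 3) (Icc 1 (k - 1))
  residual : ∀ i, s'.arr 2 i + ((Icc 1 (k - 1)).filter fun p => s.arr 1 (s'.arr 3 p) = i).card
    = cap i
  answer : answer χ (s'.arr 3) = s.reg 4

theorem SearchFound.of_same {cap : ℕ → ℕ} {s s' s'' : Memory} {x : ℕ} (hs : SameQuery s s' x)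
    (h : SearchFound χ cap s' s'') : SearchFound χ cap s s'' where
  frame := hs.frame.trans h.frame
  status := h.status
  query_zero := by
    rw [h.query_zero, hs.frame.arr 0 (by simp) (by simp), hs.frame.reg 6 (by simp)]
  lt p hp := by rw [← hs.frame.reg 3 (by simp)]; exact h.lt p hp
  inj := h.inj
  residual := by rw [← hs.frame.arr 1 (by simp) (by simp)]; exact h.residual
  answer := h.answer.trans (hs.frame.reg 4 (by simp))

/-- The memory after the current vertex has been appended to the query. -/
structure Pushed (s s' : Memory) : Prop where
  frame : SearchFrame s s'
  depth : s'.reg 8 = s.reg 8 + 1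
  vertex : s'.reg 9 = s.reg 9 + 1
  status : s'.reg 10 = s.reg 10
  cap : s'.arr 2 = Function.update (s.arr 2) (s.arr 1 (s.reg 9)) (s.arr 2 (s.arr 1 (s.reg 9)) - 1)
  query : s'.arr 3 = Function.update (s.arr 3) (s.reg 8 + 1) (s.reg 9)

theorem runs_push (s : Memory) :
    Runs χ pushProg s fun s' t => Pushed s s' ∧ t ≤ 30 := by
  simp only [pushProg, runs_block_cons, runs_block_nil, runs_assign, runs_store]
  refine ⟨⟨⟨fun x hx => ?_, fun a h₂ h₃ => ?_⟩, ?_, ?_, ?_, ?_, ?_⟩, ?_⟩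
  · rw [setReg_reg, if_neg (by omega), setReg_reg, if_neg (by omega)]; rfl
  · simp [setReg_arr, setArr_arr, h₂, h₃]
  all_goals simp [setReg_arr, setArr_arr, setReg_reg, setArr_reg, Expr.eval, Expr.cost]

theorem Pushed.queryInv {cap : ℕ → ℕ} {s s' : Memory} (hs : Pushed s s') (h : QueryInv cap s)
    (hx : s.reg 9 < s.reg 3) (hc : s.arr 2 (s.arr 1 (s.reg 9)) ≠ 0) : QueryInv cap s' where
  status := hs.status.trans h.status
  zero := by
    rw [hs.query, Function.update_of_ne (by omega), hs.frame.arr 0 (by simp) (by simp),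
      hs.frame.reg 6 (by simp)]
    exact h.zero
  lt p hp := by
    rw [hs.depth, mem_Icc] at hp
    rw [hs.query, hs.vertex, Function.update_apply]
    split_ifs with h1
    · omega
    · exact Nat.lt_succ_of_lt (h.lt p (mem_Icc.2 ⟨hp.1, by omega⟩))
  le := by rw [hs.vertex, hs.frame.reg 3 (by simp)]; exact hx
  inj := by
    intro p hp p' hp' he
    rw [coe_Icc, Set.mem_Icc, hs.depth] at hp hp'
    rw [hs.query, Function.update_apply, Function.update_apply] at he
    split_ifs at he with h1 h2 h2
    · omega
    · have := h.lt p' (mem_Icc.2 ⟨hp'.1, by omega⟩); omega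
    · have := h.lt p (mem_Icc.2 ⟨hp.1, by omega⟩); omega
    · exact h.inj (by simp; omega) (by simp; omega) he
  residual i := by
    have key : ((Icc 1 (s.reg 8)).filter fun p => s.arr 1 (s'.arr 3 p) = i) =
        (Icc 1 (s.reg 8)).filter fun p => s.arr 1 (s.arr 3 p) = i := by
      refine filter_congr fun p hp => ?_
      rw [hs.query, Function.update_of_ne]
      have := (mem_Icc.1 hp).2
      omega
    rw [hs.depth, hs.frame.arr 1 (by simp) (by simp), ← h.residual i,
      ← insert_Icc_right_eq_Icc_add_one (by omega), filter_insert, key]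
    have : s'.arr 3 (s.reg 8 + 1) = s.reg 9 := by rw [hs.query, Function.update_self]
    rw [this, hs.cap, Function.update_apply]
    split_ifs with h1 h2 h2
    · rw [card_insert_of_notMem (by simp)]
      subst h1
      omega
    · exact absurd h1.symm h2
    · exact absurd h2.symm h1
    · rfl

/-- Everything that happens between a push and the matching pop restores query and capacities. The
vertex to be removed can therefore be read off the stack, and the net effect is that the candidate
advances by one. -/
theorem runs_pop {s s' s₂ : Memory} {x : ℕ} (hs : Pushed s s') (h : SameQuery s' s₂ x)
    (hc : s.arr 2 (s.arr 1 (s.reg 9)) ≠ 0) :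
    Runs χ popProg s₂ fun s₃ t => SameQuery s s₃ (s.reg 9 + 1) ∧ t ≤ 30 := by
  have hfr := hs.frame.trans h.frame
  have h8 : s₂.reg 8 = s.reg 8 + 1 := h.depth.trans hs.depth
  have hq : s₂.arr 3 (s.reg 8 + 1) = s.reg 9 := by
    rw [h.query _ (by rw [hs.depth]), hs.query, Function.update_self]
  have h1 := hfr.arr 1 (by simp) (by simp)
  simp only [popProg, runs_block_cons, runs_block_nil, runs_assign, runs_store]
  refine ⟨⟨⟨fun x hx => ?_, fun a h₂ h₃ => ?_⟩, ?_, ?_, ?_, ?_, fun p hp => ?_⟩, ?_⟩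
  · rw [setReg_reg, if_neg (by omega), setReg_reg, if_neg (by omega), setArr_reg, setReg_reg,
      if_neg (by omega), hfr.reg x hx]
  · simp only [setReg_arr, setArr_arr, h₂, if_false]
    exact hfr.arr a h₂ h₃
  · simp [setReg_arr, setReg_reg, setArr_reg, Expr.eval, h8]
  · simp [setReg_arr, setReg_reg, setArr_reg, Expr.eval, h8, hq]
  · simp [setReg_reg, setArr_reg, h.status]
  -- The push subtracted `1` from a nonzero capacity, so truncated subtraction is undone exactly.
  · simp [setReg_arr, setArr_arr, setReg_reg, setArr_reg, Expr.eval, h8, hq, h.cap, hs.cap, h1]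
    omega
  · simp only [setReg_arr, setArr_arr]
    rw [if_neg (by simp), h.query p (by rw [hs.depth]; omega), hs.query, Function.update_of_ne]
    omega
  · simp only [Expr.cost]; omega

/-- No choice of `d` further vertices completes the query to an edge of the current color. -/
def NoCompletion (χ : EdgeColoring n k r) (s : Memory) (x d : ℕ) : Prop :=
  ∀ S ⊆ Ico x n, S.card = d → Fits (s.arr 1) (s.arr 2) S →
    colorOf χ ((range (s.reg 8 + 1)).image (s.arr 3) ∪ S) ≠ s.reg 4

/-- The number of subsets with at most `d` elements of a set with `y` elements. -/
def smallSubsets (d y : ℕ) : ℕ := ∑ i ∈ range (d + 1), y.choose i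

/-- Pascal's rule, in the form of the branching of the search: the first candidate is taken or not.
-/
theorem smallSubsets_succ_succ (d y : ℕ) :
    smallSubsets (d + 1) (y + 1) = smallSubsets d y + smallSubsets (d + 1) y := by
  unfold smallSubsets
  rw [sum_range_succ' _ (d + 1), sum_range_succ' (fun i => y.choose i) (d + 1)]
  simp only [Nat.choose_succ_succ, sum_add_distrib, Nat.choose_zero_right]
  ring

theorem one_le_smallSubsets (d y : ℕ) : 1 ≤ smallSubsets d y := by
  unfold smallSubsets
  rw [sum_range_succ']
  simp

theorem smallSubsets_zero (y : ℕ) : smallSubsets 0 y = 1 := by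
  simp [smallSubsets]

theorem Fits.erase {st cap : ℕ → ℕ} {S : Finset ℕ} {x : ℕ} (h : Fits st cap S) (hx : x ∈ S) :
    Fits st (Function.update cap (st x) (cap (st x) - 1)) (S.erase x) := by
  intro i
  rw [filter_erase, Function.update_apply]
  split_ifs with hi
  · rw [card_erase_of_mem (by simp [hx, hi])]
    have := h (st x)
    subst hi
    omega
  · exact (card_le_card (erase_subset _ _)).trans (h i)

/-- This is what allows the search to skip a vertex whose class has no capacity left. -/
theorem Fits.cap_ne_zero {st cap : ℕ → ℕ} {S : Finset ℕ} {x : ℕ} (h : Fits st cap S)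
    (hx : x ∈ S) : cap (st x) ≠ 0 := by
  have h1 := h (st x)
  have : 0 < (S.filter fun w => st w = st x).card := card_pos.2 ⟨x, by simp [hx]⟩
  omega

theorem searchCond_ne_zero {s : Memory} (h : s.reg 10 = 0) : searchCond.eval s ≠ 0 := by
  simp [Expr.eval, h]

/-- The number of steps of the search for `d` further vertices out of `y`, up to a constant. -/
def searchTime (k d y : ℕ) : ℕ := (3 * smallSubsets d y - 2) * (k + 60)

/-- No choice of `d` further vertices, one of them the current vertex `x`, completes the query to
an edge of the current color. -/
def NoCompletionWith (χ : EdgeColoring n k r) (s : Memory) (x d : ℕ) : Prop :=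
  ∀ S ⊆ Ico x n, S.card = d → Fits (s.arr 1) (s.arr 2) S → x ∈ S →
    colorOf χ ((range (s.reg 8 + 1)).image (s.arr 3) ∪ S) ≠ s.reg 4

/-- The search deals with all the completions of the query by `d + 1` vertices that contain the
current vertex. -/
def HandlesChild (χ : EdgeColoring n k r) (d : ℕ) : Prop :=
  ∀ (cap : ℕ → ℕ) (s : Memory), s.reg 0 = k → s.reg 3 = n → QueryInv cap s →
    s.reg 8 + (d + 1) + 1 = k → s.reg 9 < n →
    Reach χ searchCond searchBody s fun s' t =>
      (SearchFound χ cap s s' ∨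
        SameQuery s s' (s.reg 9 + 1) ∧ NoCompletionWith χ s (s.reg 9) (d + 1)) ∧
      t ≤ 3 * smallSubsets d (n - 1 - s.reg 9) * (k + 60)

/-- The search deals with all the completions of the query by `d + 1` vertices. -/
def HandlesLevel (χ : EdgeColoring n k r) (d : ℕ) : Prop :=
  ∀ (cap : ℕ → ℕ) (s : Memory), s.reg 0 = k → s.reg 3 = n → QueryInv cap s →
    s.reg 8 + (d + 1) + 1 = k →
    Reach χ searchCond searchBody s fun s' t =>
      (SearchFound χ cap s s' ∨ SameQuery s s' n ∧ NoCompletion χ s (s.reg 9) (d + 1)) ∧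
      t ≤ searchTime k (d + 1) (n - s.reg 9)

/-- The summand `-2` in `searchTime` leaves room for the push and the pop around a recursive call,
and it still makes the cost of a level exactly additive over its candidates. The truncation is
harmless because `smallSubsets` is at least `1`. -/
theorem searchTime_succ (k d y : ℕ) :
    3 * smallSubsets d y * (k + 60) + searchTime k (d + 1) y = searchTime k (d + 1) (y + 1) := by
  have h1 := one_le_smallSubsets (d + 1) y
  rw [searchTime, searchTime, smallSubsets_succ_succ]
  obtain ⟨b, hb⟩ := Nat.exists_eq_add_of_le h1
  rw [hb, show 3 * (1 + b) - 2 = 3 * b + 1 by omega,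
    show 3 * (smallSubsets d y + (1 + b)) - 2 = 3 * smallSubsets d y + (3 * b + 1) by omega]
  ring

theorem NoCompletionWith.noCompletion {s s' : Memory} {d : ℕ}
    (hbad : NoCompletionWith χ s (s.reg 9) d) (hs : SameQuery s s' (s.reg 9 + 1))
    (h : NoCompletion χ s' (s'.reg 9) d) : NoCompletion χ s (s.reg 9) d := by
  intro S hS hc hfit
  by_cases hx : s.reg 9 ∈ S
  · exact hbad S hS hc hfit hx
  · have := h S (fun w hw => ?_) hc (by rwa [hs.cap, hs.frame.arr 1 (by simp) (by simp)])
    · rw [hs.depth, hs.frame.reg 4 (by simp)] at this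
      convert this using 3
      refine image_congr fun p hp => (hs.query p ?_).symm
      simp at hp
      omega
    · have := mem_Ico.1 (hS hw)
      have hne : w ≠ s.reg 9 := fun h => hx (h ▸ hw)
      rw [hs.vertex, mem_Ico]
      omega

/-- A level is the sequence of its children, one for each candidate; the induction is on the number
of candidates left. -/
theorem HandlesChild.level {d : ℕ} (hd : HandlesChild χ d) : HandlesLevel χ d := by
  intro cap s h0 h3 hinv h8
  induction hy : n - s.reg 9 generalizing s with
  | zero =>
    have hle := hinv.le
    have h9 : s.reg 9 = n := by omega
    refine Reach.refl ⟨.inr ⟨⟨⟨fun _ _ => rfl, fun _ _ _ => rfl⟩, rfl, h9, hinv.status, rfl,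
      fun _ _ => rfl⟩, fun S hS hc _ => ?_⟩, Nat.zero_le _⟩
    rw [h9, Ico_self, subset_empty] at hS
    simp [hS] at hc
  | succ y ih =>
    have hlt : s.reg 9 < n := by omega
    have hcost := searchTime_succ k d y
    refine (hd cap s h0 h3 hinv h8 hlt).trans ?_
    rw [show n - 1 - s.reg 9 = y by omega]
    rintro s' T ⟨h | ⟨hs, hbad⟩, hT⟩
    · exact Reach.refl ⟨.inl h, by omega⟩
    · have hf := hs.frame
      refine (ih s' ((hf.reg 0 (by simp)).trans h0) ((hf.reg 3 (by simp)).trans h3)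
        (hinv.congr hs (by omega) (by omega)) (by rw [hs.depth]; exact h8)
        (by rw [hs.vertex]; omega)).mono ?_
      rintro s'' t ⟨h | ⟨h, hno⟩, ht⟩
      · exact ⟨.inl (h.of_same hs), by omega⟩
      · exact ⟨.inr ⟨hs.trans h, hbad.noCompletion hs hno⟩, by omega⟩

theorem runs_searchBody_skip {s : Memory} (h0 : s.reg 0 = k) (h3 : s.reg 3 = n)
    (h10 : s.reg 10 = 0) (h8 : s.reg 8 + 1 ≠ k) (h9 : s.reg 9 < n)
    (hc : s.arr 2 (s.arr 1 (s.reg 9)) = 0) :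
    Runs χ searchBody s fun s' t => SameQuery s s' (s.reg 9 + 1) ∧ t ≤ 50 := by
  simp only [searchBody, runs_ite, runs_assign, Expr.eval, h0, h3, h8, h9, hc]
  simp only [if_true, if_false, ne_eq, not_true, false_imp_iff, true_and, one_ne_zero,
    not_false_iff, forall_const, and_true]
  refine ⟨⟨⟨fun x hx => ?_, fun _ _ _ => rfl⟩, ?_, ?_, ?_, rfl, fun _ _ => rfl⟩, ?_⟩
  · rw [setReg_reg, if_neg (by omega)]
  · simp [setReg_reg]
  · simp [setReg_reg]
  · simp [setReg_reg, h10]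
  · simp only [Expr.cost]; omega

theorem runs_searchBody_push {s : Memory} (h0 : s.reg 0 = k) (h3 : s.reg 3 = n)
    (h8 : s.reg 8 + 1 ≠ k) (h9 : s.reg 9 < n) (hc : s.arr 2 (s.arr 1 (s.reg 9)) ≠ 0) :
    Runs χ searchBody s fun s' t => Pushed s s' ∧ t ≤ 50 := by
  simp only [searchBody, runs_ite, Expr.eval, h0, h3, h8, h9, hc]
  simp only [if_true, if_false, ne_eq, not_true, false_imp_iff, true_and, one_ne_zero,
    not_false_iff, forall_const, and_true]
  refine fun _ => (runs_push s).mono fun s' t h => ⟨h.1, ?_⟩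
  have := h.2
  simp only [Expr.cost]
  omega

theorem runs_searchBody_pop {s s' s₂ : Memory} (hs : Pushed s s') (h : SameQuery s' s₂ n)
    (h0 : s₂.reg 0 = k) (h3 : s₂.reg 3 = n) (h8 : s₂.reg 8 + 1 ≠ k)
    (hc : s.arr 2 (s.arr 1 (s.reg 9)) ≠ 0) :
    Runs χ searchBody s₂ fun s₃ t => SameQuery s s₃ (s.reg 9 + 1) ∧ t ≤ 50 := by
  have h8' : s₂.reg 8 ≠ 0 := by rw [h.depth, hs.depth]; omega
  simp only [searchBody, runs_ite, Expr.eval, h0, h3, h8, h8', h.vertex]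
  simp only [if_false, ne_eq, not_true, false_imp_iff, true_and, forall_const, and_true,
    lt_irrefl]
  refine fun _ => (runs_pop hs h hc).mono fun s' t h => ⟨h.1, ?_⟩
  have := h.2
  simp only [Expr.cost]
  omega

/-- A full query is asked and, if the color is wrong, popped in the same iteration, so a leaf takes
one push and one further iteration. -/
theorem runs_searchBody_leaf {cap : ℕ → ℕ} {s s' : Memory} (hs : Pushed s s')
    (hinv : QueryInv cap s') (h0 : s'.reg 0 = k) (h8 : s'.reg 8 + 1 = k)
    (hc : s.arr 2 (s.arr 1 (s.reg 9)) ≠ 0) :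
    Runs χ searchBody s' fun s₃ t =>
      (SearchFound χ cap s' s₃ ∨ SameQuery s s₃ (s.reg 9 + 1) ∧
        colorOf χ ((range k).image (s'.arr 3)) ≠ s.reg 4) ∧ t ≤ k + 50 := by
  have h4 := hs.frame.reg 4 (by simp)
  have hk : k - 1 = s'.reg 8 := by omega
  simp only [searchBody, runs_ite, runs_seq, runs_query, runs_assign, Expr.eval, h0, h8,
    setReg_reg, if_true, ne_eq, one_ne_zero, not_false_iff, true_imp_iff]
  refine ⟨⟨fun ha => ?_, fun ha => ?_⟩, fun h => absurd h (by simp)⟩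
  · have ha : answer χ (s'.arr 3) = s'.reg 4 := by by_contra h; simp [h] at ha
    refine ⟨.inl ⟨⟨fun x hx => ?_, fun _ _ _ => rfl⟩, ?_, hinv.zero, ?_, ?_, ?_, ?_⟩, ?_⟩
    · rw [setReg_reg, if_neg (by omega), setReg_reg, if_neg (by omega)]
    · simp [setReg_reg]
    · intro p hp
      exact (hinv.lt p (hk ▸ hp)).trans_le hinv.le
    · rw [hk]; exact hinv.inj
    · rw [hk]; exact hinv.residual
    · exact ha
    · simp only [Expr.cost]; omega
  · have ha : answer χ (s'.arr 3) ≠ s'.reg 4 := by intro h; simp [h] at ha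
    have hsame : SameQuery s' (s'.setReg 11 (answer χ (s'.arr 3))) (s'.reg 9) := by
      refine ⟨⟨fun x hx => ?_, fun _ _ _ => rfl⟩, ?_, ?_, ?_, rfl, fun _ _ => rfl⟩
      · rw [setReg_reg, if_neg (by omega)]
      all_goals simp [setReg_reg, hinv.status]
    refine (runs_pop hs hsame hc).mono fun s₃ t h => ⟨.inr ⟨h.1, ?_⟩, ?_⟩
    · rwa [← answer_eq_colorOf, ← h4]
    · have := h.2; simp only [Expr.cost]; omega

theorem Pushed.searchFound {cap : ℕ → ℕ} {s s' s'' : Memory} (hs : Pushed s s')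
    (h : SearchFound χ cap s' s'') : SearchFound χ cap s s'' where
  frame := hs.frame.trans h.frame
  status := h.status
  query_zero := by
    rw [h.query_zero, hs.frame.arr 0 (by simp) (by simp), hs.frame.reg 6 (by simp)]
  lt p hp := by rw [← hs.frame.reg 3 (by simp)]; exact h.lt p hp
  inj := h.inj
  residual := by rw [← hs.frame.arr 1 (by simp) (by simp)]; exact h.residual
  answer := h.answer.trans (hs.frame.reg 4 (by simp))

theorem Pushed.image_query {s s' : Memory} (hs : Pushed s s') (S : Finset ℕ) :
    (range (s'.reg 8 + 1)).image (s'.arr 3) ∪ S =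
      (range (s.reg 8 + 1)).image (s.arr 3) ∪ insert (s.reg 9) S := by
  have h1 : (range (s.reg 8 + 1)).image (s'.arr 3) = (range (s.reg 8 + 1)).image (s.arr 3) := by
    refine image_congr fun p hp => ?_
    simp at hp
    rw [hs.query, Function.update_of_ne (by omega)]
  rw [hs.depth, range_add_one, image_insert, h1, hs.query, Function.update_self, insert_union,
    union_insert]

/-- Completions that contain the current vertex correspond, by erasing it, to completions of the
pushed query by one vertex less. -/
theorem Pushed.noCompletionWith {s s' : Memory} {d : ℕ} (hs : Pushed s s')
    (h : NoCompletion χ s' (s'.reg 9) d) : NoCompletionWith χ s (s.reg 9) (d + 1) := by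
  intro S hS hcard hfit hx
  have hsub : S.erase (s.reg 9) ⊆ Ico (s'.reg 9) n := by
    intro w hw
    rw [mem_erase] at hw
    have := mem_Ico.1 (hS hw.2)
    rw [hs.vertex, mem_Ico]
    omega
  have := h _ hsub (by rw [card_erase_of_mem hx, hcard]; rfl)
    (by rw [hs.cap, hs.frame.arr 1 (by simp) (by simp)]; exact hfit.erase hx)
  rwa [hs.image_query, insert_erase hx, hs.frame.reg 4 (by simp)] at this

/-- Induction on the depth of the recursion below the current vertex: push it, run the level below
by induction, and pop it. At `d = 0` the push already makes the query full. -/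
theorem handlesChild (d : ℕ) : HandlesChild χ d := by
  induction d with
  | zero =>
    intro cap s h0 h3 hinv h8 h9
    rw [smallSubsets_zero]
    refine Reach.step (searchCond_ne_zero hinv.status) ?_
    by_cases hc : s.arr 2 (s.arr 1 (s.reg 9)) = 0
    · refine (runs_searchBody_skip h0 h3 hinv.status (by omega) h9 hc).mono fun s' t h => ?_
      refine Reach.refl ⟨.inr ⟨h.1, fun S _ _ hf hx => absurd hc (hf.cap_ne_zero hx)⟩, ?_⟩
      have := h.2
      simp only [Expr.cost]
      omega
    · refine (runs_searchBody_push h0 h3 (by omega) h9 hc).mono ?_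
      rintro s' t ⟨hs, ht⟩
      have hinv' := hs.queryInv hinv (h3 ▸ h9) hc
      refine Reach.step (searchCond_ne_zero hinv'.status) ?_
      refine (runs_searchBody_leaf hs hinv' ((hs.frame.reg 0 (by simp)).trans h0)
        (by rw [hs.depth]; exact h8) hc).mono ?_
      rintro s'' t' ⟨h, ht'⟩
      refine Reach.refl ⟨h.imp (hs.searchFound ·) fun h =>
          ⟨h.1, hs.noCompletionWith fun S _ hS _ => ?_⟩, ?_⟩
      · rw [card_eq_zero.1 hS, union_empty, hs.depth, show s.reg 8 + 1 + 1 = k from h8,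
          hs.frame.reg 4 (by simp)]
        exact h.2
      · simp only [Expr.cost]
        omega
  | succ d ih =>
    intro cap s h0 h3 hinv h8 h9
    have hS := one_le_smallSubsets (d + 1) (n - 1 - s.reg 9)
    have hS' : 3 * (k + 60) ≤ 3 * smallSubsets (d + 1) (n - 1 - s.reg 9) * (k + 60) :=
      Nat.mul_le_mul_right _ (by omega)
    have hS'' : searchTime k (d + 1) (n - 1 - s.reg 9) + 2 * (k + 60) ≤
        3 * smallSubsets (d + 1) (n - 1 - s.reg 9) * (k + 60) := by
      rw [searchTime, ← add_mul]
      exact Nat.mul_le_mul_right _ (by omega)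
    refine Reach.step (searchCond_ne_zero hinv.status) ?_
    by_cases hc : s.arr 2 (s.arr 1 (s.reg 9)) = 0
    · refine (runs_searchBody_skip h0 h3 hinv.status (by omega) h9 hc).mono fun s' t h => ?_
      refine Reach.refl ⟨.inr ⟨h.1, fun S _ _ hf hx => absurd hc (hf.cap_ne_zero hx)⟩, ?_⟩
      have := h.2
      simp only [Expr.cost]
      omega
    · refine (runs_searchBody_push h0 h3 (by omega) h9 hc).mono ?_
      rintro s' t ⟨hs, ht⟩
      have hinv' := hs.queryInv hinv (h3 ▸ h9) hc
      have h0' := (hs.frame.reg 0 (by simp)).trans h0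
      have h3' := (hs.frame.reg 3 (by simp)).trans h3
      have h8' : s'.reg 8 + (d + 1) + 1 = k := by rw [hs.depth]; omega
      have hlevel := ih.level cap s' h0' h3' hinv' h8'
      rw [hs.vertex, show n - (s.reg 9 + 1) = n - 1 - s.reg 9 by omega] at hlevel
      refine hlevel.trans ?_
      rintro s'' t' ⟨h | ⟨h, hno⟩, ht'⟩
      · refine Reach.refl ⟨.inl (hs.searchFound h), ?_⟩
        simp only [Expr.cost]
        omega
      · refine Reach.step (searchCond_ne_zero h.status) ?_
        refine (runs_searchBody_pop hs h ((h.frame.reg 0 (by simp)).trans h0')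
          ((h.frame.reg 3 (by simp)).trans h3') (by rw [h.depth]; omega) hc).mono ?_
        rintro s₃ t₃ ⟨h₃, ht₃⟩
        refine Reach.refl ⟨.inr ⟨h₃, hs.noCompletionWith (hs.vertex ▸ hno)⟩, ?_⟩
        simp only [Expr.cost]
        omega

/-- The search fails, and leaves the capacities as they were. -/
structure SearchFailed (χ : EdgeColoring n k r) (s s' : Memory) : Prop where
  frame : SearchFrame s s'
  status : s'.reg 10 = 2
  cap : s'.arr 2 = s.arr 2
  noEdge : ∀ S ⊆ range n, S.card = k - 1 → Fits (s.arr 1) (s.arr 2) S →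
    colorOf χ (insert (s.arr 0 (s.reg 6)) S) ≠ s.reg 4

theorem runs_search (hk : 2 ≤ k) {s : Memory} (h0 : s.reg 0 = k) (h3 : s.reg 3 = n) :
    Runs χ searchProg s fun s' t =>
      (SearchFound χ (s.arr 2) s s' ∨ SearchFailed χ s s') ∧
      t ≤ 3 * smallSubsets (k - 1) n * (k + 60) := by
  simp only [searchProg, runs_block_cons, runs_block_nil, runs_assign, runs_store]
  generalize hs₀ : ((((s.setArr 3 _ _).setReg 8 _).setReg 9 _).setReg 10 _) = s₀
  have hfr : SearchFrame s s₀ := by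
    subst hs₀
    refine ⟨fun x hx => ?_, fun a h₂ h₃ => ?_⟩
    · rw [setReg_reg, if_neg (by omega), setReg_reg, if_neg (by omega), setReg_reg,
        if_neg (by omega), setArr_reg]
    · simp [setReg_arr, setArr_arr, h₃]
  have h8 : s₀.reg 8 = 0 := by subst hs₀; simp [setReg_reg, Expr.eval]
  have h9 : s₀.reg 9 = 0 := by subst hs₀; simp [setReg_reg, Expr.eval]
  have h10 : s₀.reg 10 = 0 := by subst hs₀; simp [setReg_reg, Expr.eval]
  have hq : s₀.arr 3 0 = s.arr 0 (s.reg 6) := by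
    subst hs₀; simp [setReg_arr, setArr_arr, Expr.eval]
  have hcap : s₀.arr 2 = s.arr 2 := by subst hs₀; simp [setReg_arr, setArr_arr]
  have h0' := (hfr.reg 0 (by simp)).trans h0
  have h3' := (hfr.reg 3 (by simp)).trans h3
  have hinv : QueryInv (s.arr 2) s₀ :=
    ⟨h10, by rw [hq, hfr.arr 0 (by simp) (by simp), hfr.reg 6 (by simp)], fun p hp => by
        simp [h8] at hp, by omega, by simp [h8], fun i => by simp [h8, hcap]⟩
  obtain ⟨d, rfl⟩ : ∃ d, k = d + 2 := ⟨k - 2, by omega⟩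
  have hlevel := (handlesChild (χ := χ) d).level (s.arr 2) s₀ h0' h3' hinv (by rw [h8]; omega)
  have hT : searchTime (d + 2) (d + 1) n + 2 * (d + 2 + 60) ≤
      3 * smallSubsets (d + 2 - 1) n * (d + 2 + 60) := by
    have := one_le_smallSubsets (d + 1) n
    rw [searchTime, ← add_mul]
    exact Nat.mul_le_mul_right _ (by rw [show d + 2 - 1 = d + 1 by omega]; omega)
  have hreach : Reach χ searchCond searchBody s₀ fun s' t =>
      (SearchFound χ (s.arr 2) s s' ∨ SearchFailed χ s s') ∧
      t ≤ searchTime (d + 2) (d + 1) n + 60 := by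
    refine hlevel.trans ?_
    rw [h9, Nat.sub_zero]
    rintro s' t ⟨h | ⟨h, hno⟩, ht⟩
    · refine Reach.refl ⟨.inl ⟨hfr.trans h.frame, h.status, ?_, ?_, h.inj, ?_, ?_⟩, by omega⟩
      · rw [h.query_zero, hfr.arr 0 (by simp) (by simp), hfr.reg 6 (by simp)]
      · rw [← hfr.reg 3 (by simp)]; exact h.lt
      · rw [← hfr.arr 1 (by simp) (by simp)]; exact h.residual
      · rw [← hfr.reg 4 (by simp)]; exact h.answer
    -- One more iteration is needed: at depth `0` without candidates there is nothing to pop, and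
    -- the status becomes `2`.
    · refine Reach.step (searchCond_ne_zero h.status) ?_
      have h8' : s'.reg 8 = 0 := h.depth.trans h8
      have h0'' := (h.frame.reg 0 (by simp)).trans h0'
      have h3'' := (h.frame.reg 3 (by simp)).trans h3'
      have h9' : s'.reg 9 = n := h.vertex
      simp only [searchBody, runs_ite, runs_assign, Expr.eval, h8', h0'', h3'', h9']
      simp only [lt_irrefl, if_false, ne_eq, not_true, false_imp_iff, true_and, forall_const]
      refine ⟨fun h => absurd h (by simp), fun _ => Reach.refl ⟨.inr ⟨?_, ?_, ?_, ?_⟩, ?_⟩⟩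
      · refine (hfr.trans h.frame).trans ⟨fun x hx => ?_, fun _ _ _ => rfl⟩
        rw [setReg_reg, if_neg (by omega)]
      · simp [setReg_reg]
      · rw [setReg_arr, h.cap, hcap]
      · intro S hS hc hfit
        have := hno S (by rwa [← range_eq_Ico]) hc
          (by rwa [hcap, hfr.arr 1 (by simp) (by simp)])
        rwa [h8, hfr.reg 4 (by simp), range_one, image_singleton, hq,
          singleton_union] at this
      · simp only [Expr.cost]; omega
  refine hreach.runs ?_
  rintro s' t ⟨h, ht⟩
  refine ⟨?_, h, ?_⟩
  · rcases h with h | h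
    · simp [Expr.eval, h.status]
    · simp [Expr.eval, h.status]
  · simp only [Expr.cost]; omega

end Search

/-! ### Class sizes and capacities -/

/-- The number of vertices of class `i`. -/
def classSize (n : ℕ) (st : ℕ → ℕ) (i : ℕ) : ℕ := ((range n).filter fun w => st w = i).card

theorem classSize_update_of_ne {n : ℕ} {st : ℕ → ℕ} {v c i : ℕ} (h₁ : i ≠ st v) (h₂ : i ≠ c) :
    classSize n (Function.update st v c) i = classSize n st i := by
  unfold classSize
  congr 1
  refine filter_congr fun w _ => ?_
  rw [Function.update_apply]
  split_ifs with h
  · subst h; exact ⟨fun h => absurd h.symm h₂, fun h => absurd h.symm h₁⟩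
  · rfl

theorem classSize_update_self {n : ℕ} {st : ℕ → ℕ} {v c : ℕ} (hv : v < n) (h : st v ≠ c) :
    classSize n (Function.update st v c) c = classSize n st c + 1 := by
  unfold classSize
  rw [← card_insert_of_notMem (a := v) (by simp [h])]
  congr 1
  ext w
  simp only [mem_filter, mem_range, mem_insert, Function.update_apply]
  split_ifs with hw
  · subst hw; simp [hv]
  · simp [hw]

theorem classSize_update_old {n : ℕ} {st : ℕ → ℕ} {v c : ℕ} (hv : v < n) (h : st v ≠ c) :
    classSize n (Function.update st v c) (st v) + 1 = classSize n st (st v) := by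
  have := classSize_update_self (st := Function.update st v c) (c := st v) hv
    (by rw [Function.update_self]; exact h.symm)
  rw [Function.update_idem, Function.update_eq_self] at this
  exact this.symm

theorem classSize_split {n : ℕ} (st : ℕ → ℕ) {S : Finset ℕ} (hS : S ⊆ range n) (i : ℕ) :
    classSize n st i =
      (S.filter fun w => st w = i).card + ((range n \ S).filter fun w => st w = i).card := by
  unfold classSize
  rw [← card_union_of_disjoint, ← filter_union, union_sdiff_of_subset hS]
  exact disjoint_filter_filter disjoint_sdiff

/-- Classes of capacity `0` cannot occur in a fitting set. Within a stage vertices are only moved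
into such classes, and therefore a vertex that could not be extended stays so. -/
theorem Fits.congr {st st' cap : ℕ → ℕ} {S : Finset ℕ} (h : Fits st' cap S)
    (hst : ∀ w ∈ S, cap (st' w) ≠ 0 → st w = st' w) : Fits st cap S := by
  intro i
  refine le_trans (le_of_eq ?_) (h i)
  congr 1
  exact filter_congr fun w hw => by rw [hst w hw (h.cap_ne_zero hw)]

/-- When the total capacity does not exceed the size of the set, there is no slack in any class. -/
theorem Fits.card_eq {st cap : ℕ → ℕ} {S : Finset ℕ} {r : ℕ} (h : Fits st cap S)
    (hcap : ∀ i, r ≤ i → cap i = 0) (hc : ∑ i ∈ range r, cap i ≤ S.card) {i : ℕ} (hi : i < r) :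
    (S.filter fun w => st w = i).card = cap i := by
  have h1 : S.card = ∑ i ∈ range r, (S.filter fun w => st w = i).card :=
    card_eq_sum_card_fiberwise fun w hw => by
      have := h.cap_ne_zero hw
      simp only [coe_range, Set.mem_Iio]
      by_contra hlt
      exact this (hcap _ (by omega))
  have h2 : ∑ i ∈ range r, (S.filter fun w => st w = i).card ≤ ∑ i ∈ range r, cap i :=
    sum_le_sum fun i _ => h i
  exact (sum_eq_sum_iff_of_le fun i _ => h i).1 (by omega) i (mem_range.2 hi)

/-- The number of vertices of class `i` in an edge of stage `t`, apart from a vertex of class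
`0`. -/
def stageCap (k r t i : ℕ) : ℕ := if i = 0 then k - r + t else if t < i ∧ i < r then 1 else 0

theorem stageCap_eq_zero {k r t i : ℕ} (h₀ : i ≠ 0) (h : i ≤ t ∨ r ≤ i) :
    stageCap k r t i = 0 := by
  rw [stageCap, if_neg h₀, if_neg (by omega)]

theorem stageCap_zero (k r t : ℕ) : stageCap k r t 0 = k - r + t := if_pos rfl

theorem sum_stageCap {k r t : ℕ} (hr : r ≤ k) (ht : t < r) :
    ∑ i ∈ range r, stageCap k r t i = k - 1 := by
  obtain ⟨r, rfl⟩ : ∃ r', r = r' + 1 := ⟨r - 1, by omega⟩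
  rw [sum_range_succ', stageCap_zero]
  have : ∑ i ∈ range r, stageCap k (r + 1) t (i + 1) = r - t := by
    have h1 : ∀ i ∈ range r, stageCap k (r + 1) t (i + 1) = if t ≤ i then 1 else 0 := by
      intro i hi
      have := mem_range.1 hi
      rw [stageCap, if_neg (by omega)]
      by_cases h : t ≤ i
      · rw [if_pos (by omega), if_pos h]
      · rw [if_neg (by omega), if_neg h]
    rw [sum_congr rfl h1, ← card_filter, ← Nat.card_Ico]
    congr 1
    ext i
    simp
    omega
  omega

/-! ### The moves of the depth-first walk in a stage -/

section Walk

variable {n k r : ℕ}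

/-- The state of stage `t`: the array `out` holds a loose path with `L` edges of color `t`, and
`cnt` vertices have been moved to class `t`, because they could not be extended. Vertices have
class `r + t` if they lie on the path and may still be extended, and class `r` if they are not used
any more. At the beginning of the stage, the classes were given by `st₀`. -/
structure Walk (χ : EdgeColoring n k r) (t : ℕ) (st₀ st out : ℕ → ℕ) (L cnt : ℕ) : Prop where
  mark : ∀ w, st₀ w = 0 ∧ (st w = 0 ∨ st w = t ∨ st w = r + t) ∨
    (t < st₀ w ∧ st₀ w < r) ∧ (st w = st₀ w ∨ st w = r) ∨
    (st₀ w = r ∨ r + t < st₀ w) ∧ st w = st₀ w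
  out_lt : ∀ p ≤ (k - 1) * L, out p < n
  inj : Set.InjOn out (range ((k - 1) * L + 1))
  used : 0 < L → ∀ p ≤ (k - 1) * L, stageCap k r t (st (out p)) = 0
  color : ∀ i < L, colorOf χ ((Ico (i * (k - 1)) (i * (k - 1) + k)).image out) = t
  alive_mem : ∀ w, st w = r + t → ∃ p ≤ (k - 1) * L, out p = w
  alive_le : ∀ L' ≤ L, ((range ((k - 1) * L' + 1)).filter fun p => st (out p) = r + t).card ≤
    (k - r + t) * L' + 1
  dead_card : classSize n st t = cnt
  extensions : ∃ E, classSize n st 0 + (k - r + t) * E ≤ classSize n st₀ 0 ∧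
    ∀ i, t < i → i < r → classSize n st₀ i ≤ classSize n st i + E
  dead : ∀ w, w < n → st w = t → ∀ S ⊆ range n, S.card = k - 1 →
    Fits st (stageCap k r t) S → colorOf χ (insert w S) ≠ t

/-- A variant of the loop of stage `t`. -/
def potential (n k r t : ℕ) (st out : ℕ → ℕ) (L : ℕ) : ℕ :=
  6 * classSize n st 0 + 3 * classSize n st (r + t) + L +
    if st (out ((k - 1) * L)) = r + t then 0 else 1

variable {χ : EdgeColoring n k r} {t : ℕ} {st₀ st out : ℕ → ℕ} {L cnt : ℕ}

/-- The last vertex of the path cannot be extended. -/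
theorem Walk.kill (h : Walk χ t st₀ st out L cnt) (ht : 0 < t) (htr : t < r)
    (hv : st (out ((k - 1) * L)) = r + t)
    (hno : ∀ S ⊆ range n, S.card = k - 1 → Fits st (stageCap k r t) S →
      colorOf χ (insert (out ((k - 1) * L)) S) ≠ t) :
    Walk χ t st₀ (Function.update st (out ((k - 1) * L)) t) out L (cnt + 1) ∧
      potential n k r t (Function.update st (out ((k - 1) * L)) t) out L <
        potential n k r t st out L := by
  set v := out ((k - 1) * L) with hvdef
  have hvn : v < n := h.out_lt _ le_rfl
  have hne : st v ≠ t := by omega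
  refine ⟨⟨fun w => ?_, h.out_lt, h.inj, fun hL p hp => ?_, h.color, fun w hw => ?_,
    fun L' hL' => ?_, ?_, ?_, fun w hw hwt S hS hc hf => ?_⟩, ?_⟩
  · rw [Function.update_apply]
    split_ifs with hw
    · subst hw
      have := h.mark v
      omega
    · exact h.mark w
  · rw [Function.update_apply]
    split_ifs with hw
    · exact stageCap_eq_zero (by omega) (by omega)
    · exact h.used hL p hp
  · rw [Function.update_apply] at hw
    split_ifs at hw with hwv
    · omega
    · exact h.alive_mem w hw
  · refine (card_le_card fun p hp => ?_).trans (h.alive_le L' hL')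
    simp only [mem_filter, Function.update_apply] at hp ⊢
    refine ⟨hp.1, ?_⟩
    split_ifs at hp with hpv
    · omega
    · exact hp.2
  · rw [classSize_update_self hvn hne, h.dead_card]
  · obtain ⟨E, hE, hE'⟩ := h.extensions
    refine ⟨E, ?_, fun i hi hi' => ?_⟩
    · rwa [classSize_update_of_ne (by omega) (by omega)]
    · rw [classSize_update_of_ne (by omega) (by omega)]
      exact hE' i hi hi'
  -- Class `t` has capacity `0` in stage `t`, so the vertex moved there cannot belong to a fitting
  -- set, and no new fitting set arises.
  · have hf' : Fits st (stageCap k r t) S := by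
      refine hf.congr fun w hwS hcw => ?_
      rw [Function.update_apply] at hcw ⊢
      split_ifs at hcw with hwv
      · exact absurd (stageCap_eq_zero (by omega) (by omega)) hcw
      · rw [if_neg hwv]
    rw [Function.update_apply] at hwt
    split_ifs at hwt with hwv
    · rw [hwv]; exact hno S hS hc hf'
    · exact h.dead w hw hwt S hS hc hf'
  -- Losing an alive vertex lowers the potential by `3`; the indicator raises it by only `1`.
  · have h1 := classSize_update_old hvn hne
    rw [hv] at h1
    rw [potential, potential, classSize_update_of_ne (by omega) (by omega), ← hvdef,
      Function.update_self, if_neg (by omega), if_pos hv]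
    omega

/-- Start a new path. -/
theorem Walk.restart (h : Walk χ t st₀ st out 0 cnt) (ht : 0 < t) (htr : t < r)
    (hv : st (out 0) ≠ r + t) {x : ℕ} (hx : x < n) (hx0 : st x = 0) :
    Walk χ t st₀ (Function.update st x (r + t)) (Function.update out 0 x) 0 cnt ∧
      potential n k r t (Function.update st x (r + t)) (Function.update out 0 x) 0 <
        potential n k r t st out 0 := by
  have hne : st x ≠ r + t := by omega
  refine ⟨⟨fun w => ?_, fun p hp => ?_, ?_, fun hL => absurd hL (by simp), fun i hi => absurd hi
    (by simp), fun w hw => ⟨0, by simp, ?_⟩, fun L' hL' => ?_, ?_, ?_,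
    fun w hw hwt S hS hc hf => ?_⟩, ?_⟩
  · rw [Function.update_apply]
    split_ifs with hw
    · subst hw
      have := h.mark w
      omega
    · exact h.mark w
  · obtain rfl : p = 0 := by simpa using hp
    rwa [Function.update_self]
  · simp
  · rw [Function.update_self]
    rw [Function.update_apply] at hw
    split_ifs at hw with hwv
    · exact hwv.symm
    · obtain ⟨p, hp, rfl⟩ := h.alive_mem w hw
      obtain rfl : p = 0 := by simpa using hp
      exact absurd hw hv
  · obtain rfl : L' = 0 := by omega
    refine (card_filter_le _ _).trans ?_
    simp
  · rw [classSize_update_of_ne (by omega) (by omega), h.dead_card]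
  · obtain ⟨E, hE, hE'⟩ := h.extensions
    refine ⟨E, ?_, fun i hi hi' => ?_⟩
    · have := classSize_update_old hx hne
      rw [hx0] at this
      omega
    · rw [classSize_update_of_ne (by omega) (by omega)]
      exact hE' i hi hi'
  · have hf' : Fits st (stageCap k r t) S := by
      refine hf.congr fun w hwS hcw => ?_
      rw [Function.update_apply] at hcw ⊢
      split_ifs at hcw with hwv
      · exact absurd (stageCap_eq_zero (by omega) (by omega)) hcw
      · rw [if_neg hwv]
    rw [Function.update_apply] at hwt
    split_ifs at hwt with hwv
    · omega
    · exact h.dead w hw hwt S hS hc hf'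
  -- A free vertex of weight `6` becomes alive with weight `3`, and the indicator vanishes.
  · have h1 := classSize_update_old hx hne
    have h2 := classSize_update_self hx hne
    rw [hx0] at h1
    rw [potential, potential, mul_zero, if_neg hv, h2, Function.update_self, Function.update_self,
      if_pos rfl]
    omega

/-- Remove the last edge, all of whose vertices have been dealt with. -/
theorem Walk.pop (h : Walk χ t st₀ st out (L + 1) cnt)
    (hv : ∀ p, (k - 1) * L < p → p ≤ (k - 1) * (L + 1) → st (out p) ≠ r + t) :
    Walk χ t st₀ st out L cnt ∧
      (0 < k - 1 → potential n k r t st out L < potential n k r t st out (L + 1)) := by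
  have hle : (k - 1) * L ≤ (k - 1) * (L + 1) := Nat.mul_le_mul_left _ (by omega)
  -- The bound on alive vertices is part of the invariant for every initial segment of the path, so
  -- it survives the removal of edges.
  refine ⟨⟨h.mark, fun p hp => h.out_lt p (hp.trans hle), h.inj.mono ?_,
    fun _ p hp => h.used (by omega) p (hp.trans hle), fun i hi => h.color i (by omega),
    fun w hw => ?_, fun L' hL' => h.alive_le L' (by omega), h.dead_card, h.extensions, h.dead⟩,
    fun hk => ?_⟩
  · simp only [coe_range]
    exact Set.Iio_subset_Iio (by omega)
  · obtain ⟨p, hp, rfl⟩ := h.alive_mem w hw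
    refine ⟨p, ?_, rfl⟩
    by_contra hlt
    exact hv p (by omega) hp hw
  -- The indicator was already `1` before the removal, so the loss of an edge is a net decrease.
  · have := hv ((k - 1) * (L + 1)) (by rw [mul_add]; omega) le_rfl
    rw [potential, potential, if_neg this]
    split_ifs <;> omega

/-- Choose another last vertex of the last edge. -/
theorem Walk.swap (h : Walk χ t st₀ st out (L + 1) cnt) {p₀ : ℕ} (hp₀ : (k - 1) * L < p₀)
    (hp₀' : p₀ ≤ (k - 1) * (L + 1)) (hv : st (out ((k - 1) * (L + 1))) ≠ r + t)
    (ha : st (out p₀) = r + t) {out' : ℕ → ℕ}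
    (hout : ∀ p, out' p = out (Equiv.swap p₀ ((k - 1) * (L + 1)) p)) :
    Walk χ t st₀ st out' (L + 1) cnt ∧
      potential n k r t st out' (L + 1) < potential n k r t st out (L + 1) := by
  obtain rfl : out' = fun p => out (Equiv.swap p₀ ((k - 1) * (L + 1)) p) := funext hout
  set e := (k - 1) * (L + 1) with he
  set σ := Equiv.swap p₀ e with hσ
  have hkL : e = (k - 1) * L + (k - 1) := by rw [he, mul_add, mul_one]
  have hσle : ∀ p, p ≤ e → σ p ≤ e := by
    intro p hp
    rw [hσ, Equiv.swap_apply_def]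
    split_ifs <;> omega
  -- The first vertex of the last edge, which the preceding edge may share, does not move; only the
  -- order inside the last edge changes.
  have hσlow : ∀ p, p ≤ (k - 1) * L → σ p = p := by
    intro p hp
    rw [hσ]
    exact Equiv.swap_apply_of_ne_of_ne (by omega) (by omega)
  refine ⟨⟨h.mark, fun p hp => h.out_lt _ (hσle p hp), fun p hp p' hp' hpp => ?_,
    fun hL p hp => h.used hL _ (hσle p hp), fun i hi => ?_, fun w hw => ?_, fun L' hL' => ?_,
    h.dead_card, h.extensions, h.dead⟩, ?_⟩
  · simp only [coe_range, Set.mem_Iio] at hp hp'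
    refine σ.injective (h.inj ?_ ?_ hpp)
    · have := hσle p (by omega)
      simp only [coe_range, Set.mem_Iio]
      omega
    · have := hσle p' (by omega)
      simp only [coe_range, Set.mem_Iio]
      omega
  · rw [← h.color i hi, ← Function.comp_def out σ, ← image_image]
    congr 2
    have hi' : i < L ∨ i = L := by omega
    rcases hi' with hi' | rfl
    · have : i * (k - 1) + k - 1 ≤ (k - 1) * L := by
        have := Nat.mul_le_mul_left (k - 1) (show i + 1 ≤ L by omega)
        rw [mul_comm i, Nat.add_sub_assoc (by omega)]
        rwa [mul_add, mul_one] at this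
      conv_rhs => rw [← image_id (s := Ico _ _)]
      refine image_congr fun p hp => ?_
      simp at hp
      exact hσlow p (by omega)
    · have hmul := mul_comm i (k - 1)
      refine eq_of_subset_of_card_le (fun p hp => ?_)
          (by rw [card_image_of_injective _ σ.injective])
      obtain ⟨p', hp', rfl⟩ := mem_image.1 hp
      rw [mem_Ico] at hp' ⊢
      rw [hσ, Equiv.swap_apply_def]
      split_ifs <;> omega
  · obtain ⟨p, hp, rfl⟩ := h.alive_mem w hw
    exact ⟨σ p, hσle p hp, by simp [hσ]⟩
  · refine le_trans ?_ (h.alive_le L' hL')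
    rcases (show L' ≤ L ∨ L' = L + 1 by omega) with h' | rfl
    · have := Nat.mul_le_mul_left (k - 1) h'
      refine le_of_eq (congrArg _ (filter_congr fun p hp => ?_))
      have := mem_range.1 hp
      rw [hσlow p (by omega)]
    · refine card_le_card_of_injOn σ (fun p hp => ?_) σ.injective.injOn
      simp only [coe_filter, mem_range, Set.mem_ofPred_eq] at hp ⊢
      have := hσle p (by omega)
      exact ⟨by omega, hp.2⟩
  · rw [potential, potential, ← he, if_neg hv, if_pos]
    · omega
    · simpa [hσ] using ha

/-- Labels change only inside `S`, so outside of `S` each class contributes the same before and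
after. -/
theorem classSize_extend {n : ℕ} {st st' : ℕ → ℕ} {S : Finset ℕ} (hS : S ⊆ range n)
    (hst : ∀ w, w ∉ S → st' w = st w) {i a b : ℕ}
    (ha : (S.filter fun w => st w = i).card = a) (hb : (S.filter fun w => st' w = i).card = b) :
    classSize n st' i + a = classSize n st i + b := by
  rw [classSize_split st' hS, classSize_split st hS, ha, hb]
  have : ((range n \ S).filter fun w => st' w = i) = (range n \ S).filter fun w => st w = i :=
    filter_congr fun w hw => by rw [hst w (mem_sdiff.1 hw).2]
  rw [this]
  omega

/-- Append an edge to the path. -/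
theorem Walk.extend (h : Walk χ t st₀ st out L cnt) (ht : 0 < t) (htr : t < r) (hr : r ≤ k)
    (hv : st (out ((k - 1) * L)) = r + t) {q : ℕ → ℕ}
    (hqn : ∀ p ∈ Icc 1 (k - 1), q p < n) (hqi : Set.InjOn q (Icc 1 (k - 1)))
    (hfit : Fits st (stageCap k r t) ((Icc 1 (k - 1)).image q))
    (hcol : colorOf χ (insert (out ((k - 1) * L)) ((Icc 1 (k - 1)).image q)) = t)
    {st' out' : ℕ → ℕ}
    (hst : ∀ w, st' w = if w ∈ (Icc 1 (k - 1)).image q then (if st w = 0 then r + t else r)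
      else st w)
    (hout : ∀ p, out' p = if (k - 1) * L < p ∧ p ≤ (k - 1) * L + (k - 1) then
      q (p - (k - 1) * L) else out p) :
    Walk χ t st₀ st' out' (L + 1) cnt ∧
      potential n k r t st' out' (L + 1) < potential n k r t st out L := by
  set S := (Icc 1 (k - 1)).image q with hSdef
  have hS : S ⊆ range n := fun w hw => by
    obtain ⟨p, hp, rfl⟩ := mem_image.1 hw
    exact mem_range.2 (hqn p hp)
  have hScard : S.card = k - 1 := by
    rw [hSdef, card_image_of_injOn hqi, Nat.card_Icc, Nat.add_sub_cancel]
  set e := (k - 1) * L with he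
  have hkL : (k - 1) * (L + 1) = e + (k - 1) := by rw [mul_add, mul_one]
  have hSst : ∀ w ∈ S, stageCap k r t (st w) ≠ 0 := fun w hw => hfit.cap_ne_zero hw
  have hSst' : ∀ w ∈ S, st w = 0 ∨ t < st w ∧ st w < r := fun w hw => by
    by_contra hcon
    exact hSst w hw (stageCap_eq_zero (by omega) (by omega))
  have hoff : ∀ w, w ∉ S → st' w = st w := fun w hw => by rw [hst, if_neg hw]
  have hon : ∀ w ∈ S, st' w = if st w = 0 then r + t else r := fun w hw => by
    rw [hst, if_pos hw]
  have hqS : ∀ p, e < p → p ≤ e + (k - 1) → q (p - e) ∈ S := fun p h1 h2 =>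
    mem_image_of_mem q (mem_Icc.2 ⟨by omega, by omega⟩)
  -- Vertices of a nonempty path have classes of capacity `0`. For the empty path the only relevant
  -- vertex is its start, which is alive.
  have hpathS : ∀ p ≤ e, out p ∉ S := by
    intro p hp hpS
    rcases Nat.eq_zero_or_pos L with hL | hL
    · have he0 : e = 0 := by simp [he, hL]
      obtain rfl : p = e := by omega
      have := hSst' _ hpS
      omega
    · exact hSst _ hpS (h.used hL p hp)
  have hlow : ∀ p ≤ e, out' p = out p := fun p hp => by rw [hout, if_neg (by omega)]
  have hhigh : ∀ p, e < p → p ≤ e + (k - 1) → out' p = q (p - e) := fun p h1 h2 => by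
    rw [hout, if_pos ⟨h1, h2⟩]
  have hlowst : ∀ p ≤ e, st' (out' p) = st (out p) := fun p hp => by
    rw [hlow p hp, hoff _ (hpathS p hp)]
  -- The stage capacities add up to `k - 1`, the size of `S`, so `S` takes exactly the prescribed
  -- number from each class.
  have hfull := fun {i : ℕ} (hi : i < r) =>
    hfit.card_eq (fun i hi => stageCap_eq_zero (by omega) (.inr hi))
      (by rw [sum_stageCap hr htr, hScard]) hi
  have h0 : (S.filter fun w => st w = 0).card = k - r + t := by
    rw [hfull (by omega), stageCap_zero]
  have hnone : ∀ i, i < r → (S.filter fun w => st' w = i).card = 0 := by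
    intro i hi
    rw [card_eq_zero, filter_eq_empty_iff]
    intro w hw
    rw [hon w hw]
    split_ifs <;> omega
  have halive : (S.filter fun w => st' w = r + t) = S.filter fun w => st w = 0 := by
    refine filter_congr fun w hw => ?_
    rw [hon w hw]
    split_ifs <;> omega
  have hc0 : classSize n st' 0 + (k - r + t) = classSize n st 0 :=
    classSize_extend hS hoff h0 (hnone 0 (by omega))
  have hca : classSize n st' (r + t) = classSize n st (r + t) + (k - r + t) :=
    classSize_extend hS hoff (a := 0) (card_eq_zero.2 (filter_eq_empty_iff.2 fun w hw => by
      have := hSst' w hw; omega)) (by rw [halive, h0])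
  refine ⟨⟨fun w => ?_, fun p hp => ?_, fun p hp p' hp' hpp => ?_, fun _ p hp => ?_,
    fun i hi => ?_, fun w hw => ?_, fun L' hL' => ?_, ?_, ?_,
    fun w hw hwt S' hS' hc hf => ?_⟩, ?_⟩
  · have := h.mark w
    by_cases hw : w ∈ S
    · have h1 := hSst' w hw
      rw [hon w hw]
      split_ifs <;> omega
    · rwa [hoff w hw]
  · rw [hkL] at hp
    by_cases hpe : p ≤ e
    · rw [hlow p hpe]; exact h.out_lt p hpe
    · rw [hhigh p (by omega) hp]
      exact mem_range.1 (hS (hqS p (by omega) hp))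
  · simp only [coe_range, Set.mem_Iio, hkL] at hp hp'
    by_cases hpe : p ≤ e <;> by_cases hpe' : p' ≤ e
    · rw [hlow p hpe, hlow p' hpe'] at hpp
      refine h.inj ?_ ?_ hpp <;> simp only [coe_range, Set.mem_Iio] <;> omega
    · rw [hlow p hpe, hhigh p' (by omega) (by omega)] at hpp
      exact absurd (hpp ▸ hqS p' (by omega) (by omega)) (hpathS p hpe)
    · rw [hlow p' hpe', hhigh p (by omega) (by omega)] at hpp
      exact absurd (hpp ▸ hqS p (by omega) (by omega)) (hpathS p' hpe')
    · rw [hhigh p (by omega) (by omega), hhigh p' (by omega) (by omega)] at hpp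
      have := hqi (by simp only [coe_Icc, Set.mem_Icc]; omega)
        (by simp only [coe_Icc, Set.mem_Icc]; omega) hpp
      omega
  · rw [hkL] at hp
    by_cases hpe : p ≤ e
    · rw [hlowst p hpe]
      rcases Nat.eq_zero_or_pos L with hL | hL
      · have he0 : e = 0 := by simp [he, hL]
        obtain rfl : p = e := by omega
        rw [hv]
        exact stageCap_eq_zero (by omega) (by omega)
      · exact h.used hL p hpe
    · rw [hhigh p (by omega) hp, hon _ (hqS p (by omega) hp)]
      split_ifs <;> exact stageCap_eq_zero (by omega) (by omega)
  · rcases (show i < L ∨ i = L by omega) with hi' | rfl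
    · rw [← h.color i hi']
      congr 1
      refine image_congr fun p hp => ?_
      have : i * (k - 1) + (k - 1) ≤ e := by
        have := Nat.mul_le_mul_left (k - 1) (show i + 1 ≤ L by omega)
        rwa [mul_add, mul_one, mul_comm] at this
      simp at hp
      exact hlow p (by omega)
    · rw [← hcol, mul_comm i, ← he]
      congr 1
      ext w
      simp only [mem_image, mem_Ico, mem_insert, hSdef, mem_Icc]
      constructor
      · rintro ⟨p, hp, rfl⟩
        rcases (show p = e ∨ e < p by omega) with rfl | hpe
        · exact .inl (hlow e le_rfl)
        · exact .inr ⟨p - e, by omega, (hhigh p hpe (by omega)).symm⟩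
      · rintro (rfl | ⟨p, hp, rfl⟩)
        · exact ⟨e, by omega, hlow e le_rfl⟩
        · refine ⟨e + p, by omega, ?_⟩
          rw [hhigh _ (by omega) (by omega), Nat.add_sub_cancel_left]
  · by_cases hwS : w ∈ S
    · obtain ⟨p, hp, rfl⟩ := mem_image.1 hwS
      rw [mem_Icc] at hp
      refine ⟨e + p, by omega, ?_⟩
      rw [hhigh _ (by omega) (by omega), Nat.add_sub_cancel_left]
    · rw [hoff w hwS] at hw
      obtain ⟨p, hp, rfl⟩ := h.alive_mem w hw
      exact ⟨p, by omega, hlow p hp⟩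
  · have hold : ∀ L' ≤ L, ((range ((k - 1) * L' + 1)).filter fun p => st' (out' p) = r + t).card ≤
        (k - r + t) * L' + 1 := by
      intro L' hL'
      refine le_trans (le_of_eq (congrArg _ (filter_congr fun p hp => ?_))) (h.alive_le L' hL')
      have h1 := Nat.mul_le_mul_left (k - 1) hL'
      have h2 := mem_range.1 hp
      rw [hlowst p (by omega)]
    rcases (show L' ≤ L ∨ L' = L + 1 by omega) with h' | rfl
    · exact hold L' h'
    · have hsplit : (range ((k - 1) * (L + 1) + 1)).filter (fun p => st' (out' p) = r + t) ⊆
          (range (e + 1)).filter (fun p => st' (out' p) = r + t) ∪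
          ((Icc 1 (k - 1)).filter fun p => st' (q p) = r + t).image (e + ·) := by
        intro p hp
        rw [mem_filter, mem_range, hkL] at hp
        by_cases hpe : p ≤ e
        · exact mem_union_left _ (mem_filter.2 ⟨mem_range.2 (by omega), hp.2⟩)
        · refine mem_union_right _ (mem_image.2 ⟨p - e, ?_, by omega⟩)
          rw [mem_filter, mem_Icc, ← hhigh p (by omega) (by omega)]
          exact ⟨by omega, hp.2⟩
      have hnew : ((Icc 1 (k - 1)).filter fun p => st' (q p) = r + t).card ≤ k - r + t := by
        rw [← h0, ← halive]
        refine card_le_card_of_injOn q (fun p hp => ?_) (hqi.mono fun p hp => ?_)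
        · simp only [coe_filter, Set.mem_ofPred_eq] at hp ⊢
          exact ⟨mem_image_of_mem q hp.1, hp.2⟩
        · simp only [coe_filter, Set.mem_ofPred_eq] at hp
          exact hp.1
      have h1 := card_le_card hsplit
      have h2 := card_union_le ((range (e + 1)).filter (fun p => st' (out' p) = r + t))
        (((Icc 1 (k - 1)).filter fun p => st' (q p) = r + t).image (e + ·))
      have h3 := card_image_le (s := (Icc 1 (k - 1)).filter fun p => st' (q p) = r + t)
        (f := (e + ·))
      have h4 := hold L le_rfl
      rw [← he] at h4
      rw [Nat.mul_add (k - r + t) L 1, mul_one]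
      omega
  · rw [← h.dead_card]
    have := classSize_extend hS hoff (i := t) (a := 0) (card_eq_zero.2 (filter_eq_empty_iff.2
      fun w hw => by have := hSst' w hw; omega)) (hnone t htr)
    omega
  · obtain ⟨E, hE, hE'⟩ := h.extensions
    -- The new edge takes `k - r + t` vertices from the reservoir and exactly one from each higher
    -- class.
    refine ⟨E + 1, ?_, fun i hi hi' => ?_⟩
    · rw [mul_add, mul_one]
      omega
    · have h1 := hE' i hi hi'
      have h2 := hfull hi'
      rw [stageCap, if_neg (by omega), if_pos ⟨hi, hi'⟩] at h2
      have := classSize_extend hS hoff h2 (hnone i hi')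
      omega
  · have hwS : w ∉ S := fun hwS => by
      rw [hon w hwS] at hwt
      split_ifs at hwt <;> omega
    rw [hoff w hwS] at hwt
    refine h.dead w hw hwt S' hS' hc (hf.congr fun x hx hcx => ?_)
    by_cases hxS : x ∈ S
    · exfalso
      refine hcx ?_
      rw [hon x hxS]
      split_ifs <;> exact stageCap_eq_zero (by omega) (by omega)
    · exact (hoff x hxS).symm
  -- Here `k - r + t ≥ 1` vertices drop from weight `6` to weight `3`, which pays for the new edge
  -- and for the indicator.
  · rw [potential, potential, hca, if_pos hv]
    split_ifs <;> omega

end Walk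

/-! ### Programs for the moves -/

/-- Put into register `9` the first vertex whose class is the content of register `10`. -/
def findProg : Program := .block [
  .assign 9 (.const 0),
  .while (.eq (.eq (.get 1 (.reg 9)) (.reg 10)) (.const 0)) (.assign 9 (.add (.reg 9) (.const 1)))]

/-- A successful search stops with its capacities still reduced; they are given back here, vertex by
vertex. Register `12` holds the mark `r + t` of alive vertices and register `2` the mark `r` of
spent ones. -/
def appendBody : Program := .block [
  .assign 9 (.get 3 (.reg 8)),
  .store 2 (.get 1 (.reg 9)) (.add (.get 2 (.get 1 (.reg 9))) (.const 1)),
  .store 0 (.add (.reg 6) (.reg 8)) (.reg 9),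
  .ite (.get 1 (.reg 9)) (.store 1 (.reg 9) (.reg 2)) (.store 1 (.reg 9) (.reg 12)),
  .assign 8 (.add (.reg 8) (.const 1))]

/-- Append the edge that has been found to the path. -/
def appendProg : Program := .block [
  .assign 8 (.const 1),
  .while (.lt (.reg 8) (.reg 0)) appendBody,
  .assign 5 (.add (.reg 5) (.const 1)),
  .assign 6 (.sub (.add (.reg 6) (.reg 0)) (.const 1))]

abbrev scanCond : Expr :=
  .eq (.add (.lt (.reg 9) (.reg 6)) (.eq (.eq (.get 1 (.get 0 (.reg 9))) (.reg 12)) (.const 0)))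
    (.const 2)

/-- Look for a vertex of the last edge that may still be extended. -/
def scanProg : Program := .block [
  .assign 9 (.sub (.add (.reg 6) (.const 2)) (.reg 0)),
  .while scanCond (.assign 9 (.add (.reg 9) (.const 1)))]

def restartProg : Program := .block [
  .assign 10 (.const 0),
  findProg,
  .store 0 (.const 0) (.reg 9),
  .store 1 (.reg 9) (.reg 12)]

def retreatProg : Program := .block [
  scanProg,
  .ite (.lt (.reg 9) (.reg 6))
    (.block [
      .assign 10 (.get 0 (.reg 9)),
      .store 0 (.reg 9) (.get 0 (.reg 6)),
      .store 0 (.reg 6) (.reg 10)])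
    (.block [
      .assign 5 (.sub (.reg 5) (.const 1)),
      .assign 6 (.sub (.add (.reg 6) (.const 1)) (.reg 0))])]

def advanceProg : Program := .block [
  searchProg,
  .ite (.eq (.reg 10) (.const 1)) appendProg
    (.block [
      .store 1 (.get 0 (.reg 6)) (.reg 4),
      .assign 7 (.add (.reg 7) (.const 1))])]

/-- Register `4` is the stage, register `5` the number of edges of the path, register `6` the
position of its end vertex, and register `7` counts the vertices moved to the class of the stage. -/
def walkBody : Program :=
  .ite (.eq (.get 1 (.get 0 (.reg 6))) (.reg 12)) advanceProg
    (.ite (.reg 5) retreatProg restartProg)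

section

variable {n k r : ℕ} {χ : EdgeColoring n k r}

theorem setReg_setReg (s : Memory) (x v v' : ℕ) : (s.setReg x v).setReg x v' = s.setReg x v' := by
  simp [Memory.setReg]

theorem runs_find {s : Memory} (h : ∃ x < n, s.arr 1 x = s.reg 10) :
    Runs χ findProg s fun s' t =>
      (∃ y < n, s.arr 1 y = s.reg 10 ∧ s' = s.setReg 9 y) ∧ t ≤ 20 * (n + 1) := by
  obtain ⟨x, hx, hx'⟩ := h
  simp only [findProg, runs_block_cons, runs_block_nil, runs_assign]
  refine (runs_while (fun s' => ∃ y ≤ x, s' = s.setReg 9 y) (fun s' => x - s'.reg 9) 10 ?_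
    ⟨0, Nat.zero_le _, rfl⟩).mono ?_
  · rintro s' ⟨y, hy, rfl⟩ hc
    simp only [runs_assign]
    have hne : y ≠ x := by
      rintro rfl
      simp [Expr.eval, setReg_arr, setReg_reg, hx'] at hc
    refine ⟨⟨y + 1, by omega, ?_⟩, ?_, ?_⟩
    · simp [setReg_setReg, Expr.eval, setReg_reg]
    · simp [Expr.eval, setReg_reg]; omega
    · simp [Expr.cost]
  · rintro s' t ⟨⟨y, hy, rfl⟩, hc, ht⟩
    refine ⟨⟨y, by omega, ?_, rfl⟩, ?_⟩
    · by_contra hne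
      simp [Expr.eval, setReg_arr, setReg_reg, hne] at hc
    · simp [setReg_reg, Expr.cost] at ht ⊢
      omega

theorem runs_scan {s : Memory} (hk : s.reg 0 = k) (hk2 : 2 ≤ k) (he : k - 1 ≤ s.reg 6) :
    Runs χ scanProg s fun s' t =>
      (∃ y, s.reg 6 + 2 - k ≤ y ∧ y ≤ s.reg 6 ∧ s' = s.setReg 9 y ∧
        (∀ p, s.reg 6 + 2 - k ≤ p → p < y → s.arr 1 (s.arr 0 p) ≠ s.reg 12) ∧
        (y < s.reg 6 → s.arr 1 (s.arr 0 y) = s.reg 12)) ∧ t ≤ 30 * (k + 1) := by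
  simp only [scanProg, runs_block_cons, runs_block_nil, runs_assign]
  refine (runs_while (fun s' => ∃ y, s.reg 6 + 2 - k ≤ y ∧ y ≤ s.reg 6 ∧ s' = s.setReg 9 y ∧
    ∀ p, s.reg 6 + 2 - k ≤ p → p < y → s.arr 1 (s.arr 0 p) ≠ s.reg 12)
    (fun s' => s.reg 6 - s'.reg 9) 10 ?_
    ⟨s.reg 6 + 2 - k, le_rfl, by omega, ?_, fun p hp hp' => absurd hp' (by omega)⟩).mono ?_
  · rintro s' ⟨y, hy, hy', rfl, hall⟩ hc
    simp only [runs_assign]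
    have hc' : y < s.reg 6 ∧ s.arr 1 (s.arr 0 y) ≠ s.reg 12 := by
      by_contra hcon
      apply hc
      rw [not_and_or, not_lt, not_not] at hcon
      rcases hcon with h | h
      · simp [Expr.eval, setReg_reg, setReg_arr, not_lt.2 h]
        split_ifs <;> simp
      · simp [Expr.eval, setReg_reg, setReg_arr, h]
        split_ifs <;> simp
    refine ⟨⟨y + 1, by omega, by omega, ?_, fun p hp hp' => ?_⟩, ?_, ?_⟩
    · simp [setReg_setReg, Expr.eval, setReg_reg]
    · rcases (show p < y ∨ p = y by omega) with h | rfl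
      · exact hall p hp h
      · exact hc'.2
    · simp [Expr.eval, setReg_reg]; omega
    · simp [Expr.cost]
  · simp [Expr.eval, hk]
  · rintro s' t ⟨⟨y, hy, hy', rfl, hall⟩, hc, ht⟩
    refine ⟨⟨y, hy, hy', rfl, hall, fun hlt => ?_⟩, ?_⟩
    · by_contra hne
      simp [Expr.eval, setReg_arr, setReg_reg, hne, hlt] at hc
    · simp [setReg_reg, Expr.eval, Expr.cost, hk] at ht ⊢
      have h1 : s.reg 6 - (s.reg 6 + 2 - k) ≤ k := by omega
      have := Nat.mul_le_mul_right 22 h1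
      omega

/-- The memory during the execution of `appendProg`, started with memory `s`. -/
structure AppendInv (k : ℕ) (cap : ℕ → ℕ) (s s' : Memory) : Prop where
  reg : ∀ x, x ≠ 8 → x ≠ 9 → s'.reg x = s.reg x
  arr : ∀ a, 3 ≤ a → s'.arr a = s.arr a
  pos : 1 ≤ s'.reg 8
  le : s'.reg 8 ≤ k
  out : ∀ p, s'.arr 0 p =
    if s.reg 6 < p ∧ p < s.reg 6 + s'.reg 8 then s.arr 3 (p - s.reg 6) else s.arr 0 p
  class_eq : ∀ w, s'.arr 1 w = if w ∈ (Ico 1 (s'.reg 8)).image (s.arr 3) then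
    (if s.arr 1 w = 0 then s.reg 12 else s.reg 2) else s.arr 1 w
  cap_eq : ∀ i, s'.arr 2 i +
    ((Ico (s'.reg 8) k).filter fun p => s.arr 1 (s.arr 3 p) = i).card = cap i

/-- The vertices of the query are distinct, so the one being treated has not been relabelled yet,
and its present class is the one whose capacity the search has consumed. -/
theorem AppendInv.step {cap : ℕ → ℕ} {s s' : Memory} (hinj : Set.InjOn (s.arr 3) (Icc 1 (k - 1)))
    (h : AppendInv k cap s s') (hlt : s'.reg 8 < k) :
    Runs χ appendBody s' fun s'' t =>
      AppendInv k cap s s'' ∧ s''.reg 8 = s'.reg 8 + 1 ∧ t ≤ 60 := by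
  set m := s'.reg 8 with hm
  have hq : s'.arr 3 = s.arr 3 := h.arr 3 le_rfl
  have hmem : s.arr 3 m ∉ (Ico 1 m).image (s.arr 3) := by
    intro hmem
    obtain ⟨p, hp, hpm⟩ := mem_image.1 hmem
    have h1 := mem_Ico.1 hp
    have := hinj (by simp; omega) (by simp; have := h.pos; omega) hpm
    omega
  have hcls : s'.arr 1 (s.arr 3 m) = s.arr 1 (s.arr 3 m) := by rw [h.class_eq, if_neg hmem]
  have h2 := h.reg 2 (by simp) (by simp)
  have h6 := h.reg 6 (by simp) (by simp)
  have h12 := h.reg 12 (by simp) (by simp)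
  have hpos := h.pos
  have key : ∀ s'', (∀ x, x ≠ 8 → x ≠ 9 → s''.reg x = s'.reg x) → s''.reg 8 = m + 1 →
      (∀ a, 3 ≤ a → s''.arr a = s'.arr a) →
      s''.arr 0 = Function.update (s'.arr 0) (s.reg 6 + m) (s.arr 3 m) →
      s''.arr 1 = Function.update (s'.arr 1) (s.arr 3 m)
        (if s.arr 1 (s.arr 3 m) = 0 then s.reg 12 else s.reg 2) →
      s''.arr 2 = Function.update (s'.arr 2) (s.arr 1 (s.arr 3 m))
        (s'.arr 2 (s.arr 1 (s.arr 3 m)) + 1) →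
      AppendInv k cap s s'' := by
    intro s'' hr h8 ha hout hcl hcap
    refine ⟨fun x hx hx' => (hr x hx hx').trans (h.reg x hx hx'),
      fun a h3 => (ha a h3).trans (h.arr a h3), by omega, by omega, fun p => ?_, fun w => ?_,
      fun i => ?_⟩
    · rw [hout, Function.update_apply, h.out, h8]
      by_cases hp : p = s.reg 6 + m
      · rw [if_pos hp, if_pos (by omega), hp, Nat.add_sub_cancel_left]
      · rw [if_neg hp]
        exact if_congr (by omega) rfl rfl
    · rw [hcl, Function.update_apply, h.class_eq, h8, Nat.Ico_succ_right_eq_insert_Ico hpos,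
        image_insert]
      by_cases hw : w = s.arr 3 m
      · subst hw
        rw [if_pos (rfl : s.arr 3 m = s.arr 3 m), if_pos (mem_insert_self _ _)]
      · rw [if_neg hw]
        exact if_congr (by rw [mem_insert]; tauto) rfl rfl
    · rw [hcap, h8, ← h.cap_eq i, ← hm, ← insert_Ico_add_one_left_eq_Ico hlt, filter_insert,
        Function.update_apply]
      by_cases hi : i = s.arr 1 (s.arr 3 m)
      · rw [if_pos hi, if_pos hi.symm, card_insert_of_notMem (by simp), hi]
        omega
      · rw [if_neg hi, if_neg (fun h => hi h.symm)]
  simp only [appendBody, runs_block_cons, runs_block_nil, runs_assign, runs_store, runs_ite]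
  constructor
  · intro hne
    refine ⟨key _ (fun x h8 h9 => ?_) ?_ (fun a ha => ?_) ?_ ?_ ?_, ?_, ?_⟩
    · simp [setReg_reg, setArr_reg, h8, h9]
    · simp [setReg_reg, setArr_reg, Expr.eval, hm]
    · simp [setReg_arr, setArr_arr, show a ≠ 0 by omega, show a ≠ 1 by omega, show a ≠ 2 by omega]
    · simp [setReg_arr, setArr_arr, setReg_reg, setArr_reg, Expr.eval, hq, h6, ← hm]
    · simp [setReg_arr, setArr_arr, setReg_reg, setArr_reg, Expr.eval, hq, h2, ← hm, hcls] at hne ⊢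
      simp [hne]
    · simp [setReg_arr, setArr_arr, setReg_reg, setArr_reg, Expr.eval, hq, ← hm, hcls]
    · simp [setReg_reg, setArr_reg, Expr.eval, hm]
    · simp [Expr.cost]
  · intro hne
    refine ⟨key _ (fun x h8 h9 => ?_) ?_ (fun a ha => ?_) ?_ ?_ ?_, ?_, ?_⟩
    · simp [setReg_reg, setArr_reg, h8, h9]
    · simp [setReg_reg, setArr_reg, Expr.eval, hm]
    · simp [setReg_arr, setArr_arr, show a ≠ 0 by omega, show a ≠ 1 by omega, show a ≠ 2 by omega]
    · simp [setReg_arr, setArr_arr, setReg_reg, setArr_reg, Expr.eval, hq, h6, ← hm]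
    · simp [setReg_arr, setArr_arr, setReg_reg, setArr_reg, Expr.eval, hq, h12, ← hm, hcls] at hne ⊢
      simp [hne]
    · simp [setReg_arr, setArr_arr, setReg_reg, setArr_reg, Expr.eval, hq, ← hm, hcls]
    · simp [setReg_reg, setArr_reg, Expr.eval, hm]
    · simp [Expr.cost]

/-- The effect of `appendProg`. -/
structure Appended (k : ℕ) (cap : ℕ → ℕ) (s s' : Memory) : Prop where
  reg : ∀ x, x < 5 ∨ 9 < x → s'.reg x = s.reg x
  edges : s'.reg 5 = s.reg 5 + 1
  last : s'.reg 6 = s.reg 6 + (k - 1)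
  dead : s'.reg 7 = s.reg 7
  arr : ∀ a, 3 ≤ a → s'.arr a = s.arr a
  out : ∀ p, s'.arr 0 p =
    if s.reg 6 < p ∧ p ≤ s.reg 6 + (k - 1) then s.arr 3 (p - s.reg 6) else s.arr 0 p
  class_eq : ∀ w, s'.arr 1 w = if w ∈ (Icc 1 (k - 1)).image (s.arr 3) then
    (if s.arr 1 w = 0 then s.reg 12 else s.reg 2) else s.arr 1 w
  cap_eq : s'.arr 2 = cap

theorem runs_append {cap : ℕ → ℕ} {s : Memory} (hk : 2 ≤ k) (h0 : s.reg 0 = k)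
    (hinj : Set.InjOn (s.arr 3) (Icc 1 (k - 1)))
    (hcap : ∀ i, s.arr 2 i + ((Icc 1 (k - 1)).filter fun p => s.arr 1 (s.arr 3 p) = i).card
      = cap i) :
    Runs χ appendProg s fun s' t => Appended k cap s s' ∧ t ≤ 100 * (k + 1) := by
  have hIcc : Icc 1 (k - 1) = Ico 1 k := by ext; simp; omega
  simp only [appendProg, runs_block_cons, runs_block_nil, runs_assign]
  refine (runs_while (AppendInv k cap s) (fun s' => k - s'.reg 8) 60 ?_ ?_).mono ?_
  · intro s' h hc
    have h0' : s'.reg 0 = k := (h.reg 0 (by simp) (by simp)).trans h0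
    have hlt : s'.reg 8 < k := by
      by_contra hcon
      simp [Expr.eval, h0', hcon] at hc
    refine (h.step hinj hlt).mono ?_
    rintro s'' t ⟨h', h8, ht⟩
    exact ⟨h', by omega, ht⟩
  · refine ⟨fun x h8 h9 => ?_, fun a ha => rfl, ?_, ?_, fun p => ?_, fun w => ?_, fun i => ?_⟩
    · simp [setReg_reg, h8]
    · simp [setReg_reg, Expr.eval]
    · simp [setReg_reg, Expr.eval]; omega
    · simp only [setReg_reg, Expr.eval, if_true]
      rw [if_neg (by omega)]; rfl
    · simp [setReg_reg, setReg_arr, Expr.eval]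
    · rw [← hcap i, hIcc]; simp [setReg_reg, setReg_arr, Expr.eval]
  · rintro s' t ⟨h, hc, ht⟩
    have h0' : s'.reg 0 = k := (h.reg 0 (by simp) (by simp)).trans h0
    have h8 : s'.reg 8 = k := by
      have := h.le
      by_contra hcon
      simp [Expr.eval, h0', show s'.reg 8 < k by omega] at hc
    have h5 := h.reg 5 (by simp) (by simp)
    have h6 := h.reg 6 (by simp) (by simp)
    have h7 := h.reg 7 (by simp) (by simp)
    refine ⟨⟨fun x hx => ?_, ?_, ?_, ?_, h.arr, fun p => ?_, fun w => ?_, ?_⟩, ?_⟩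
    · rw [setReg_reg, if_neg (by omega), setReg_reg, if_neg (by omega),
        h.reg x (by omega) (by omega)]
    · simp [setReg_reg, Expr.eval, h5]
    · simp [setReg_reg, Expr.eval, h6, h0']; omega
    · simp [setReg_reg, h7]
    · rw [setReg_arr, setReg_arr, h.out, h8]
      exact if_congr (by omega) rfl rfl
    · rw [setReg_arr, setReg_arr, h.class_eq, h8, hIcc]
    · ext i
      have := h.cap_eq i
      rw [h8] at this
      simpa [setReg_arr] using this
    · simp [setReg_reg, Expr.eval, Expr.cost] at ht ⊢
      have := Nat.mul_le_mul_right 64 (show k - 1 ≤ k by omega)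
      omega

end

/-! ### One iteration of a stage -/

section

variable {n k r : ℕ} {χ : EdgeColoring n k r}

/-- The memory during stage `t`. -/
structure StageMem (χ : EdgeColoring n k r) (ℓ t : ℕ) (st₀ : ℕ → ℕ) (s : Memory) : Prop where
  k_eq : s.reg 0 = k
  ℓ_eq : s.reg 1 = ℓ
  r_eq : s.reg 2 = r
  n_eq : s.reg 3 = n
  t_eq : s.reg 4 = t
  last_eq : s.reg 6 = (k - 1) * s.reg 5
  alive_eq : s.reg 12 = r + t
  cap_eq : s.arr 2 = stageCap k r t
  walk : Walk χ t st₀ (s.arr 1) (s.arr 0) (s.reg 5) (s.reg 7)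

theorem StageMem.congr {ℓ t : ℕ} {st₀ : ℕ → ℕ} {s s' : Memory} (h : StageMem χ ℓ t st₀ s)
    (hreg : ∀ x, x < 5 ∨ 11 < x → s'.reg x = s.reg x) (hlast : s'.reg 6 = (k - 1) * s'.reg 5)
    (hcap : s'.arr 2 = s.arr 2)
    (hwalk : Walk χ t st₀ (s'.arr 1) (s'.arr 0) (s'.reg 5) (s'.reg 7)) :
    StageMem χ ℓ t st₀ s' where
  k_eq := (hreg 0 (by simp)).trans h.k_eq
  ℓ_eq := (hreg 1 (by simp)).trans h.ℓ_eq
  r_eq := (hreg 2 (by simp)).trans h.r_eq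
  n_eq := (hreg 3 (by simp)).trans h.n_eq
  t_eq := (hreg 4 (by simp)).trans h.t_eq
  last_eq := hlast
  alive_eq := (hreg 12 (by simp)).trans h.alive_eq
  cap_eq := hcap.trans h.cap_eq
  walk := hwalk

/-- One iteration of the loop of stage `t`. -/
structure StageStep (χ : EdgeColoring n k r) (ℓ t : ℕ) (st₀ : ℕ → ℕ) (s s' : Memory) : Prop where
  mem : StageMem χ ℓ t st₀ s'
  edges : s'.reg 5 ≤ s.reg 5 + 1
  dead : s'.reg 7 ≤ s.reg 7 + 1
  thresholds : s'.arr 4 = s.arr 4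
  variant : potential n k r t (s'.arr 1) (s'.arr 0) (s'.reg 5) <
    potential n k r t (s.arr 1) (s.arr 0) (s.reg 5)

/-- A bound for the time of one iteration of the loop of a stage. -/
def stepTime (n k : ℕ) : ℕ := 3 * smallSubsets (k - 1) n * (k + 60) + 100 * (n + k + 3)

theorem runs_advance {ℓ t : ℕ} {st₀ : ℕ → ℕ} {s : Memory} (h : StageMem χ ℓ t st₀ s) (hk : 2 ≤ k)
    (ht : 0 < t) (htr : t < r) (hr : r ≤ k) (halive : s.arr 1 (s.arr 0 (s.reg 6)) = r + t) :
    Runs χ advanceProg s fun s' T =>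
      StageStep χ ℓ t st₀ s s' ∧ T ≤ 3 * smallSubsets (k - 1) n * (k + 60) + 100 * (k + 2) := by
  have halive' := halive
  rw [h.last_eq] at halive
  simp only [advanceProg, runs_block_cons, runs_block_nil]
  refine (runs_search hk h.k_eq h.n_eq).mono ?_
  rintro s₁ T₁ ⟨hs | hs, hT₁⟩
  · rw [runs_ite]
    refine ⟨fun _ => ?_, fun hc => by simp [Expr.eval, hs.status] at hc⟩
    have hf := hs.frame
    have hfr : ∀ x, x < 8 ∨ 11 < x → s₁.reg x = s.reg x := hf.reg
    have hst := hf.arr 1 (by simp) (by simp)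
    have hout := hf.arr 0 (by simp) (by simp)
    refine (runs_append (cap := stageCap k r t) hk ((hfr 0 (by simp)).trans h.k_eq) hs.inj
      (by rw [hst]; have := hs.residual; rwa [h.cap_eq] at this)).mono ?_
    rintro s₂ T₂ ⟨ha, hT₂⟩
    have hfit : Fits (s.arr 1) (stageCap k r t) ((Icc 1 (k - 1)).image (s₁.arr 3)) := by
      intro i
      have h1 := hs.residual i
      rw [h.cap_eq] at h1
      have h2 : ((Icc 1 (k - 1)).image (s₁.arr 3)).filter (fun w => s.arr 1 w = i) =
          ((Icc 1 (k - 1)).filter fun p => s.arr 1 (s₁.arr 3 p) = i).image (s₁.arr 3) := by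
        rw [filter_image]
      rw [h2]
      exact card_image_le.trans (by omega)
    have hcol : colorOf χ (insert (s.arr 0 ((k - 1) * s.reg 5))
        ((Icc 1 (k - 1)).image (s₁.arr 3))) = t := by
      have h1 := hs.answer
      rw [answer_eq_colorOf, h.t_eq] at h1
      rw [← h1, ← h.last_eq, ← hs.query_zero, ← image_insert]
      congr 2
      ext p
      simp
      omega
    have h5 := hfr 5 (by simp)
    have h6 := hfr 6 (by simp)
    have h7 := hfr 7 (by simp)
    obtain ⟨hw, hpot⟩ := h.walk.extend ht htr hr halive (fun p hp => (hs.lt p hp).trans_eq h.n_eq)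
      hs.inj hfit hcol (st' := s₂.arr 1) (out' := s₂.arr 0)
      (fun w => by rw [ha.class_eq, hst, hfr 12 (by simp), hfr 2 (by simp), h.alive_eq, h.r_eq])
      (fun p => by rw [ha.out, hout, h6, h.last_eq])
    rw [← h5, ← ha.edges] at hw hpot
    rw [← h7, ← ha.dead] at hw
    refine ⟨⟨h.congr (fun x hx => ?_) ?_ (ha.cap_eq.trans h.cap_eq.symm) hw, ?_, ?_, ?_, ?_⟩, ?_⟩
    · rw [ha.reg x (by omega), hfr x (by omega)]
    · rw [ha.last, ha.edges, h6, h5, h.last_eq, mul_add, mul_one]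
    · rw [ha.edges, h5]
    · rw [ha.dead, h7]; omega
    · rw [ha.arr 4 (by simp), hf.arr 4 (by simp) (by simp)]
    · rwa [← h5]
    · simp only [Expr.cost]; omega
  · rw [runs_ite]
    refine ⟨fun hc => by simp [Expr.eval, hs.status] at hc, fun _ => ?_⟩
    simp only [runs_block_cons, runs_block_nil, runs_assign, runs_store]
    have hf := hs.frame
    have h4 := hf.reg 4 (by simp)
    have h5 := hf.reg 5 (by simp)
    have h6 := hf.reg 6 (by simp)
    have h7 := hf.reg 7 (by simp)
    have hst := hf.arr 1 (by simp) (by simp)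
    have hout := hf.arr 0 (by simp) (by simp)
    have hno := hs.noEdge
    rw [h.last_eq, h.t_eq, h.cap_eq] at hno
    obtain ⟨hw, hpot⟩ := h.walk.kill ht htr halive hno
    refine ⟨⟨h.congr (fun x hx => ?_) ?_ ?_ ?_, ?_, ?_, ?_, ?_⟩, ?_⟩
    · rw [setReg_reg, if_neg (by omega), setArr_reg, hf.reg x (by omega)]
    · simp [setReg_reg, setArr_reg, h5, h6, h.last_eq]
    · simp [setReg_arr, setArr_arr, hs.cap]
    · simpa [setReg_arr, setArr_arr, setReg_reg, setArr_reg, Expr.eval, hst, hout, h4, h5, h6, h7,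
        h.t_eq, h.last_eq] using hw
    · simp [setReg_reg, setArr_reg, h5]
    · simp [setReg_reg, setArr_reg, h7, Expr.eval]
    · simp [setReg_arr, setArr_arr, hf.arr 4]
    · simpa [setReg_arr, setArr_arr, setReg_reg, setArr_reg, Expr.eval, hst, hout, h4, h5, h6,
        h.t_eq, h.last_eq] using hpot
    · simp only [Expr.cost]; omega

theorem runs_restart {ℓ t : ℕ} {st₀ : ℕ → ℕ} {s : Memory} (h : StageMem χ ℓ t st₀ s)
    (ht : 0 < t) (htr : t < r) (h5 : s.reg 5 = 0) (hdead : s.arr 1 (s.arr 0 0) ≠ r + t)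
    (hfree : 0 < classSize n (s.arr 1) 0) :
    Runs χ restartProg s fun s' T => StageStep χ ℓ t st₀ s s' ∧ T ≤ 20 * (n + 1) + 20 := by
  simp only [restartProg, runs_block_cons, runs_block_nil, runs_assign]
  have hex : ∃ x < n, (s.setReg 10 ((Expr.const 0).eval s)).arr 1 x =
      (s.setReg 10 ((Expr.const 0).eval s)).reg 10 := by
    obtain ⟨x, hx⟩ := card_pos.1 hfree
    rw [mem_filter, mem_range] at hx
    exact ⟨x, hx.1, by simpa [setReg_arr, setReg_reg, Expr.eval] using hx.2⟩
  refine (runs_find hex).mono ?_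
  rintro s' T ⟨⟨y, hy, hy0, rfl⟩, hT⟩
  simp only [setReg_arr, setReg_reg, if_true, Expr.eval] at hy0
  simp only [runs_store]
  have hwalk := h.walk
  rw [h5] at hwalk
  obtain ⟨hw, hpot⟩ := hwalk.restart ht htr hdead hy hy0
  refine ⟨⟨h.congr (fun x hx => ?_) ?_ ?_ ?_, ?_, ?_, ?_, ?_⟩, ?_⟩
  · rw [setArr_reg, setArr_reg, setReg_reg, if_neg (by omega), setReg_reg, if_neg (by omega)]
  · simp [setReg_reg, setArr_reg, h.last_eq]
  · simp [setReg_arr, setArr_arr]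
  · simpa [setReg_arr, setArr_arr, setReg_reg, setArr_reg, Expr.eval, h5, h.alive_eq] using hw
  · simp [setReg_reg, setArr_reg]
  · simp [setReg_reg, setArr_reg]
  · simp [setReg_arr, setArr_arr]
  · simpa [setReg_arr, setArr_arr, setReg_reg, setArr_reg, Expr.eval, h5, h.alive_eq] using hpot
  · simp only [Expr.cost]; omega

theorem runs_retreat {ℓ t : ℕ} {st₀ : ℕ → ℕ} {s : Memory} (h : StageMem χ ℓ t st₀ s) (hk : 2 ≤ k)
    (h5 : s.reg 5 ≠ 0) (hdead : s.arr 1 (s.arr 0 (s.reg 6)) ≠ r + t) :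
    Runs χ retreatProg s fun s' T => StageStep χ ℓ t st₀ s s' ∧ T ≤ 30 * (k + 1) + 30 := by
  obtain ⟨L, hL⟩ := Nat.exists_eq_succ_of_ne_zero h5
  rw [Nat.succ_eq_add_one] at hL
  have hlast := h.last_eq
  have hmul : (k - 1) * (L + 1) = (k - 1) * L + (k - 1) := by rw [mul_add, mul_one]
  rw [hL] at hlast
  have hwalk := h.walk
  rw [hL] at hwalk
  rw [hlast] at hdead
  simp only [retreatProg, runs_block_cons, runs_block_nil]
  -- The scan starts at `s.reg 6 + 2 - k`, which is `(k - 1) * L + 1`: one position after the first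
  -- vertex of the last edge.
  refine (runs_scan h.k_eq hk (by omega)).mono ?_
  rintro s' T ⟨⟨y, hy, hy', rfl, hall, hfound⟩, hT⟩
  rw [h.alive_eq] at hall hfound
  simp only [runs_ite, runs_block_cons, runs_block_nil, runs_assign, runs_store]
  constructor
  · intro hc
    have hlt : y < s.reg 6 := by
      by_contra hcon
      simp [Expr.eval, setReg_reg, hcon] at hc
    obtain ⟨hw, hpot⟩ := hwalk.swap (p₀ := y) (by omega) (by omega) hdead (hfound hlt)
      (out' := Function.update (Function.update (s.arr 0) y (s.arr 0 ((k - 1) * (L + 1))))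
        ((k - 1) * (L + 1)) (s.arr 0 y)) (fun p => by
          rw [Equiv.swap_apply_def, Function.update_apply, Function.update_apply]
          split_ifs <;> simp_all)
    refine ⟨⟨h.congr (fun x hx => ?_) ?_ ?_ ?_, ?_, ?_, ?_, ?_⟩, ?_⟩
    · rw [setArr_reg, setArr_reg, setReg_reg, if_neg (by omega), setReg_reg, if_neg (by omega)]
    · simp [setReg_reg, setArr_reg, h.last_eq]
    · simp [setReg_arr, setArr_arr]
    · simpa [setReg_arr, setArr_arr, setReg_reg, setArr_reg, Expr.eval, hL, hlast] using hw
    · simp [setReg_reg, setArr_reg]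
    · simp [setReg_reg, setArr_reg]
    · simp [setReg_arr, setArr_arr]
    · simpa [setReg_arr, setArr_arr, setReg_reg, setArr_reg, Expr.eval, hL, hlast] using hpot
    · simp only [Expr.cost]; omega
  · intro hc
    have hyeq : y = s.reg 6 := by
      by_contra hcon
      simp [Expr.eval, setReg_reg, show y < s.reg 6 by omega] at hc
    obtain ⟨hw, hpot⟩ := hwalk.pop fun p hp hp' => by
      rcases (show p < s.reg 6 ∨ p = (k - 1) * (L + 1) by omega) with hp | rfl
      · exact hall p (by omega) (by omega)
      · exact hdead
    have hpot := hpot (by omega)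
    refine ⟨⟨h.congr (fun x hx => ?_) ?_ ?_ ?_, ?_, ?_, ?_, ?_⟩, ?_⟩
    · rw [setReg_reg, if_neg (by omega), setReg_reg, if_neg (by omega), setReg_reg,
        if_neg (by omega)]
    · simp [setReg_reg, Expr.eval, hL, hlast, h.k_eq]
      omega
    · simp [setReg_arr]
    · simpa [setReg_arr, setReg_reg, Expr.eval, hL] using hw
    · simp [setReg_reg, Expr.eval]; omega
    · simp [setReg_reg]
    · simp [setReg_arr]
    · simpa [setReg_arr, setReg_reg, Expr.eval, hL] using hpot
    · simp only [Expr.cost]; omega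

theorem runs_walkBody {ℓ t : ℕ} {st₀ : ℕ → ℕ} {s : Memory} (h : StageMem χ ℓ t st₀ s) (hk : 2 ≤ k)
    (ht : 0 < t) (htr : t < r) (hr : r ≤ k)
    (hfree : s.reg 5 = 0 → s.arr 1 (s.arr 0 0) ≠ r + t → 0 < classSize n (s.arr 1) 0) :
    Runs χ walkBody s fun s' T => StageStep χ ℓ t st₀ s s' ∧ T ≤ stepTime n k := by
  simp only [walkBody, runs_ite, stepTime]
  have halive : (Expr.eq (.get 1 (.get 0 (.reg 6))) (.reg 12)).eval s ≠ 0 ↔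
      s.arr 1 (s.arr 0 (s.reg 6)) = r + t := by
    rw [← h.alive_eq]
    simp only [Expr.eval]
    split_ifs with hc <;> simp [hc]
  refine ⟨fun hc => ?_, fun hc => ?_⟩
  · refine (runs_advance h hk ht htr hr (halive.1 hc)).mono fun s' T h' => ⟨h'.1, ?_⟩
    have := h'.2
    simp only [Expr.cost]
    omega
  have ha := fun hcon => halive.2 hcon hc
  refine ⟨fun hc' => ?_, fun hc' => ?_⟩
  · refine (runs_retreat h hk hc' ha).mono fun s' T h' => ⟨h'.1, ?_⟩
    have := h'.2
    simp only [Expr.cost]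
    omega
  · have h5 : s.reg 5 = 0 := hc'
    rw [h.last_eq, h5, mul_zero] at ha
    refine (runs_restart h ht htr h5 ha (hfree h5 ha)).mono fun s' T h' => ⟨h'.1, ?_⟩
    have := h'.2
    simp only [Expr.cost]
    omega

end

/-! ### The budget of vertices, and the passage from stage to stage -/

/-- The number of vertices of class `i` needed in the end. -/
def baseNeed (ℓ i : ℕ) : ℕ := if i = 1 then (ℓ + 1) / 2 else ℓ

/-- A bound for the number of vertices of each class that the last `t` stages use up. -/
def wasted (k r ℓ : ℕ) : ℕ → ℕ
  | 0 => 0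
  | t + 1 => wasted k r ℓ t + ((baseNeed ℓ (t + 1) + wasted k r ℓ t + 1) / (k - r + (t + 1)) + ℓ)

/-- The number of vertices that are moved to class `t` in stage `t`. -/
def threshold (k r ℓ t : ℕ) : ℕ := baseNeed ℓ t + wasted k r ℓ (t - 1)

/-- The number of unused vertices needed for the last `t` stages and the final path. -/
def freeNeed (k r ℓ : ℕ) : ℕ → ℕ
  | 0 => (k - r) * ℓ + ℓ / 2 + 1
  | t + 1 => freeNeed k r ℓ t + threshold k r ℓ (t + 1) + 1 + (k - r + (t + 1)) * (ℓ - 1)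

/-- The number of vertices of class `i` in an edge before stage `t`. -/
def edgeCap (k r t i : ℕ) : ℕ := stageCap k r t i + if i = 0 then 1 else 0

section

variable {n k r : ℕ}

/-- The classes before stage `t`: there are enough vertices of each class, and the edges that
contain one vertex of each class `i` with `t < i < r` and have their other vertices in class `0`
do not have a color greater than `t`. -/
structure StageStart (χ : EdgeColoring n k r) (ℓ t : ℕ) (st : ℕ → ℕ) : Prop where
  mark : ∀ w, st w = 0 ∨ t < st w ∧ st w ≤ r ∨ r + t < st w
  free : freeNeed k r ℓ t ≤ classSize n st 0
  classes : ∀ i, t < i → i < r → baseNeed ℓ i + wasted k r ℓ t ≤ classSize n st i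
  colors : ∀ E ⊆ range n, E.card = k → Fits st (edgeCap k r t) E →
    ∀ c, t < c → c < r → colorOf χ E ≠ c

variable {χ : EdgeColoring n k r} {ℓ t : ℕ} {st₀ st out : ℕ → ℕ} {L cnt : ℕ}

/-- The entry `out 0` is a leftover and may even lie in the reservoir; this is why `Walk.used`
speaks only of nonempty paths. No vertex carries the mark `r + t` yet, so the first iteration
chooses a proper start. -/
theorem StageStart.walk (h : StageStart χ ℓ t st) (ht : 0 < t) (htr : t < r) (hout : out 0 < n) :
    Walk χ t st st out 0 0 where
  mark w := by have := h.mark w; omega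
  out_lt p hp := by obtain rfl : p = 0 := by simpa using hp
                    exact hout
  inj := by simp
  used hL := absurd hL (by simp)
  color i hi := absurd hi (by simp)
  alive_mem w hw := by have := h.mark w; omega
  alive_le L' hL' := by
    obtain rfl : L' = 0 := by omega
    refine (card_filter_le _ _).trans ?_
    simp
  dead_card := card_eq_zero.2 (filter_eq_empty_iff.2 fun w _ => by have := h.mark w; omega)
  extensions := ⟨0, by simp, fun i _ _ => by simp⟩
  dead w _ hwt := by have := h.mark w; omega

/-- Vertices leave the reservoir only by becoming alive, and an alive vertex can only move to class
`t`; the spent mark `r` is reserved for the higher classes. -/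
theorem Walk.classSize_zero (h : Walk χ t st₀ st out L cnt) (ht : 0 < t) (htr : t < r) :
    classSize n st₀ 0 = classSize n st 0 + cnt + classSize n st (r + t) := by
  rw [← h.dead_card]
  unfold classSize
  rw [← card_union_of_disjoint, ← card_union_of_disjoint]
  · congr 1
    ext w
    have := h.mark w
    simp only [mem_union, mem_filter, mem_range]
    omega
  · rw [disjoint_union_left]
    constructor <;> exact disjoint_filter.2 fun w _ h1 => by omega
  · exact disjoint_filter.2 fun w _ h1 => by omega

theorem Walk.alive_card (h : Walk χ t st₀ st out L cnt) :
    classSize n st (r + t) ≤ (k - r + t) * L + 1 := by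
  refine le_trans ?_ (h.alive_le L le_rfl)
  refine le_trans (card_le_card fun w hw => ?_) (card_image_le (f := out))
  rw [mem_filter] at hw
  obtain ⟨p, hp, rfl⟩ := h.alive_mem w hw.2
  exact mem_image_of_mem _ (mem_filter.2 ⟨mem_range.2 (by omega), hw.2⟩)

theorem sum_edgeCap (hr : r ≤ k) (htr : t < r) :
    ∑ i ∈ range r, edgeCap k r t i = k := by
  unfold edgeCap
  rw [sum_add_distrib, sum_stageCap hr htr, sum_ite_eq' (range r) 0, if_pos (by simp; omega)]
  omega

/-- The state at the end of stage `t + 1`, if the path has not become too long. -/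
theorem Walk.finish (hs : StageStart χ ℓ (t + 1) st₀) (h : Walk χ (t + 1) st₀ st out L cnt)
    (htr : t + 1 < r) (hr : r ≤ k) (hL : L < ℓ) (hcnt : cnt = threshold k r ℓ (t + 1)) :
    StageStart χ ℓ t st := by
  have hsum := h.classSize_zero (by omega) htr
  have halive := h.alive_card
  have hmul : (k - r + (t + 1)) * L ≤ (k - r + (t + 1)) * (ℓ - 1) :=
    Nat.mul_le_mul_left _ (by omega)
  have hfree := hs.free
  rw [freeNeed] at hfree
  refine ⟨fun w => ?_, by omega, fun i hi hir => ?_, fun E hE hcard hfit c hc hcr hcol => ?_⟩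
  -- Vertices still alive keep the mark `r + (t + 1)`. Each stage has its own mark, so they need no
  -- cleaning up and are never used again.
  · have := h.mark w
    omega
  · rcases (show i = t + 1 ∨ t + 1 < i by omega) with rfl | hi'
    · rw [h.dead_card, hcnt]
      rfl
    · obtain ⟨E, hE, hE'⟩ := h.extensions
      have h1 := hs.classes i hi' hir
      have h2 := hE' i hi' hir
      -- The double count: everything taken from the reservoir by the `E` extensions is now in class
      -- `t + 1` or alive, and at most `(k - r + (t + 1)) * L + 1` vertices are alive.
      have h3 : E ≤ (baseNeed ℓ (t + 1) + wasted k r ℓ t + 1) / (k - r + (t + 1)) + ℓ := by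
        rw [threshold, Nat.add_sub_cancel] at hcnt
        have h4 : (k - r + (t + 1)) * E ≤ cnt + 1 + (k - r + (t + 1)) * ℓ := by
          have := Nat.mul_le_mul_left (k - r + (t + 1)) hL.le
          omega
        rw [← Nat.add_mul_div_left _ _ (by omega : 0 < k - r + (t + 1)), Nat.le_div_iff_mul_le
          (by omega), mul_comm]
        omega
      rw [wasted] at h1
      omega
  -- An admissible edge of the next stage is a vertex of class `t + 1` together with a set that was
  -- admissible in the stage just finished.
  · have hcap : ∀ i, edgeCap k r t i = stageCap k r (t + 1) i + if i = t + 1 then 1 else 0 := by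
      intro i
      unfold edgeCap stageCap
      split_ifs <;> omega
    have hmem : ∀ w ∈ E, st w = 0 ∨ t < st w ∧ st w < r := by
      intro w hw
      have := hfit.cap_ne_zero hw
      by_contra hcon
      refine this ?_
      rw [edgeCap, stageCap_eq_zero (by omega) (by omega), if_neg (by omega)]
    have hfull := fun {i : ℕ} (hi : i < r) => hfit.card_eq (fun i hi => by
      rw [edgeCap, stageCap_eq_zero (by omega) (by omega), if_neg (by omega)])
      (by rw [sum_edgeCap hr (by omega), hcard]) hi
    have hone := hfull htr
    rw [hcap, stageCap_eq_zero (by omega) (by omega), if_pos rfl, zero_add] at hone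
    obtain ⟨v, hv⟩ := card_eq_one.1 hone
    have hvE : v ∈ E ∧ st v = t + 1 := by
      rw [← mem_filter (p := fun w => st w = t + 1), hv]
      exact mem_singleton_self v
    -- Color `t + 1` is excluded because `v` could not be extended. For a higher color, `v` counts
    -- as the reservoir vertex that it was when the stage began.
    rcases (show c = t + 1 ∨ t + 1 < c by omega) with rfl | hc'
    · refine h.dead v (mem_range.1 (hE hvE.1)) hvE.2 (E.erase v) ((erase_subset _ _).trans hE)
        (by rw [card_erase_of_mem hvE.1, hcard]) (fun i => ?_) (by rwa [insert_erase hvE.1])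
      by_cases hi : i = t + 1
      · rw [hi, filter_erase, hv, erase_singleton]
        simp
      · refine (card_le_card (filter_subset_filter _ (erase_subset _ _))).trans ?_
        have := hfit i
        rwa [hcap, if_neg hi, add_zero] at this
    · refine hs.colors E hE hcard (fun i => ?_) c hc' hcr hcol
      by_cases hi : i = 0
      · have h1 : (E.filter fun w => st₀ w = i) ⊆
            (E.filter fun w => st w = 0) ∪ E.filter fun w => st w = t + 1 := by
          intro w hw
          rw [mem_filter] at hw
          rw [mem_union, mem_filter, mem_filter]
          have h2 := h.mark w
          have h3 := hmem w hw.1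
          have : st w = 0 ∨ st w = t + 1 := by omega
          tauto
        refine (card_le_card h1).trans ((card_union_le _ _).trans ?_)
        rw [hone]
        have := hfit 0
        rw [edgeCap, stageCap_zero, if_pos rfl] at this
        rw [hi, edgeCap, stageCap_zero, if_pos rfl]
        omega
      by_cases hi' : i = t + 1
      · rw [filter_eq_empty_iff.2 fun w _ => by have := hs.mark w; omega]
        simp
      · refine (card_le_card fun w hw => ?_).trans ((hfit i).trans ?_)
        · rw [mem_filter] at hw ⊢
          have h2 := h.mark w
          have h3 := hmem w hw.1
          exact ⟨hw.1, by omega⟩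
        · rw [hcap, if_neg hi', edgeCap, if_neg hi]

theorem isMonoPath_of_colorOf {ℓ a : ℕ} {out : ℕ → ℕ} (hk : 1 ≤ k) (ha : a < r)
    (hlt : ∀ p ≤ (k - 1) * ℓ, out p < n) (hinj : Set.InjOn out (range ((k - 1) * ℓ + 1)))
    (hcol : ∀ i < ℓ, colorOf χ ((Ico (i * (k - 1)) (i * (k - 1) + k)).image out) = a) :
    IsMonoPath χ ℓ out := by
  let φ : Fin ((k - 1) * ℓ + 1) ↪ Fin n := ⟨fun v => ⟨out v, hlt v (by omega)⟩, fun v v' hv =>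
    Fin.ext (hinj (by simpa using v.is_le) (by simpa using v'.is_le) (Fin.mk.inj_iff.1 hv))⟩
  refine ⟨φ, fun v => rfl, ⟨a, ha⟩, fun i => ?_⟩
  · have hset : (pathEdge k ℓ i).map φ = univ.filter fun v : Fin n =>
          (v : ℕ) ∈ (Ico ((i : ℕ) * (k - 1)) (i * (k - 1) + k)).image out := by
      ext v
      simp only [pathEdge, mem_map, mem_filter, mem_univ, true_and, mem_image, mem_Ico, φ]
      constructor
      · rintro ⟨p, hp, rfl⟩
        exact ⟨p, hp, rfl⟩
      · rintro ⟨p, hp, hpv⟩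
        have h1 : ((i : ℕ) + 1) * (k - 1) ≤ ℓ * (k - 1) := Nat.mul_le_mul_right _ i.2
        rw [add_mul, one_mul, mul_comm ℓ] at h1
        exact ⟨⟨p, by omega⟩, hp, Fin.ext hpv⟩
    have hc := hcol i i.2
    unfold colorOf at hc
    split_ifs at hc with hcard
    · refine ⟨by rw [hset]; exact hcard, Fin.ext ?_⟩
      simp only [hset]
      exact hc
    -- Here `colorOf` has its default value `r`, which is not a color.
    · omega

/-! ### The loop over the stages -/

abbrev stageCond : Expr :=
  .eq (.add (.lt (.reg 5) (.reg 1)) (.lt (.reg 7) (.get 4 (.reg 4)))) (.const 2)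

/-- Passing to the next stage shifts one unit of capacity from the reservoir to the class just
built. The classes and the old path stay in memory. -/
def stageEnd : Program := .block [
  .store 2 (.const 0) (.sub (.get 2 (.const 0)) (.const 1)),
  .store 2 (.reg 4) (.const 1),
  .assign 4 (.sub (.reg 4) (.const 1)),
  .assign 12 (.sub (.reg 12) (.const 1)),
  .assign 5 (.const 0),
  .assign 6 (.const 0),
  .assign 7 (.const 0)]

def stageProg : Program := .block [
  .while stageCond walkBody,
  .ite (.lt (.reg 5) (.reg 1)) stageEnd .skip]

abbrev stagesCond : Expr :=
  .eq (.add (.lt (.const 0) (.reg 4)) (.lt (.reg 5) (.reg 1))) (.const 2)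

def stagesProg : Program := .while stagesCond stageProg

/-- The memory before stage `t`. -/
structure BetweenStages (χ : EdgeColoring n k r) (ℓ t : ℕ) (s : Memory) : Prop where
  k_eq : s.reg 0 = k
  ℓ_eq : s.reg 1 = ℓ
  r_eq : s.reg 2 = r
  n_eq : s.reg 3 = n
  t_eq : s.reg 4 = t
  edges_eq : s.reg 5 = 0
  last_eq : s.reg 6 = 0
  dead_eq : s.reg 7 = 0
  alive_eq : s.reg 12 = r + t
  cap_eq : s.arr 2 = stageCap k r t
  thresholds : ∀ i, 0 < i → i ≤ t → s.arr 4 i = threshold k r ℓ i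
  out_lt : s.arr 0 0 < n
  start : StageStart χ ℓ t (s.arr 1)

/-- The memory after the algorithm has been successful. -/
structure Success (χ : EdgeColoring n k r) (ℓ : ℕ) (s : Memory) : Prop where
  ℓ_eq : s.reg 1 = ℓ
  edges_eq : s.reg 5 = ℓ
  path : IsMonoPath χ ℓ (s.arr 0)

theorem eval_and {s : Memory} {a b c d : Expr} :
    (Expr.eq (.add (.lt a b) (.lt c d)) (.const 2)).eval s ≠ 0 ↔
      a.eval s < b.eval s ∧ c.eval s < d.eval s := by
  simp only [Expr.eval]
  split_ifs <;> simp_all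

theorem runs_stageLoop {s : Memory} (h : BetweenStages χ ℓ t s) (hk : 2 ≤ k) (ht : 0 < t)
    (htr : t < r) (hr : r ≤ k) (hℓ : 0 < ℓ) :
    Runs χ (.while stageCond walkBody) s fun s' T =>
      (StageMem χ ℓ t (s.arr 1) s' ∧ s'.arr 4 = s.arr 4 ∧
        (s'.reg 5 = ℓ ∨ s'.reg 5 < ℓ ∧ s'.reg 7 = threshold k r ℓ t)) ∧
      T ≤ (6 * n + 1) * (stepTime n k + 11) + 11 := by
  obtain ⟨u, rfl⟩ : ∃ u, t = u + 1 := ⟨t - 1, by omega⟩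
  have hfree := h.start.free
  rw [freeNeed] at hfree
  have hwalk : StageMem χ ℓ (u + 1) (s.arr 1) s :=
    ⟨h.k_eq, h.ℓ_eq, h.r_eq, h.n_eq, h.t_eq, by rw [h.edges_eq, h.last_eq, mul_zero], h.alive_eq,
      h.cap_eq, by rw [h.edges_eq, h.dead_eq]; exact h.start.walk ht htr h.out_lt⟩
  have hcond : ∀ s', StageMem χ ℓ (u + 1) (s.arr 1) s' → s'.arr 4 = s.arr 4 →
      (stageCond.eval s' ≠ 0 ↔ s'.reg 5 < ℓ ∧ s'.reg 7 < threshold k r ℓ (u + 1)) := by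
    intro s' hs' h4
    rw [eval_and, ← h.thresholds (u + 1) ht le_rfl, ← h4]
    simp only [Expr.eval, hs'.ℓ_eq, hs'.t_eq]
  refine (runs_while (fun s' => StageMem χ ℓ (u + 1) (s.arr 1) s' ∧ s'.arr 4 = s.arr 4 ∧
    s'.reg 5 ≤ ℓ ∧ s'.reg 7 ≤ threshold k r ℓ (u + 1))
    (fun s' => potential n k r (u + 1) (s'.arr 1) (s'.arr 0) (s'.reg 5)) (stepTime n k) ?_
    ⟨hwalk, rfl, by rw [h.edges_eq]; omega, by rw [h.dead_eq]; omega⟩).mono ?_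
  · rintro s' ⟨hs', h4, h5, h7⟩ hc
    rw [hcond s' hs' h4] at hc
    refine (runs_walkBody hs' hk ht htr hr fun h50 hdead => ?_).mono ?_
    -- With no edges and a dead start nothing is alive. So the reservoir has lost only the vertices
    -- moved to the class of this stage, fewer than the threshold, and cannot be empty.
    · have h1 := hs'.walk.classSize_zero ht htr
      have h2 : classSize n (s'.arr 1) (r + (u + 1)) = 0 := by
        rw [classSize, card_eq_zero, filter_eq_empty_iff]
        intro w _ hw
        obtain ⟨p, hp, rfl⟩ := hs'.walk.alive_mem w hw
        rw [h50, mul_zero, Nat.le_zero] at hp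
        rw [hp] at hw
        exact hdead hw
      omega
    · rintro s'' T ⟨hstep, hT⟩
      have := hstep.edges
      have := hstep.dead
      exact ⟨⟨hstep.mem, hstep.thresholds.trans h4, by omega, by omega⟩, hstep.variant, hT⟩
  · rintro s' T ⟨⟨hs', h4, h5, h7⟩, hc, hT⟩
    have hc' := (hcond s' hs' h4).not.1 (not_not.2 hc)
    refine ⟨⟨hs', h4, by omega⟩, hT.trans ?_⟩
    -- At the beginning no vertex is alive and the path has no edges, so only the reservoir and the
    -- indicator count.
    have hpot : potential n k r (u + 1) (s.arr 1) (s.arr 0) (s.reg 5) ≤ 6 * n + 1 := by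
      have h1 := h.start.mark
      have h2 : classSize n (s.arr 1) (r + (u + 1)) = 0 :=
        card_eq_zero.2 (filter_eq_empty_iff.2 fun w _ => by have := h1 w; omega)
      have h3 : classSize n (s.arr 1) 0 ≤ n :=
        (card_filter_le _ _).trans (card_range n).le
      rw [potential, h2, h.edges_eq]
      split_ifs <;> omega
    have h2 := Nat.mul_le_mul_right (stepTime n k + 11) hpot
    have h3 : stageCond.cost + 1 + stepTime n k = stepTime n k + 11 := by
      simp only [Expr.cost]
      omega
    rw [h3]
    simp only [Expr.cost]
    omega

theorem stageCap_pred (htr : t + 1 < r) :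
    Function.update (Function.update (stageCap k r (t + 1)) 0 (stageCap k r (t + 1) 0 - 1))
      (t + 1) 1 = stageCap k r t := by
  ext i
  rw [Function.update_apply, Function.update_apply]
  unfold stageCap
  split_ifs <;> omega

theorem runs_stageEnd {s s₁ : Memory} (h : BetweenStages χ ℓ (t + 1) s)
    (hs : StageMem χ ℓ (t + 1) (s.arr 1) s₁) (h4 : s₁.arr 4 = s.arr 4) (htr : t + 1 < r)
    (hr : r ≤ k) (hL : s₁.reg 5 < ℓ) (hcnt : s₁.reg 7 = threshold k r ℓ (t + 1)) :
    Runs χ stageEnd s₁ fun s' T => BetweenStages χ ℓ t s' ∧ T ≤ 40 := by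
  have hstart := hs.walk.finish h.start htr hr hL hcnt
  have hout := hs.walk.out_lt 0 (Nat.zero_le _)
  simp only [stageEnd, runs_block_cons, runs_block_nil, runs_assign, runs_store]
  refine ⟨⟨?_, ?_, ?_, ?_, ?_, ?_, ?_, ?_, ?_, ?_, fun i hi hi' => ?_, ?_, ?_⟩, ?_⟩
  · simp [setReg_reg, setArr_reg, hs.k_eq]
  · simp [setReg_reg, setArr_reg, hs.ℓ_eq]
  · simp [setReg_reg, setArr_reg, hs.r_eq]
  · simp [setReg_reg, setArr_reg, hs.n_eq]
  · simp [setReg_reg, setArr_reg, Expr.eval, hs.t_eq]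
  · simp [setReg_reg, Expr.eval]
  · simp [setReg_reg, Expr.eval]
  · simp [setReg_reg, Expr.eval]
  · simp [setReg_reg, setArr_reg, Expr.eval, hs.alive_eq]
  · simp only [setReg_arr, setArr_arr, setArr_reg, Expr.eval, if_true, hs.t_eq, hs.cap_eq]
    exact stageCap_pred htr
  · simp [setReg_arr, setArr_arr, h4]
    exact h.thresholds i hi (by omega)
  · simpa [setReg_arr, setArr_arr] using hout
  · simpa [setReg_arr, setArr_arr] using hstart
  · simp only [Expr.cost]; omega

theorem runs_stage {s : Memory} (h : BetweenStages χ ℓ (t + 1) s) (hk : 2 ≤ k)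
    (htr : t + 1 < r) (hr : r ≤ k) (hℓ : 0 < ℓ) :
    Runs χ stageProg s fun s' T =>
      (BetweenStages χ ℓ t s' ∨ Success χ ℓ s') ∧
      T ≤ (6 * n + 1) * (stepTime n k + 11) + 60 := by
  simp only [stageProg, runs_block_cons, runs_block_nil, runs_ite, runs_skip]
  refine (runs_stageLoop h hk (by omega) htr hr hℓ).mono ?_
  rintro s₁ T₁ ⟨⟨hs, h4, h5⟩, hT⟩
  have hcond : (Expr.lt (.reg 5) (.reg 1)).eval s₁ ≠ 0 ↔ s₁.reg 5 < ℓ := by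
    rw [← hs.ℓ_eq]
    simp only [Expr.eval]
    split_ifs with hc <;> simp [hc]
  refine ⟨fun hc => ?_, fun hc => ⟨.inr ?_, ?_⟩⟩
  · have hlt := hcond.1 hc
    refine (runs_stageEnd h hs h4 htr hr hlt (by omega)).mono ?_
    rintro s' T ⟨h', hT'⟩
    refine ⟨.inl h', ?_⟩
    simp only [Expr.cost]; omega
  · have hL : s₁.reg 5 = ℓ := by
      have := hcond.not.1 (not_not.2 hc)
      omega
    have hw := hs.walk
    rw [hL] at hw
    exact ⟨hs.ℓ_eq, hL, isMonoPath_of_colorOf (by omega) htr hw.out_lt hw.inj hw.color⟩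
  · simp only [Expr.cost]; omega

theorem runs_stages {s : Memory} (h : BetweenStages χ ℓ t s) (hk : 2 ≤ k)
    (htr : t < r) (hr : r ≤ k) (hℓ : 0 < ℓ) :
    Runs χ stagesProg s fun s' T =>
      (BetweenStages χ ℓ 0 s' ∨ Success χ ℓ s') ∧
      T ≤ t * ((6 * n + 1) * (stepTime n k + 11) + 80) + 10 := by
  have hcond : ∀ s', stagesCond.eval s' ≠ 0 ↔ 0 < s'.reg 4 ∧ s'.reg 5 < s'.reg 1 :=
    fun s' => eval_and
  unfold stagesProg
  induction t generalizing s with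
  | zero =>
    refine runs_while_false ?_ ⟨.inl h, ?_⟩
    · by_contra hc
      have := (hcond s).1 hc
      rw [h.t_eq] at this
      omega
    · simp only [Expr.cost]; omega
  | succ t ih =>
    obtain ⟨s₁, T₁, hex, hs₁ | hs₁, hT₁⟩ := runs_stage h hk htr hr hℓ
    · obtain ⟨s₂, T₂, hex₂, hs₂, hT₂⟩ := ih hs₁ (by omega)
      refine ⟨s₂, _, .while_true ?_ hex hex₂, hs₂, ?_⟩
      · rw [hcond, h.t_eq, h.edges_eq, h.ℓ_eq]
        omega
      · rw [add_mul, one_mul]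
        simp only [Expr.cost]
        omega
    · refine ⟨s₁, _, .while_true ?_ hex (.while_false ?_), .inr hs₁, ?_⟩
      · rw [hcond, h.t_eq, h.edges_eq, h.ℓ_eq]
        omega
      · by_contra hc
        have := (hcond s₁).1 hc
        rw [hs₁.edges_eq, hs₁.ℓ_eq] at this
        omega
      · rw [add_mul, one_mul]
        simp only [Expr.cost]
        omega

end

/-! ### The final path of color `0` -/

/-- The class of the vertex at position `q` of the edge number `i` of the final path. -/
def edgeClass (r i q : ℕ) : ℕ := if q = 0 then i % 2 else if q + 1 < r then q + 1 else 0

/-- The class of the vertex at position `p` of the final path. -/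
def pathClass (k r p : ℕ) : ℕ := edgeClass r (p / (k - 1)) (p % (k - 1))

theorem pathClass_add {k r i q : ℕ} (hq : q < k - 1) :
    pathClass k r (i * (k - 1) + q) = edgeClass r i q := by
  rw [pathClass, mul_comm, Nat.mul_add_div (by omega), Nat.div_eq_of_lt hq, add_zero,
    Nat.mul_add_mod, Nat.mod_eq_of_lt hq]

theorem edgeClass_lt {r : ℕ} (hr : 2 ≤ r) (i q : ℕ) : edgeClass r i q < r := by
  unfold edgeClass
  split_ifs <;> omega

section

variable {n k r : ℕ}

/-- The last vertex of the path counts as position `0` of a further edge number `ℓ`, which is why `i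
= ℓ` is possible for `q = 0` only. -/
theorem exists_edge_position {p ℓ : ℕ} (hk : 2 ≤ k) (hp : p ≤ (k - 1) * ℓ) :
    ∃ i q, p = i * (k - 1) + q ∧ q < k - 1 ∧ i ≤ ℓ ∧ (q ≠ 0 → i < ℓ) ∧
      pathClass k r p = edgeClass r i q := by
  have h1 := Nat.div_add_mod' p (k - 1)
  have h2 := Nat.mod_lt p (show 0 < k - 1 by omega)
  have h3 : p / (k - 1) ≤ ℓ := by
    rw [Nat.div_le_iff_le_mul_add_pred (by omega)]
    omega
  refine ⟨p / (k - 1), p % (k - 1), h1.symm, h2, h3, fun hq => ?_, rfl⟩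
  refine lt_of_le_of_ne h3 fun heq => ?_
  rw [heq, mul_comm] at h1
  omega

/-- The number of positions of class `c` on the final path. -/
def classNeed (k r ℓ c : ℕ) : ℕ :=
  ((range ((k - 1) * ℓ + 1)).filter fun p => pathClass k r p = c).card

/-- The link vertices of even index number `ℓ / 2 + 1`; in addition, each edge has `k - r` inner
positions of class `0`. -/
theorem classNeed_zero_le {ℓ : ℕ} (hk : 2 ≤ k) (hr : 2 ≤ r) (hrk : r ≤ k) :
    classNeed k r ℓ 0 ≤ (k - r) * ℓ + ℓ / 2 + 1 := by
  have h1 : (range ((k - 1) * ℓ + 1)).filter (fun p => pathClass k r p = 0) ⊆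
      (range (ℓ / 2 + 1)).image (fun j => 2 * j * (k - 1)) ∪
        (range ℓ ×ˢ Ico (r - 1) (k - 1)).image fun x => x.1 * (k - 1) + x.2 := by
    intro p hp
    rw [mem_filter, mem_range] at hp
    obtain ⟨i, q, rfl, hq, hi, hiq, hc⟩ := exists_edge_position (r := r) hk (Nat.lt_succ_iff.1 hp.1)
    rw [hc, edgeClass] at hp
    rw [mem_union, mem_image, mem_image]
    by_cases h0 : q = 0
    · left
      rw [if_pos h0] at hp
      refine ⟨i / 2, mem_range.2 (by omega), ?_⟩
      rw [h0, show 2 * (i / 2) = i by omega, add_zero]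
    · right
      have := hiq h0
      have hqr : r - 1 ≤ q := by
        rw [if_neg h0] at hp
        by_contra hqr
        rw [if_pos (by omega)] at hp
        omega
      exact ⟨(i, q), mem_product.2 ⟨mem_range.2 (hiq h0), mem_Ico.2 ⟨hqr, hq⟩⟩, rfl⟩
  refine (card_le_card h1).trans ((card_union_le _ _).trans ?_)
  have h2 := card_image_le (s := range (ℓ / 2 + 1)) (f := fun j => 2 * j * (k - 1))
  have h3 := card_image_le (s := range ℓ ×ˢ Ico (r - 1) (k - 1))
    (f := fun x : ℕ × ℕ => x.1 * (k - 1) + x.2)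
  rw [card_range] at h2
  rw [card_product, card_range, Nat.card_Ico, show k - 1 - (r - 1) = k - r by omega,
    mul_comm] at h3
  omega

theorem classNeed_one_le {ℓ : ℕ} (hk : 2 ≤ k) : classNeed k r ℓ 1 ≤ (ℓ + 1) / 2 := by
  have h1 : (range ((k - 1) * ℓ + 1)).filter (fun p => pathClass k r p = 1) ⊆
      (range ((ℓ + 1) / 2)).image (fun j => (2 * j + 1) * (k - 1)) := by
    intro p hp
    rw [mem_filter, mem_range] at hp
    obtain ⟨i, q, rfl, hq, hi, hiq, hc⟩ := exists_edge_position (r := r) hk (Nat.lt_succ_iff.1 hp.1)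
    rw [hc, edgeClass] at hp
    rw [mem_image]
    have h0 : q = 0 := by
      by_contra h0
      rw [if_neg h0] at hp
      by_cases hqr : q + 1 < r
      · rw [if_pos hqr] at hp
        omega
      · rw [if_neg hqr] at hp
        omega
    rw [if_pos h0] at hp
    refine ⟨i / 2, mem_range.2 (by omega), ?_⟩
    rw [h0, show 2 * (i / 2) + 1 = i by omega, add_zero]
  refine (card_le_card h1).trans (card_image_le.trans ?_)
  rw [card_range]

theorem classNeed_le {ℓ c : ℕ} (hk : 2 ≤ k) (hc : 2 ≤ c) : classNeed k r ℓ c ≤ ℓ := by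
  have h1 : (range ((k - 1) * ℓ + 1)).filter (fun p => pathClass k r p = c) ⊆
      (range ℓ).image (fun i => i * (k - 1) + (c - 1)) := by
    intro p hp
    rw [mem_filter, mem_range] at hp
    obtain ⟨i, q, rfl, hq, hi, hiq, hcl⟩ :=
        exists_edge_position (r := r) hk (Nat.lt_succ_iff.1 hp.1)
    rw [hcl, edgeClass] at hp
    rw [mem_image]
    have h0 : q ≠ 0 := by
      intro h0
      rw [if_pos h0] at hp
      omega
    rw [if_neg h0] at hp
    refine ⟨i, mem_range.2 (hiq h0), ?_⟩
    split_ifs at hp <;> omega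
  refine (card_le_card h1).trans (card_image_le.trans ?_)
  rw [card_range]

variable {χ : EdgeColoring n k r} {ℓ : ℕ} {st out : ℕ → ℕ}

theorem StageStart.classNeed_le (h : StageStart χ ℓ 0 st) (hk : 2 ≤ k) (hr : 2 ≤ r) (hrk : r ≤ k)
    {c : ℕ} (hc : c < r) : classNeed k r ℓ c ≤ classSize n st c := by
  rcases (show c = 0 ∨ c = 1 ∨ 2 ≤ c by omega) with rfl | rfl | h2
  · exact (classNeed_zero_le hk hr hrk).trans h.free
  · exact (classNeed_one_le hk).trans (h.classes 1 (by omega) hc)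
  · have := h.classes c (by omega) hc
    rw [baseNeed, if_neg (by omega)] at this
    exact (LoosePath.classNeed_le hk h2).trans (by omega)

/-- The two ends of an edge are consecutive links, whose indices have opposite parity: they give one
vertex of class `0` and one of class `1`. The inner positions give each of the classes `2, …, r - 1`
once and class `0` the remaining `k - r` times. -/
theorem card_edge_positions_le (hk : 2 ≤ k) (hr : 2 ≤ r) (hrk : r ≤ k) (i c : ℕ) :
    ((Ico (i * (k - 1)) (i * (k - 1) + k)).filter fun p => pathClass k r p = c).card ≤
      edgeCap k r 0 c := by
  have hpos : ∀ p ∈ Ico (i * (k - 1)) (i * (k - 1) + k),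
      (∃ q, 0 < q ∧ q < k - 1 ∧ p = i * (k - 1) + q ∧
        pathClass k r p = if q + 1 < r then q + 1 else 0) ∨
      p = i * (k - 1) ∧ pathClass k r p = i % 2 ∨
      p = (i + 1) * (k - 1) ∧ pathClass k r p = (i + 1) % 2 := by
    intro p hp
    rw [mem_Ico] at hp
    have hmul : (i + 1) * (k - 1) = i * (k - 1) + (k - 1) := by ring
    obtain ⟨q, rfl⟩ := Nat.exists_eq_add_of_le hp.1
    rcases (show q = 0 ∨ q = k - 1 ∨ 0 < q ∧ q < k - 1 by omega) with rfl | rfl | hq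
    · exact .inr (.inl ⟨rfl, by rw [pathClass_add (by omega), edgeClass, if_pos rfl]⟩)
    · refine .inr (.inr ⟨hmul.symm, ?_⟩)
      have := pathClass_add (r := r) (i := i + 1) (show 0 < k - 1 by omega)
      rwa [add_zero, edgeClass, if_pos rfl, hmul] at this
    · exact .inl ⟨q, hq.1, hq.2, rfl, by
        rw [pathClass_add hq.2, edgeClass, if_neg (by omega)]⟩
  have hlink : ∃ a, ∀ b, (b = i * (k - 1) ∧ i % 2 = 0 ∨ b = (i + 1) * (k - 1) ∧ (i + 1) % 2 = 0) →
      b = a := by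
    rcases Nat.mod_two_eq_zero_or_one i with h | h
    · exact ⟨i * (k - 1), fun b hb => hb.elim (·.1) fun hb => by omega⟩
    · exact ⟨(i + 1) * (k - 1), fun b hb => hb.elim (fun hb => by omega) (·.1)⟩
  have hlink' : ∃ a, ∀ b, (b = i * (k - 1) ∧ i % 2 = 1 ∨ b = (i + 1) * (k - 1) ∧ (i + 1) % 2 = 1) →
      b = a := by
    rcases Nat.mod_two_eq_zero_or_one i with h | h
    · exact ⟨(i + 1) * (k - 1), fun b hb => hb.elim (fun hb => by omega) (·.1)⟩
    · exact ⟨i * (k - 1), fun b hb => hb.elim (·.1) fun hb => by omega⟩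
  unfold edgeCap stageCap
  rcases (show c = 0 ∨ c = 1 ∨ 2 ≤ c by omega) with rfl | rfl | h2
  · obtain ⟨a, ha⟩ := hlink
    rw [if_pos rfl, if_pos rfl]
    have hsub : (Ico (i * (k - 1)) (i * (k - 1) + k)).filter (fun p => pathClass k r p = 0) ⊆
        insert a ((Ico (r - 1) (k - 1)).image fun q => i * (k - 1) + q) := by
      intro p hp
      rw [mem_filter] at hp
      rw [mem_insert, mem_image]
      rcases hpos p hp.1 with ⟨q, hq, hq', rfl, hc⟩ | ⟨hp', hc⟩ | ⟨hp', hc⟩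
      · refine .inr ⟨q, mem_Ico.2 ⟨?_, hq'⟩, rfl⟩
        have := hc.symm.trans hp.2
        split_ifs at this
        omega
      · exact .inl (ha p (.inl ⟨hp', hc.symm.trans hp.2⟩))
      · exact .inl (ha p (.inr ⟨hp', hc.symm.trans hp.2⟩))
    refine (card_le_card hsub).trans ((card_insert_le _ _).trans ?_)
    have := card_image_le (s := Ico (r - 1) (k - 1)) (f := fun q => i * (k - 1) + q)
    rw [Nat.card_Ico] at this
    omega
  · obtain ⟨a, ha⟩ := hlink'
    rw [if_neg (by omega), if_pos (by omega), if_neg (by omega), add_zero]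
    refine (card_le_card (t := {a}) fun p hp => ?_).trans (card_singleton a).le
    rw [mem_filter] at hp
    rw [mem_singleton]
    rcases hpos p hp.1 with ⟨q, hq, hq', rfl, hc⟩ | ⟨hp', hc⟩ | ⟨hp', hc⟩
    · have := hc.symm.trans hp.2
      by_cases hqr : q + 1 < r
      · rw [if_pos hqr] at this
        omega
      · rw [if_neg hqr] at this
        omega
    · exact ha p (.inl ⟨hp', hc.symm.trans hp.2⟩)
    · exact ha p (.inr ⟨hp', hc.symm.trans hp.2⟩)
  · have hall : ∀ p ∈ (Ico (i * (k - 1)) (i * (k - 1) + k)).filter fun p => pathClass k r p = c,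
        p = i * (k - 1) + (c - 1) ∧ c < r := by
      intro p hp
      rw [mem_filter] at hp
      rcases hpos p hp.1 with ⟨q, hq, hq', rfl, hc⟩ | ⟨hp', hc⟩ | ⟨hp', hc⟩
      · have := hc.symm.trans hp.2
        split_ifs at this <;> omega
      · omega
      · omega
    rw [if_neg (by omega : ¬ c = 0), if_neg (by omega : ¬ c = 0), add_zero]
    split_ifs with hcr
    · exact (card_le_card fun p hp => mem_singleton.2 (hall p hp).1).trans (card_singleton _).le
    · rw [Nat.le_zero, card_eq_zero]
      exact eq_empty_of_forall_notMem fun p hp => hcr ⟨by omega, (hall p hp).2⟩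

theorem colorOf_lt {E : Finset ℕ} (hE : E ⊆ range n) (hcard : E.card = k) : colorOf χ E < r := by
  have : (univ.filter fun v : Fin n => (v : ℕ) ∈ E).card = k := by
    rw [← hcard, ← card_map Fin.valEmbedding]
    congr 1
    ext w
    simp only [mem_map, mem_filter, mem_univ, true_and, Fin.valEmbedding_apply]
    constructor
    · rintro ⟨v, hv, rfl⟩
      exact hv
    · exact fun hw => ⟨⟨w, mem_range.1 (hE hw)⟩, hw, rfl⟩
  rw [colorOf, dif_pos this]
  exact (χ _).2

/-- After the last stage every positive color is excluded on the edges of this shape, so only `0` is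
left. -/
theorem StageStart.isMonoPath (h : StageStart χ ℓ 0 st) (hk : 2 ≤ k) (hr : 2 ≤ r) (hrk : r ≤ k)
    (hlt : ∀ p ≤ (k - 1) * ℓ, out p < n) (hinj : Set.InjOn out (range ((k - 1) * ℓ + 1)))
    (hcl : ∀ p ≤ (k - 1) * ℓ, st (out p) = pathClass k r p) : IsMonoPath χ ℓ out := by
  refine isMonoPath_of_colorOf (a := 0) (by omega) (by omega) hlt hinj fun i hi => ?_
  have hle : ∀ p ∈ Ico (i * (k - 1)) (i * (k - 1) + k), p ≤ (k - 1) * ℓ := by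
    intro p hp
    have h1 : (i + 1) * (k - 1) ≤ ℓ * (k - 1) := Nat.mul_le_mul_right _ hi
    rw [add_mul, one_mul, mul_comm ℓ] at h1
    have := mem_Ico.1 hp
    omega
  have hE : (Ico (i * (k - 1)) (i * (k - 1) + k)).image out ⊆ range n := fun w hw => by
    obtain ⟨p, hp, rfl⟩ := mem_image.1 hw
    exact mem_range.2 (hlt p (hle p hp))
  have hcard : ((Ico (i * (k - 1)) (i * (k - 1) + k)).image out).card = k := by
    rw [card_image_of_injOn (hinj.mono fun p hp => ?_), Nat.card_Ico, Nat.add_sub_cancel_left]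
    have := hle p hp
    simp only [coe_range, Set.mem_Iio]
    omega
  have hfit : Fits st (edgeCap k r 0) ((Ico (i * (k - 1)) (i * (k - 1) + k)).image out) := by
    intro c
    refine le_trans ?_ (card_edge_positions_le hk hr hrk i c)
    rw [filter_image]
    refine card_image_le.trans (le_of_eq (congrArg _ (filter_congr fun p hp => ?_)))
    rw [hcl p (hle p hp)]
  by_contra hne
  exact h.colors _ hE hcard hfit _ (Nat.pos_of_ne_zero hne) (colorOf_lt hE hcard) rfl

end

/-- Put the class of the next vertex of the final path into register `10`. -/
def chooseClass : Program :=
  .ite (.reg 7)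
    (.ite (.lt (.add (.reg 7) (.const 1)) (.reg 2))
      (.assign 10 (.add (.reg 7) (.const 1)))
      (.assign 10 (.const 0)))
    (.block [
      .assign 10 (.reg 8),
      .assign 8 (.sub (.const 1) (.reg 8))])

/-- Register `7` is the position within the edge and register `8` the class of the next link. Chosen
vertices get the mark `r`, so that they are not found again. -/
def writeBody : Program := .block [
  chooseClass,
  findProg,
  .store 0 (.reg 6) (.reg 9),
  .store 1 (.reg 9) (.reg 2),
  .assign 6 (.add (.reg 6) (.const 1)),
  .assign 7 (.add (.reg 7) (.const 1)),
  .ite (.lt (.add (.reg 7) (.const 1)) (.reg 0)) .skip (.assign 7 (.const 0))]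

/-- Write a path of the last remaining color. -/
def finalProg : Program := .block [
  .assign 13 (.const 0),
  .assign 8 (.const 0),
  .while (.lt (.reg 8) (.reg 1)) (.block [
    .assign 13 (.sub (.add (.reg 13) (.reg 0)) (.const 1)),
    .assign 8 (.add (.reg 8) (.const 1))]),
  .assign 6 (.const 0),
  .assign 7 (.const 0),
  .assign 8 (.const 0),
  .while (.lt (.reg 6) (.add (.reg 13) (.const 1))) writeBody]

section

variable {n k r : ℕ} {χ : EdgeColoring n k r} {ℓ : ℕ}

/-- The memory after the first `p` vertices of the final path have been written. -/
structure WriteInv (n k r ℓ : ℕ) (st : ℕ → ℕ) (s : Memory) : Prop where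
  k_eq : s.reg 0 = k
  r_eq : s.reg 2 = r
  length_eq : s.reg 13 = (k - 1) * ℓ
  le : s.reg 6 ≤ (k - 1) * ℓ + 1
  position : ∃ i, s.reg 6 = i * (k - 1) + s.reg 7 ∧ s.reg 7 < k - 1 ∧
    s.reg 8 = if s.reg 7 = 0 then i % 2 else (i + 1) % 2
  out_lt : ∀ p < s.reg 6, s.arr 0 p < n
  class_eq : ∀ p < s.reg 6, st (s.arr 0 p) = pathClass k r p
  inj : Set.InjOn (s.arr 0) (range (s.reg 6))
  used : ∀ w, s.arr 1 w = if w ∈ (range (s.reg 6)).image (s.arr 0) then r else st w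

/-- Pigeonhole: if the class were used up, its size would be at most the number of earlier positions
of this class, which is less than the number of all such positions. -/
theorem WriteInv.exists_vertex {st : ℕ → ℕ} {s : Memory} (h : WriteInv n k r ℓ st s)
    (hneed : ∀ c < r, classNeed k r ℓ c ≤ classSize n st c) (hr : 2 ≤ r)
    (hp : s.reg 6 < (k - 1) * ℓ + 1) : ∃ x < n, s.arr 1 x = pathClass k r (s.reg 6) := by
  by_contra! hcon
  have h1 : (range n).filter (fun w => st w = pathClass k r (s.reg 6)) ⊆
      ((range (s.reg 6)).filter fun p => pathClass k r p = pathClass k r (s.reg 6)).image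
        (s.arr 0) := by
    intro w hw
    rw [mem_filter, mem_range] at hw
    have := hcon w hw.1
    rw [h.used] at this
    split_ifs at this with hmem
    · obtain ⟨p, hp, rfl⟩ := mem_image.1 hmem
      refine mem_image_of_mem _ (mem_filter.2 ⟨hp, ?_⟩)
      rw [← hw.2, h.class_eq p (mem_range.1 hp)]
    · exact absurd hw.2 this
  have h2 : (range (s.reg 6)).filter (fun p => pathClass k r p = pathClass k r (s.reg 6)) ⊂
      (range ((k - 1) * ℓ + 1)).filter fun p => pathClass k r p = pathClass k r (s.reg 6) := by
    refine (ssubset_iff_of_subset ?_).2 ⟨s.reg 6, by simpa using Nat.lt_succ_iff.1 hp, by simp⟩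
    exact filter_subset_filter _ (range_subset_range.2 hp.le)
  have h3 := card_lt_card h2
  have h4 := (card_le_card h1).trans card_image_le
  have h5 := hneed _ (edgeClass_lt hr (s.reg 6 / (k - 1)) (s.reg 6 % (k - 1)))
  unfold classNeed classSize at h5
  unfold pathClass at *
  omega

theorem runs_chooseClass {st : ℕ → ℕ} {s : Memory} (h : WriteInv n k r ℓ st s) :
    Runs χ chooseClass s fun s' T =>
      (s'.reg 10 = pathClass k r (s.reg 6) ∧ s'.arr = s.arr ∧
        (∀ x, x ≠ 8 → x ≠ 10 → s'.reg x = s.reg x) ∧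
        ∃ i, s.reg 6 = i * (k - 1) + s.reg 7 ∧ s.reg 7 < k - 1 ∧ s'.reg 8 = (i + 1) % 2) ∧
      T ≤ 20 := by
  obtain ⟨i, h6, h7, h8⟩ := h.position
  have hcl : pathClass k r (s.reg 6) = edgeClass r i (s.reg 7) := by rw [h6, pathClass_add h7]
  rw [hcl, edgeClass]
  simp only [chooseClass, runs_ite, runs_block_cons, runs_block_nil, runs_assign]
  refine ⟨fun hc => ?_, fun hc => ?_⟩
  · replace hc : s.reg 7 ≠ 0 := hc
    rw [if_neg hc] at h8
    rw [if_neg hc]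
    refine ⟨fun hc' => ?_, fun hc' => ?_⟩
    · have hlt : s.reg 7 + 1 < r := by
        by_contra hcon
        simp [Expr.eval, h.r_eq, hcon] at hc'
      rw [if_pos hlt]
      refine ⟨⟨by simp [setReg_reg, Expr.eval], rfl, fun x h8 h10 => ?_, i, h6, h7, ?_⟩, ?_⟩
      · simp [setReg_reg, h10]
      · simp [setReg_reg, h8]
      · simp only [Expr.cost]; omega
    · have hlt : ¬ s.reg 7 + 1 < r := by
        intro hcon
        simp [Expr.eval, h.r_eq, hcon] at hc'
      rw [if_neg hlt]
      refine ⟨⟨by simp [setReg_reg, Expr.eval], rfl, fun x h8 h10 => ?_, i, h6, h7, ?_⟩, ?_⟩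
      · simp [setReg_reg, h10]
      · simp [setReg_reg, h8]
      · simp only [Expr.cost]; omega
  · replace hc : s.reg 7 = 0 := hc
    rw [if_pos hc] at h8
    rw [if_pos hc]
    refine ⟨⟨by simp [setReg_reg, Expr.eval, h8], rfl, fun x h8 h10 => ?_, i, h6, h7, ?_⟩, ?_⟩
    · simp [setReg_reg, h8, h10]
    · simp [setReg_reg, Expr.eval, h8]; omega
    · simp only [Expr.cost]; omega

theorem runs_writeBody {st : ℕ → ℕ} {s : Memory} (h : WriteInv n k r ℓ st s)
    (hneed : ∀ c < r, classNeed k r ℓ c ≤ classSize n st c) (hr : 2 ≤ r)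
    (hp : s.reg 6 < (k - 1) * ℓ + 1) :
    Runs χ writeBody s fun s' T =>
      WriteInv n k r ℓ st s' ∧ s'.reg 6 = s.reg 6 + 1 ∧ T ≤ 20 * n + 100 := by
  simp only [writeBody, runs_block_cons, runs_block_nil]
  refine (runs_chooseClass h).mono ?_
  rintro s₁ T₁ ⟨⟨h10, harr, hreg, i, h6, h7, h8⟩, hT₁⟩
  refine (runs_find (n := n) ?_).mono ?_
  · rw [h10, harr]
    exact h.exists_vertex hneed hr hp
  rintro s₂ T₂ ⟨⟨y, hy, hy', rfl⟩, hT₂⟩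
  rw [h10, harr] at hy'
  have hlt : pathClass k r (s.reg 6) < r := edgeClass_lt hr _ _
  have hynew : y ∉ (range (s.reg 6)).image (s.arr 0) := fun hmem => by
    rw [h.used, if_pos hmem] at hy'
    omega
  have hyst : st y = pathClass k r (s.reg 6) := by rw [← hy', h.used, if_neg hynew]
  have hr0 := (hreg 0 (by simp) (by simp)).trans h.k_eq
  have hr2 := (hreg 2 (by simp) (by simp)).trans h.r_eq
  have hr13 := (hreg 13 (by simp) (by simp)).trans h.length_eq
  have hr6 := hreg 6 (by simp) (by simp)
  have hr7 := hreg 7 (by simp) (by simp)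
  have key : ∀ s', s'.reg 0 = k → s'.reg 2 = r → s'.reg 13 = (k - 1) * ℓ →
      s'.reg 6 = s.reg 6 + 1 → s'.reg 8 = (i + 1) % 2 →
      s'.reg 7 = (if s.reg 7 + 1 < k - 1 then s.reg 7 + 1 else 0) →
      s'.arr 0 = Function.update (s.arr 0) (s.reg 6) y →
      s'.arr 1 = Function.update (s.arr 1) y r → WriteInv n k r ℓ st s' := by
    intro s' h0' h2' h13' h6' h8' h7' ha0 ha1
    have hold : ∀ p < s.reg 6, s'.arr 0 p = s.arr 0 p := fun p hp => by
      rw [ha0, Function.update_of_ne (by omega)]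
    have hnew : s'.arr 0 (s.reg 6) = y := by rw [ha0, Function.update_self]
    refine ⟨h0', h2', h13', by omega, ?_, fun p hp => ?_, fun p hp => ?_, fun p hp p' hp' hpp => ?_,
      fun w => ?_⟩
    · by_cases hq : s.reg 7 + 1 < k - 1
      · rw [if_pos hq] at h7'
        refine ⟨i, by omega, by omega, ?_⟩
        rw [if_neg (by omega), h8']
      · rw [if_neg hq] at h7'
        refine ⟨i + 1, ?_, by omega, ?_⟩
        · rw [add_mul, one_mul]
          omega
        · rw [if_pos h7', h8']
    · rcases (show p < s.reg 6 ∨ p = s.reg 6 by omega) with hp | rfl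
      · rw [hold p hp]; exact h.out_lt p hp
      · rwa [hnew]
    · rcases (show p < s.reg 6 ∨ p = s.reg 6 by omega) with hp | rfl
      · rw [hold p hp]; exact h.class_eq p hp
      · rw [hnew, hyst]
    · simp only [coe_range, Set.mem_Iio] at hp hp'
      rcases (show p < s.reg 6 ∨ p = s.reg 6 by omega) with hp | rfl <;>
        rcases (show p' < s.reg 6 ∨ p' = s.reg 6 by omega) with hp' | rfl
      · rw [hold p hp, hold p' hp'] at hpp
        exact h.inj (by simpa using hp) (by simpa using hp') hpp
      · rw [hold p hp, hnew] at hpp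
        exact absurd (mem_image.2 ⟨p, mem_range.2 hp, hpp⟩) hynew
      · rw [hold p' hp', hnew] at hpp
        exact absurd (mem_image.2 ⟨p', mem_range.2 hp', hpp.symm⟩) hynew
      · rfl
    · have himg : (range (s'.reg 6)).image (s'.arr 0) =
          insert y ((range (s.reg 6)).image (s.arr 0)) := by
        rw [h6', range_add_one, image_insert, hnew]
        congr 1
        exact image_congr fun p hp => hold p (by simpa using hp)
      rw [himg, ha1, Function.update_apply, h.used]
      by_cases hw : w = y
      · rw [if_pos hw, if_pos (by rw [hw]; exact mem_insert_self _ _)]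
      · rw [if_neg hw]
        exact if_congr (by rw [mem_insert]; tauto) rfl rfl
  simp only [runs_assign, runs_store, runs_ite, runs_skip]
  refine ⟨fun hc => ⟨key _ ?_ ?_ ?_ ?_ ?_ ?_ ?_ ?_, ?_, ?_⟩,
    fun hc => ⟨key _ ?_ ?_ ?_ ?_ ?_ ?_ ?_ ?_, ?_, ?_⟩⟩
  · simp [setReg_reg, setArr_reg, hr0]
  · simp [setReg_reg, setArr_reg, hr2]
  · simp [setReg_reg, setArr_reg, hr13]
  · simp [setReg_reg, setArr_reg, hr6, Expr.eval]
  · simp [setReg_reg, setArr_reg, h8]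
  · simp [setReg_reg, setArr_reg, hr7, hr0, Expr.eval] at hc ⊢
    omega
  · simp [setReg_reg, setArr_reg, setReg_arr, setArr_arr, hr6, harr, Expr.eval]
  · simp [setReg_reg, setArr_reg, setReg_arr, setArr_arr, hr2, harr, Expr.eval]
  · simp [setReg_reg, setArr_reg, hr6, Expr.eval]
  · simp only [Expr.cost]; omega
  · simp [setReg_reg, setArr_reg, hr0]
  · simp [setReg_reg, setArr_reg, hr2]
  · simp [setReg_reg, setArr_reg, hr13]
  · simp [setReg_reg, setArr_reg, hr6, Expr.eval]
  · simp [setReg_reg, setArr_reg, h8]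
  · simp [setReg_reg, setArr_reg, hr7, hr0, Expr.eval] at hc ⊢
    omega
  · simp [setReg_reg, setArr_reg, setReg_arr, setArr_arr, hr6, harr, Expr.eval]
  · simp [setReg_reg, setArr_reg, setReg_arr, setArr_arr, hr2, harr, Expr.eval]
  · simp [setReg_reg, setArr_reg, hr6, Expr.eval]
  · simp only [Expr.cost]; omega

theorem runs_final {s : Memory} (h : BetweenStages χ ℓ 0 s) (hk : 2 ≤ k) (hr : 2 ≤ r)
    (hrk : r ≤ k) :
    Runs χ finalProg s fun s' T => IsMonoPath χ ℓ (s'.arr 0) ∧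
      T ≤ ((k - 1) * ℓ + 1) * (20 * n + 120) + 30 * ℓ + 40 := by
  simp only [finalProg, runs_block_cons, runs_block_nil, runs_assign]
  -- Multiplication is not an instruction, so `(k - 1) * ℓ` is accumulated in `ℓ` rounds.
  refine (runs_while (fun s' => s'.arr = s.arr ∧ (∀ x, x ≠ 8 → x ≠ 13 → s'.reg x = s.reg x) ∧
    s'.reg 13 = (k - 1) * s'.reg 8 ∧ s'.reg 8 ≤ ℓ) (fun s' => ℓ - s'.reg 8) 20 ?_ ?_).mono ?_
  · rintro s' ⟨harr, hreg, h13, h8⟩ hc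
    have h0 := (hreg 0 (by simp) (by simp)).trans h.k_eq
    have h1 := (hreg 1 (by simp) (by simp)).trans h.ℓ_eq
    have hlt : s'.reg 8 < ℓ := by
      by_contra hcon
      simp [Expr.eval, h1, hcon] at hc
    simp only [runs_block_cons, runs_block_nil, runs_assign]
    refine ⟨⟨harr, fun x h8 h13 => ?_, ?_, ?_⟩, ?_, ?_⟩
    · simp [setReg_reg, h8, h13, hreg]
    · simp [setReg_reg, Expr.eval, h0, h13, mul_add]
      omega
    · simp [setReg_reg, Expr.eval]; omega
    · simp [setReg_reg, Expr.eval]; omega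
    · simp only [Expr.cost]; omega
  · refine ⟨rfl, fun x h8 h13 => ?_, ?_, ?_⟩
    · simp [setReg_reg, h8, h13]
    · simp [setReg_reg, Expr.eval]
    · simp [setReg_reg, Expr.eval]
  · rintro s₁ T₁ ⟨⟨harr, hreg, h13, h8⟩, hc, hT₁⟩
    have h0 := (hreg 0 (by simp) (by simp)).trans h.k_eq
    have h1 := (hreg 1 (by simp) (by simp)).trans h.ℓ_eq
    have h2 := (hreg 2 (by simp) (by simp)).trans h.r_eq
    have h8' : s₁.reg 8 = ℓ := by
      by_contra hcon
      simp [Expr.eval, h1, show s₁.reg 8 < ℓ by omega] at hc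
    rw [h8'] at h13
    refine (runs_while (WriteInv n k r ℓ (s.arr 1)) (fun s' => (k - 1) * ℓ + 1 - s'.reg 6)
      (20 * n + 100) ?_ ?_).mono ?_
    · intro s' hs' hc
      have hlt : s'.reg 6 < (k - 1) * ℓ + 1 := by
        by_contra hcon
        simp only [Expr.eval, hs'.length_eq, if_neg hcon, ne_eq, not_true] at hc
      refine (runs_writeBody hs' (fun c hc => h.start.classNeed_le hk hr hrk hc) hr hlt).mono ?_
      rintro s'' T ⟨hs'', h6, hT⟩
      exact ⟨hs'', by omega, hT⟩
    · refine ⟨?_, ?_, ?_, ?_, ⟨0, ?_, ?_, ?_⟩, ?_, ?_, ?_, fun w => ?_⟩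
      · simp [setReg_reg, h0]
      · simp [setReg_reg, h2]
      · simp [setReg_reg, h13]
      · simp [setReg_reg, Expr.eval]
      · simp [setReg_reg, Expr.eval]
      · simp [setReg_reg, Expr.eval]; omega
      · simp [setReg_reg, Expr.eval]
      · simp [setReg_reg, Expr.eval]
      · simp [setReg_reg, Expr.eval]
      · simp [setReg_reg, Expr.eval]
      · simp [setReg_reg, setReg_arr, Expr.eval, harr]
    · rintro s₂ T₂ ⟨hs₂, hc₂, hT₂⟩
      have h6 : s₂.reg 6 = (k - 1) * ℓ + 1 := by
        have := hs₂.le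
        by_contra hcon
        simp only [Expr.eval, hs₂.length_eq,
          if_pos (show s₂.reg 6 < (k - 1) * ℓ + 1 by omega), one_ne_zero] at hc₂
      refine ⟨h.start.isMonoPath hk hr hrk (fun p hp => hs₂.out_lt p (by omega)) (h6 ▸ hs₂.inj)
        fun p hp => hs₂.class_eq p (by omega), ?_⟩
      simp [setReg_reg, Expr.eval, Expr.cost] at hT₁ hT₂ ⊢
      have h7 : ((k - 1) * ℓ + 1) * (6 + (20 * n + 100)) ≤
        ((k - 1) * ℓ + 1) * (20 * n + 120) := Nat.mul_le_mul_left _ (by omega)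
      omega

end

/-! ### Computing the thresholds, and the whole algorithm -/

abbrev divideCond : Expr := .eq (.lt (.reg 9) (.reg 10)) (.const 0)

/-- Add the quotient of the registers `9` and `10` to register `13`. -/
def divideProg : Program := .while divideCond (.block [
  .assign 9 (.sub (.reg 9) (.reg 10)),
  .assign 13 (.add (.reg 13) (.const 1))])

/-- Register `8` holds the current base need and register `13` the current value of `wasted`. Only
class `1` has a special base need, so register `8` is `ℓ` after the first round. -/
def thresholdBody : Program := .block [
  .store 4 (.reg 4) (.add (.reg 8) (.reg 13)),
  .assign 8 (.reg 1),
  .assign 9 (.add (.get 4 (.reg 4)) (.const 1)),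
  .assign 10 (.add (.sub (.reg 0) (.reg 2)) (.reg 4)),
  divideProg,
  .assign 13 (.add (.reg 13) (.reg 1)),
  .assign 4 (.add (.reg 4) (.const 1))]

/-- Compute the thresholds and prepare the first stage. -/
def preludeProg : Program := .block [
  .store 2 (.const 0) (.sub (.reg 0) (.const 1)),
  .while (.lt (.add (.reg 8) (.reg 8)) (.reg 1)) (.assign 8 (.add (.reg 8) (.const 1))),
  .assign 4 (.const 1),
  .while (.lt (.reg 4) (.reg 2)) thresholdBody,
  .assign 4 (.sub (.reg 4) (.const 1)),
  .assign 12 (.add (.reg 2) (.reg 4))]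

/-- The algorithm: it finds a monochromatic loose path. -/
def findPath : Program := .block [
  preludeProg,
  stagesProg,
  .ite (.lt (.reg 5) (.reg 1)) finalProg .skip]

theorem freeNeed_mono (k r ℓ : ℕ) : Monotone (freeNeed k r ℓ) :=
  monotone_nat_of_le_succ fun t => by rw [freeNeed]; omega

/-- This bounds the dividends in the computation of the thresholds by `n`, and with them the number
of repeated subtractions. -/
theorem threshold_lt {k r ℓ t T : ℕ} (ht : 0 < t) (htT : t ≤ T) :
    threshold k r ℓ t + 1 ≤ freeNeed k r ℓ T := by
  refine le_trans ?_ (freeNeed_mono k r ℓ htT)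
  obtain ⟨u, rfl⟩ : ∃ u, t = u + 1 := ⟨t - 1, by omega⟩
  rw [freeNeed]
  omega

section

variable {n k r : ℕ} {χ : EdgeColoring n k r} {ℓ : ℕ}

theorem runs_divide {s : Memory} (h10 : 0 < s.reg 10) :
    Runs χ divideProg s fun s' T =>
      (s'.arr = s.arr ∧ (∀ x, x ≠ 9 → x ≠ 13 → s'.reg x = s.reg x) ∧
        s'.reg 13 = s.reg 13 + s.reg 9 / s.reg 10) ∧ T ≤ s.reg 9 * 20 + 10 := by
  refine (runs_while (fun s' => s'.arr = s.arr ∧ (∀ x, x ≠ 9 → x ≠ 13 → s'.reg x = s.reg x) ∧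
    s'.reg 13 + s'.reg 9 / s.reg 10 = s.reg 13 + s.reg 9 / s.reg 10) (fun s' => s'.reg 9) 10 ?_
    ⟨rfl, fun _ _ _ => rfl, rfl⟩).mono ?_
  · rintro s' ⟨harr, hreg, h13⟩ hc
    have hd := hreg 10 (by simp) (by simp)
    have hle : s.reg 10 ≤ s'.reg 9 := by
      by_contra hcon
      simp [Expr.eval, hd, not_le.1 hcon] at hc
    simp only [runs_block_cons, runs_block_nil, runs_assign]
    refine ⟨⟨harr, fun x h9 h13 => ?_, ?_⟩, ?_, ?_⟩
    · simp [setReg_reg, h9, h13, hreg]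
    · rw [← h13, Nat.div_eq_sub_div h10 hle]
      simp [setReg_reg, Expr.eval, hd]
      omega
    · simp [setReg_reg, Expr.eval, hd]
      omega
    · simp only [Expr.cost]; omega
  · rintro s' T ⟨⟨harr, hreg, h13⟩, hc, hT⟩
    have hd := hreg 10 (by simp) (by simp)
    have hlt : s'.reg 9 < s.reg 10 := by
      by_contra hcon
      simp [Expr.eval, hd, hcon] at hc
    refine ⟨⟨harr, hreg, by rw [← h13, Nat.div_eq_of_lt hlt, add_zero]⟩, hT.trans ?_⟩
    have : s.reg 9 * (divideCond.cost + 1 + 10) ≤ s.reg 9 * 20 :=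
      Nat.mul_le_mul_left _ (by simp [Expr.cost])
    simp only [Expr.cost] at this ⊢
    omega

/-- The memory after `t - 1` thresholds have been computed. -/
structure ThresholdInv (k ℓ r n : ℕ) (s : Memory) : Prop where
  k_eq : s.reg 0 = k
  ℓ_eq : s.reg 1 = ℓ
  r_eq : s.reg 2 = r
  n_eq : s.reg 3 = n
  edges_eq : s.reg 5 = 0
  last_eq : s.reg 6 = 0
  dead_eq : s.reg 7 = 0
  pos : 0 < s.reg 4
  le : s.reg 4 ≤ r
  base : s.reg 8 = baseNeed ℓ (s.reg 4)
  sum : s.reg 13 = wasted k r ℓ (s.reg 4 - 1)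
  out : ∀ p, s.arr 0 p = 0
  unused : ∀ w, s.arr 1 w = 0
  cap_eq : s.arr 2 = stageCap k r (r - 1)
  thresholds : ∀ i, 0 < i → i < s.reg 4 → s.arr 4 i = threshold k r ℓ i

theorem runs_thresholdBody {s : Memory} (h : ThresholdInv k ℓ r n s) (hlt : s.reg 4 < r)
    (hn : freeNeed k r ℓ (r - 1) ≤ n) :
    Runs χ thresholdBody s fun s' T =>
      ThresholdInv k ℓ r n s' ∧ s'.reg 4 = s.reg 4 + 1 ∧ T ≤ n * 20 + 80 := by
  obtain ⟨t, ht⟩ : ∃ t, s.reg 4 = t + 1 := ⟨s.reg 4 - 1, by have := h.pos; omega⟩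
  have hbase := h.base
  have hsum := h.sum
  rw [ht] at hbase hlt
  rw [ht, Nat.add_sub_cancel] at hsum
  have hd : s.reg 8 + s.reg 13 = threshold k r ℓ (t + 1) := by
    rw [hbase, hsum, threshold, Nat.add_sub_cancel]
  have hdn := threshold_lt (k := k) (r := r) (ℓ := ℓ) (show 0 < t + 1 by omega)
    (show t + 1 ≤ r - 1 by omega)
  simp only [thresholdBody, runs_block_cons, runs_block_nil, runs_assign, runs_store]
  generalize hs₀ : ((((s.setArr 4 _ _).setReg 8 _).setReg 9 _).setReg 10 _) = s₀
  have harr : ∀ a, a ≠ 4 → s₀.arr a = s.arr a := fun a ha => by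
    subst hs₀; simp [setReg_arr, setArr_arr, ha]
  have harr4 : s₀.arr 4 = Function.update (s.arr 4) (t + 1) (threshold k r ℓ (t + 1)) := by
    subst hs₀; simp [setReg_arr, setArr_arr, Expr.eval, ht, hd]
  have hreg : ∀ x, x < 8 ∨ 10 < x → s₀.reg x = s.reg x := fun x hx => by
    subst hs₀
    rw [setReg_reg, if_neg (by omega), setReg_reg, if_neg (by omega), setReg_reg,
      if_neg (by omega), setArr_reg]
  have h8 : s₀.reg 8 = ℓ := by
    subst hs₀; simp [setReg_reg, setArr_reg, Expr.eval, h.ℓ_eq]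
  have h9 : s₀.reg 9 = threshold k r ℓ (t + 1) + 1 := by
    subst hs₀; simp [setReg_reg, setArr_reg, setReg_arr, setArr_arr, Expr.eval, ht, hd]
  have h10 : s₀.reg 10 = k - r + (t + 1) := by
    subst hs₀; simp [setReg_reg, setArr_reg, Expr.eval, ht, h.k_eq, h.r_eq]
  refine (runs_divide (s := s₀) (by omega)).mono ?_
  rintro s₁ T₁ ⟨⟨harr₁, hreg₁, h13⟩, hT₁⟩
  have hr : ∀ x, x < 8 ∨ 13 < x → s₁.reg x = s.reg x := fun x hx => by
    rw [hreg₁ x (by omega) (by omega), hreg x (by omega)]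
  refine ⟨⟨?_, ?_, ?_, ?_, ?_, ?_, ?_, ?_, ?_, ?_, ?_, ?_, ?_, ?_, fun i hi hi' => ?_⟩, ?_, ?_⟩
  · simp [setReg_reg, hr, h.k_eq]
  · simp [setReg_reg, hr, h.ℓ_eq]
  · simp [setReg_reg, hr, h.r_eq]
  · simp [setReg_reg, hr, h.n_eq]
  · simp [setReg_reg, hr, h.edges_eq]
  · simp [setReg_reg, hr, h.last_eq]
  · simp [setReg_reg, hr, h.dead_eq]
  · simp [setReg_reg, Expr.eval]
  · simp [setReg_reg, Expr.eval, hr, ht]; omega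
  · simp [setReg_reg, Expr.eval, hr, ht, hreg₁, h8, baseNeed]
  · simp [setReg_reg, Expr.eval, hr, ht, h13, hreg, hsum, h9, h10, h.ℓ_eq]
    rw [wasted, threshold, Nat.add_sub_cancel, add_assoc]
  · simp [setReg_arr, harr₁, harr, h.out]
  · simp [setReg_arr, harr₁, harr, h.unused]
  · simp [setReg_arr, harr₁, harr, h.cap_eq]
  · simp [setReg_reg, Expr.eval, hr, ht] at hi'
    simp only [setReg_arr, harr₁, harr4, Function.update_apply]
    split_ifs with hit
    · rw [hit]
    · exact h.thresholds i hi (by omega)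
  · simp [setReg_reg, Expr.eval, hr]
  · rw [h9] at hT₁
    simp only [Expr.cost]
    omega

theorem runs_prelude (hr : 2 ≤ r) (hrk : r ≤ k) (hn : freeNeed k r ℓ (r - 1) ≤ n)
    (hn0 : 0 < n) :
    Runs χ preludeProg (initialMemory k ℓ r n) fun s' T =>
      BetweenStages χ ℓ (r - 1) s' ∧ T ≤ r * (n * 20 + 90) + 20 * ℓ + 60 := by
  simp only [preludeProg, runs_block_cons, runs_block_nil, runs_assign, runs_store]
  generalize hs₀ : (initialMemory k ℓ r n).setArr 2 _ _ = s₀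
  have hreg : s₀.reg = (initialMemory k ℓ r n).reg := by subst hs₀; rfl
  have harr : ∀ a, a ≠ 2 → ∀ i, s₀.arr a i = 0 := fun a ha i => by
    subst hs₀; simp [setArr_arr, ha, initialMemory]
  have hcap : s₀.arr 2 = stageCap k r (r - 1) := by
    subst hs₀
    ext i
    simp [setArr_arr, initialMemory, Expr.eval, Function.update_apply, stageCap]
    split_ifs <;> omega
  -- The loop stops at the least `x` with `x + x ≥ ℓ`, which is the base need `(ℓ + 1) / 2` of class
  -- `1`.
  refine (runs_while (fun s' => s'.arr = s₀.arr ∧ (∀ x, x ≠ 8 → s'.reg x = s₀.reg x) ∧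
    s'.reg 8 ≤ (ℓ + 1) / 2) (fun s' => (ℓ + 1) / 2 - s'.reg 8) 10 ?_
    ⟨rfl, fun _ _ => rfl, by rw [hreg]; simp [initialMemory]⟩).mono ?_
  · rintro s' ⟨ha, hx, h8⟩ hc
    have h1 : s'.reg 1 = ℓ := by rw [hx 1 (by simp), hreg]; simp [initialMemory]
    have hlt : s'.reg 8 + s'.reg 8 < ℓ := by
      by_contra hcon
      simp [Expr.eval, h1, hcon] at hc
    simp only [runs_assign]
    refine ⟨⟨ha, fun x h8 => ?_, ?_⟩, ?_, ?_⟩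
    · simp [setReg_reg, h8, hx]
    · simp [setReg_reg, Expr.eval]; omega
    · simp [setReg_reg, Expr.eval]; omega
    · simp only [Expr.cost]; omega
  rintro s₁ T₁ ⟨⟨ha, hx, h8⟩, hc, hT₁⟩
  have h1 : s₁.reg 1 = ℓ := by rw [hx 1 (by simp), hreg]; simp [initialMemory]
  have h8' : s₁.reg 8 = (ℓ + 1) / 2 := by
    by_contra hcon
    simp [Expr.eval, h1, show s₁.reg 8 + s₁.reg 8 < ℓ by omega] at hc
  have h80 : s₀.reg 8 = 0 := by rw [hreg]; simp [initialMemory]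
  refine (runs_while (ThresholdInv k ℓ r n) (fun s' => r - s'.reg 4) (n * 20 + 80) ?_ ?_).mono ?_
  · intro s' hs' hc
    have hlt : s'.reg 4 < r := by
      by_contra hcon
      simp [Expr.eval, hs'.r_eq, hcon] at hc
    refine (runs_thresholdBody hs' hlt hn).mono ?_
    rintro s'' T ⟨hs'', h4, hT⟩
    exact ⟨hs'', by omega, hT⟩
  · refine ⟨?_, ?_, ?_, ?_, ?_, ?_, ?_, ?_, ?_, ?_, ?_, fun p => ?_, fun w => ?_, ?_,
      fun i hi hi' => ?_⟩
    · simp [setReg_reg, hx, hreg, initialMemory]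
    · simp [setReg_reg, hx, hreg, initialMemory]
    · simp [setReg_reg, hx, hreg, initialMemory]
    · simp [setReg_reg, hx, hreg, initialMemory]
    · simp [setReg_reg, hx, hreg, initialMemory]
    · simp [setReg_reg, hx, hreg, initialMemory]
    · simp [setReg_reg, hx, hreg, initialMemory]
    · simp [setReg_reg, Expr.eval]
    · simp [setReg_reg, Expr.eval]; omega
    · simp [setReg_reg, Expr.eval, h8', baseNeed]
    · simp [setReg_reg, Expr.eval, hx, hreg, initialMemory, wasted]
    · rw [setReg_arr, ha, harr 0 (by simp)]
    · rw [setReg_arr, ha, harr 1 (by simp)]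
    · rw [setReg_arr, ha, hcap]
    · simp [setReg_reg, Expr.eval] at hi'
      omega
  · rintro s₂ T₂ ⟨hs₂, hc₂, hT₂⟩
    have h4 : s₂.reg 4 = r := by
      have := hs₂.le
      by_contra hcon
      simp [Expr.eval, hs₂.r_eq, show s₂.reg 4 < r by omega] at hc₂
    refine ⟨⟨?_, ?_, ?_, ?_, ?_, ?_, ?_, ?_, ?_, ?_, fun i hi hi' => ?_, ?_, ?_⟩, ?_⟩
    · simp [setReg_reg, hs₂.k_eq]
    · simp [setReg_reg, hs₂.ℓ_eq]
    · simp [setReg_reg, hs₂.r_eq]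
    · simp [setReg_reg, hs₂.n_eq]
    · simp [setReg_reg, Expr.eval, h4]
    · simp [setReg_reg, hs₂.edges_eq]
    · simp [setReg_reg, hs₂.last_eq]
    · simp [setReg_reg, hs₂.dead_eq]
    · simp [setReg_reg, Expr.eval, h4, hs₂.r_eq]
    · exact hs₂.cap_eq
    · exact hs₂.thresholds i hi (by omega)
    · simpa [setReg_arr, hs₂.out] using hn0
    · have h0 : ∀ w, s₂.arr 1 w = 0 := hs₂.unused
      have hsize : classSize n (s₂.arr 1) 0 = n := by
        rw [classSize, filter_true_of_mem fun w _ => h0 w, card_range]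
      -- Before stage `r - 1` there are no higher classes or colors, so the other two conditions are
      -- vacuous.
      refine ⟨fun w => .inl (h0 w), hn.trans hsize.ge, fun i hi hi' => by omega,
        fun E _ _ _ c hc hc' => by omega⟩
    · rw [h80] at hT₁
      simp [Expr.cost, setReg_reg, Expr.eval] at hT₁ hT₂ ⊢
      have h5 : (r - 1) * (4 + (n * 20 + 80)) ≤ r * (n * 20 + 90) :=
        Nat.mul_le_mul (by omega) (by omega)
      omega

theorem runs_findPath (hk : 2 ≤ k) (hr : 2 ≤ r) (hrk : r ≤ k) (hℓ : 0 < ℓ)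
    (hn : freeNeed k r ℓ (r - 1) ≤ n) (hn0 : 0 < n) :
    Runs χ findPath (initialMemory k ℓ r n) fun s' T => IsMonoPath χ ℓ (s'.arr 0) ∧
      T ≤ r * (n * 20 + 90) + (r - 1) * ((6 * n + 1) * (stepTime n k + 11) + 80) +
        ((k - 1) * ℓ + 1) * (20 * n + 120) + 50 * ℓ + 200 := by
  simp only [findPath, runs_block_cons, runs_block_nil]
  refine (runs_prelude hr hrk hn hn0).mono ?_
  rintro s₁ T₁ ⟨h₁, hT₁⟩
  refine (runs_stages h₁ hk (by omega) hrk hℓ).mono ?_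
  rintro s₂ T₂ ⟨h₂ | h₂, hT₂⟩
  · rw [runs_ite]
    refine ⟨fun _ => (runs_final h₂ hk hr hrk).mono ?_, fun hc => ?_⟩
    · rintro s₃ T₃ ⟨h₃, hT₃⟩
      refine ⟨h₃, ?_⟩
      simp only [Expr.cost]
      omega
    · simp [Expr.eval, h₂.edges_eq, h₂.ℓ_eq, hℓ] at hc
  · rw [runs_ite]
    refine ⟨fun hc => ?_, fun _ => runs_skip.2 ⟨h₂.path, ?_⟩⟩
    · simp [Expr.eval, h₂.edges_eq, h₂.ℓ_eq] at hc
    · simp only [Expr.cost]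
      omega

end

/-! ### The total running time -/

theorem factorial_add_le (i : ℕ) {j n : ℕ} (h : i + j ≤ n) :
    (i + j).factorial ≤ i.factorial * n ^ j := by
  induction j with
  | zero => simp
  | succ j ih =>
    rw [← add_assoc, Nat.factorial_succ, pow_succ, ← mul_assoc, mul_comm]
    exact Nat.mul_le_mul (ih (by omega)) h

/-- Since `m ≤ n`, the factors of `m!` beyond `i!` are at most `n` each, and `i! * n.choose i` is a
falling factorial, hence at most `n ^ i`. -/
theorem factorial_mul_choose_le {i m n : ℕ} (him : i ≤ m) (hmn : m ≤ n) :
    m.factorial * n.choose i ≤ n ^ m := by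
  obtain ⟨j, rfl⟩ := Nat.exists_eq_add_of_le him
  calc (i + j).factorial * n.choose i ≤ i.factorial * n ^ j * n.choose i :=
        Nat.mul_le_mul_right _ (factorial_add_le i hmn)
    _ = n.descFactorial i * n ^ j := by rw [Nat.descFactorial_eq_factorial_mul_choose]; ring
    _ ≤ n ^ i * n ^ j := Nat.mul_le_mul_right _ (Nat.descFactorial_le_pow n i)
    _ = n ^ (i + j) := (pow_add _ _ _).symm

theorem factorial_mul_smallSubsets_le {m n : ℕ} (hmn : m ≤ n) :
    m.factorial * smallSubsets m n ≤ (m + 1) * n ^ m := by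
  rw [smallSubsets, mul_sum]
  refine (sum_le_card_nsmul _ _ (n ^ m) fun i hi => ?_).trans (by simp)
  exact factorial_mul_choose_le (by have := mem_range.1 hi; omega) hmn

/-- The constant is dictated by `m = 2`, where `27 ≤ 14 * 2`. -/
theorem succ_pow_three_le {m : ℕ} (hm : 1 ≤ m) : (m + 1) ^ 3 ≤ 14 * m.factorial := by
  rcases (show m = 1 ∨ 2 ≤ m by omega) with rfl | h2
  · decide
  · induction m, h2 using Nat.le_induction with
    | base => decide
    | succ m h2 ih =>
      rw [Nat.factorial_succ]
      have h3 := Nat.mul_le_mul_left (m + 1) (ih (by omega))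
      nlinarith [sq_nonneg (m : ℤ), Nat.pow_le_pow_left h2 2, Nat.pow_le_pow_left h2 3]

/-- Three powers of `k` must be absorbed by `(k - 1)!`: the number of stages, the cost of a query,
and the number of summands in `smallSubsets`. -/
theorem mul_sq_mul_smallSubsets_le {k n : ℕ} (hk : 2 ≤ k) (hkn : k ≤ n) :
    n * (k ^ 2 * smallSubsets (k - 1) n) ≤ 14 * n ^ k := by
  obtain ⟨m, rfl⟩ : ∃ m, k = m + 1 := ⟨k - 1, by omega⟩
  rw [Nat.add_sub_cancel]
  refine Nat.le_of_mul_le_mul_left ?_ m.factorial_pos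
  calc m.factorial * (n * ((m + 1) ^ 2 * smallSubsets m n))
      = n * (m + 1) ^ 2 * (m.factorial * smallSubsets m n) := by ring
    _ ≤ n * (m + 1) ^ 2 * ((m + 1) * n ^ m) :=
        Nat.mul_le_mul_left _ (factorial_mul_smallSubsets_le (by omega))
    _ = (m + 1) ^ 3 * n ^ (m + 1) := by ring
    _ ≤ 14 * m.factorial * n ^ (m + 1) := Nat.mul_le_mul_right _ (succ_pow_three_le (by omega))
    _ = m.factorial * (14 * n ^ (m + 1)) := by ring

theorem total_time_le {k ℓ r n : ℕ} (hk : 2 ≤ k) (hr : 2 ≤ r) (hrk : r ≤ k) (hn : k * ℓ + k ≤ n) :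
    r * (n * 20 + 90) + (r - 1) * ((6 * n + 1) * (stepTime n k + 11) + 80) +
      ((k - 1) * ℓ + 1) * (20 * n + 120) + 50 * ℓ + 200 ≤ 50000 * n ^ k := by
  have hkn : k ≤ n := by have := Nat.zero_le (k * ℓ); omega
  have hmain := mul_sq_mul_smallSubsets_le hk hkn
  have hnM : n ≤ smallSubsets (k - 1) n := by
    unfold smallSubsets
    have h1 : n.choose 1 ≤ ∑ i ∈ range (k - 1 + 1), n.choose i :=
      single_le_sum (f := fun i => n.choose i) (fun _ _ => Nat.zero_le _)
        (mem_range.2 (by omega))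
    rwa [Nat.choose_one_right] at h1
  set M := smallSubsets (k - 1) n with hM
  have hkM : 2 * M ≤ k * M := Nat.mul_le_mul_right _ hk
  have hstep : stepTime n k + 11 ≤ 400 * (k * M) := by
    rw [stepTime, ← hM]
    have : 3 * M * (k + 60) ≤ 93 * (k * M) := by
      have := Nat.mul_le_mul_left (3 * M) (show k + 60 ≤ 31 * k by omega)
      calc _ ≤ _ := this
        _ = 93 * (k * M) := by ring
    omega
  have hkk : k * M ≤ k ^ 2 * M := by
    rw [pow_two]
    exact Nat.mul_le_mul_right _ (Nat.le_mul_of_pos_left _ (by omega))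
  have hk2M : n ≤ k ^ 2 * M := by omega
  have hk2k : k ≤ k ^ 2 * M := by omega
  set Z := n * (k ^ 2 * M) with hZ
  have hnZ : n ≤ Z := Nat.le_mul_of_pos_right _ (by omega)
  have h1 : r * (n * 20 + 90) ≤ 110 * Z := by
    calc r * (n * 20 + 90) ≤ (k ^ 2 * M) * (110 * n) := Nat.mul_le_mul (by omega) (by omega)
      _ = 110 * Z := by rw [hZ]; ring
  have h2 : (r - 1) * ((6 * n + 1) * (stepTime n k + 11) + 80) ≤ 2900 * Z := by
    have h3 : (6 * n + 1) * (stepTime n k + 11) ≤ 7 * n * (400 * (k * M)) :=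
      Nat.mul_le_mul (by omega) hstep
    have h4 : n ≤ n * (k * M) := Nat.le_mul_of_pos_right _ (by omega)
    have h5 : 7 * n * (400 * (k * M)) = 2800 * (n * (k * M)) := by ring
    calc _ ≤ k * (2900 * (n * (k * M))) := Nat.mul_le_mul (by omega) (by omega)
      _ = 2900 * Z := by rw [hZ]; ring
  have hℓ : (k - 1) * ℓ + ℓ = k * ℓ := by
    rw [← Nat.succ_mul, Nat.succ_eq_add_one, Nat.sub_add_cancel (by omega)]
  have h6 : ((k - 1) * ℓ + 1) * (20 * n + 120) ≤ 140 * Z := by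
    calc _ ≤ (k ^ 2 * M) * (140 * n) := Nat.mul_le_mul (by omega) (by omega)
      _ = 140 * Z := by rw [hZ]; ring
  -- The three main terms add up to at most `3150 * Z`, the rest is at most `100 * n ≤ 100 * Z`, and
  -- `Z ≤ 14 * n ^ k`.
  omega

/-! ### Harmonic estimates for the budget of vertices -/

section Thresholds

/-- A part of the harmonic series. -/
noncomputable def partialHarmonic (m t : ℕ) : ℝ := ∑ i ∈ range t, 1 / ((m : ℝ) + (i + 1 : ℕ))

theorem partialHarmonic_nonneg (m t : ℕ) : 0 ≤ partialHarmonic m t :=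
  sum_nonneg fun _ _ => by positivity

theorem partialHarmonic_succ (m t : ℕ) :
    partialHarmonic m (t + 1) = partialHarmonic m t + 1 / ((m : ℝ) + (t + 1 : ℕ)) :=
  sum_range_succ _ _

theorem partialHarmonic_mono (m : ℕ) : Monotone (partialHarmonic m) :=
  monotone_nat_of_le_succ fun t => by
    rw [partialHarmonic_succ]
    have : 0 ≤ 1 / ((m : ℝ) + (t + 1 : ℕ)) := by positivity
    linarith

/-- The first term is kept, and each further term satisfies `1 / (x + 1) ≤ log ((x + 1) / x)`, which
is `1 - 1 / y ≤ log y` at `y = (x + 1) / x`. The logarithms telescope. -/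
theorem partialHarmonic_le (m t : ℕ) :
    partialHarmonic m (t + 1) ≤ 1 / ((m : ℝ) + 1) + Real.log (1 + t / ((m : ℝ) + 1)) := by
  induction t with
  | zero => simp [partialHarmonic]
  | succ t ih =>
    rw [partialHarmonic_succ]
    have hm : (0 : ℝ) < m + 1 := by positivity
    have ha : (0 : ℝ) < m + 1 + t := by positivity
    have hb : (0 : ℝ) < m + 1 + t + 1 := by positivity
    have h1 : 1 + (t : ℝ) / (m + 1) = (m + 1 + t) / (m + 1) := by field_simp
    have h2 : 1 + ((t + 1 : ℕ) : ℝ) / (m + 1) = (m + 1 + t + 1) / (m + 1) := by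
      push_cast
      field_simp
      ring
    rw [h1, Real.log_div ha.ne' hm.ne'] at ih
    rw [h2, Real.log_div hb.ne' hm.ne']
    have h3 := Real.one_sub_inv_le_log_of_pos (div_pos hb ha)
    rw [Real.log_div hb.ne' ha.ne', inv_div] at h3
    have h4 : 1 / ((m : ℝ) + ((t + 1 + 1 : ℕ) : ℝ)) = 1 - (m + 1 + t) / (m + 1 + t + 1) := by
      push_cast
      field_simp
      ring
    rw [h4]
    linarith

variable {k r ℓ : ℕ}

/-- Put `U t = wasted k r ℓ t + ℓ + 1` and `m = k - r + t + 1`. The recursion gives `U (t + 1) ≤ U t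
* (m + 1) / m + (ℓ + 1)`. After division by `m + 1` each step adds at most `(ℓ + 1) / (m + 1)`,
which produces the harmonic sum. -/
theorem wasted_le (t : ℕ) :
    (wasted k r ℓ t : ℝ) + ℓ + 1 ≤
      ((k - r : ℕ) + (t + 1 : ℕ)) * (ℓ + 1) * partialHarmonic (k - r) (t + 1) := by
  induction t with
  | zero =>
    rw [partialHarmonic, sum_range_one, wasted]
    have : (((k - r : ℕ) : ℝ) + (0 + 1 : ℕ)) ≠ 0 := by positivity
    field_simp
    push_cast
    linarith
  | succ t ih =>
    set m : ℝ := (k - r : ℕ) + (t + 1 : ℕ) with hm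
    have hmpos : 0 < m := by positivity
    have hbase : (baseNeed ℓ (t + 1) : ℝ) ≤ ℓ := by
      exact_mod_cast (show baseNeed ℓ (t + 1) ≤ ℓ by unfold baseNeed; split_ifs <;> omega)
    have hdiv : (((baseNeed ℓ (t + 1) + wasted k r ℓ t + 1) / (k - r + (t + 1)) : ℕ) : ℝ) ≤
        (ℓ + 1) * partialHarmonic (k - r) (t + 1) := by
      refine Nat.cast_div_le.trans ?_
      push_cast at hm ⊢
      rw [← hm, div_le_iff₀ hmpos]
      nlinarith
    have hm' : ((k - r : ℕ) : ℝ) + (t + 1 + 1 : ℕ) = m + 1 := by rw [hm]; push_cast; ring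
    rw [wasted, partialHarmonic_succ, hm']
    push_cast at hdiv ⊢
    have : (m + 1) * ((ℓ : ℝ) + 1) * (partialHarmonic (k - r) (t + 1) + 1 / (m + 1)) =
        m * (ℓ + 1) * partialHarmonic (k - r) (t + 1) +
          (ℓ + 1) * partialHarmonic (k - r) (t + 1) + (ℓ + 1) := by
      field_simp
    rw [this]
    linarith

/-- Each stage takes at most `k * (ℓ + 1) * H` vertices for its class, by `wasted_le`, and at most
`k * (ℓ + 1)` for the path. The final path needs at most another `k * (ℓ + 1)`. -/
theorem freeNeed_le {H : ℝ} (hr : 2 ≤ r) (hrk : r ≤ k) (hℓ : 1 ≤ ℓ)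
    (hH : partialHarmonic (k - r) (r - 1) ≤ H)
    {t : ℕ} (ht : t < r) :
    (freeNeed k r ℓ t : ℝ) ≤ (t + 1) * (k * (ℓ + 1) * (1 + H)) := by
  have hH0 := (partialHarmonic_nonneg (k - r) (r - 1)).trans hH
  have hX : (k : ℝ) * (ℓ + 1) ≤ k * (ℓ + 1) * (1 + H) :=
    le_mul_of_one_le_right (by positivity) (by linarith)
  induction t with
  | zero =>
    have h1 : freeNeed k r ℓ 0 ≤ k * (ℓ + 1) := by
      rw [freeNeed]
      have h2 := Nat.mul_le_mul_right ℓ (show k - r + 1 ≤ k by omega)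
      rw [add_mul, one_mul] at h2
      rw [mul_add, mul_one]
      omega
    have h2 : (freeNeed k r ℓ 0 : ℝ) ≤ k * (ℓ + 1) := by exact_mod_cast h1
    push_cast
    linarith
  | succ t ih =>
    have h1 := wasted_le (k := k) (r := r) (ℓ := ℓ) t
    have hbase : (baseNeed ℓ (t + 1) : ℝ) ≤ ℓ := by
      exact_mod_cast (show baseNeed ℓ (t + 1) ≤ ℓ by unfold baseNeed; split_ifs <;> omega)
    have hh : partialHarmonic (k - r) (t + 1) ≤ H :=
      (partialHarmonic_mono (k - r) (by omega)).trans hH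
    have hm : ((k - r : ℕ) : ℝ) + (t + 1 : ℕ) ≤ k := by
      exact_mod_cast (show k - r + (t + 1) ≤ k by omega)
    have h2 : (((k - r : ℕ) : ℝ) + (t + 1 : ℕ)) * (ℓ + 1) * partialHarmonic (k - r) (t + 1) ≤
        k * (ℓ + 1) * H :=
      mul_le_mul (mul_le_mul_of_nonneg_right hm (by positivity)) hh
        (partialHarmonic_nonneg _ _) (by positivity)
    have h3 : (((k - r + (t + 1)) * (ℓ - 1) : ℕ) : ℝ) ≤ k * (ℓ + 1) := by
      exact_mod_cast Nat.mul_le_mul (show k - r + (t + 1) ≤ k by omega) (by omega)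
    rw [freeNeed, threshold, Nat.add_sub_cancel]
    push_cast at h3 ih ⊢
    have := ih (by omega)
    linarith

/-- There is a single stage and nothing is wasted before it. The shares `ℓ / 2` and `(ℓ + 1) / 2` of
the two classes of links add up to `ℓ`, so the exact need is `(2 * k - 2) * ℓ - k + 3`. -/
theorem freeNeed_two_le {n : ℕ} (hk : 2 ≤ k) (hℓ : 1 ≤ ℓ) (hn : (2 * k - 2) * ℓ + k ≤ n) :
    freeNeed k 2 ℓ (2 - 1) ≤ n := by
  refine le_trans ?_ hn
  obtain ⟨m, rfl⟩ := Nat.exists_eq_add_of_le hk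
  obtain ⟨j, rfl⟩ := Nat.exists_eq_add_of_le hℓ
  rw [show 2 - 1 = 0 + 1 from rfl, freeNeed, freeNeed, threshold, baseNeed, if_pos (by simp)]
  simp only [wasted, Nat.add_sub_cancel_left, show 2 * (2 + m) - 2 = 2 * m + 2 by omega, zero_add,
    add_zero, Nat.sub_self]
  ring_nf
  omega

end Thresholds

/-! ### Conclusion -/

theorem findsMonoPath_findPath {k ℓ r n : ℕ} (hk : 2 ≤ k) (hr : 2 ≤ r) (hrk : r ≤ k) (hℓ : 3 ≤ ℓ)
    (hfree : freeNeed k r ℓ (r - 1) ≤ n) (hn : k * ℓ + k ≤ n) :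
    FindsMonoPath findPath 50000 k ℓ r n := by
  intro χ
  obtain ⟨s, T, hex, hpath, hT⟩ := runs_findPath (χ := χ) hk hr hrk (by omega) hfree (by omega)
  exact ⟨s, T, hex, by exact_mod_cast hT.trans (total_time_le hk hr hrk hn), hpath⟩

end LoosePath

theorem theorem3 :
    ∃ c : ℝ, 0 < c ∧ ∃ A : LoosePath.Program,
      (∀ k ℓ r n : ℕ, 2 ≤ k → 3 ≤ ℓ → 2 ≤ r → r ≤ k →
        (k : ℝ) * ((ℓ : ℝ) + 1) * (r : ℝ) *
            (1 + 1 / ((k : ℝ) - (r : ℝ) + 1) +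
              Real.log (1 + ((r : ℝ) - 2) / ((k : ℝ) - (r : ℝ) + 1))) ≤ (n : ℝ) →
        LoosePath.FindsMonoPath A c k ℓ r n) ∧
      (∀ k ℓ n : ℕ, 2 ≤ k → 3 ≤ ℓ →
        (2 * (k : ℝ) - 2) * (ℓ : ℝ) + (k : ℝ) ≤ (n : ℝ) →
        LoosePath.FindsMonoPath A c k ℓ 2 n) := by
  refine ⟨50000, by norm_num, LoosePath.findPath, fun k ℓ r n hk hℓ hr hrk hn => ?_,
    fun k ℓ n hk hℓ hn => ?_⟩
  -- With `m = k - r` and `t = r - 2` the bound on the harmonic sum is the bracket in the hypothesis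
  -- without its leading `1`.
  · have hH := LoosePath.partialHarmonic_le (k - r) (r - 2)
    rw [show r - 2 + 1 = r - 1 by omega, Nat.cast_sub hrk, Nat.cast_sub hr] at hH
    push_cast at hH
    set H : ℝ := 1 / ((k : ℝ) - r + 1) + Real.log (1 + ((r : ℝ) - 2) / ((k : ℝ) - r + 1)) with hHdef
    have hH0 : 0 ≤ H := (LoosePath.partialHarmonic_nonneg _ _).trans hH
    have hle := LoosePath.freeNeed_le hr hrk (by omega : 1 ≤ ℓ) hH (t := r - 1) (by omega)
    rw [add_assoc, ← hHdef] at hn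
    have hr1 : ((r - 1 : ℕ) : ℝ) + 1 = r := by
      rw [Nat.cast_sub (by omega)]
      simp
    rw [hr1] at hle
    refine LoosePath.findsMonoPath_findPath hk hr hrk hℓ ?_ ?_
    · have : (LoosePath.freeNeed k r ℓ (r - 1) : ℝ) ≤ n := by linarith
      exact_mod_cast this
    · have h1 : (k : ℝ) * (ℓ + 1) ≤ k * (ℓ + 1) * r :=
        le_mul_of_one_le_right (by positivity) (by exact_mod_cast (by omega : 1 ≤ r))
      have h2 : (k : ℝ) * (ℓ + 1) * r ≤ k * (ℓ + 1) * r * (1 + H) :=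
        le_mul_of_one_le_right (by positivity) (by linarith)
      have h3 : (k : ℝ) * ℓ + k ≤ n := by linarith
      exact_mod_cast h3
  · have hn' : (2 * k - 2) * ℓ + k ≤ n := by
      have h1 : ((2 * k - 2 : ℕ) : ℝ) = 2 * k - 2 := by
        rw [Nat.cast_sub (by omega)]
        push_cast
        ring
      rw [← h1] at hn
      exact_mod_cast hn
    refine LoosePath.findsMonoPath_findPath hk le_rfl hk hℓ
      (LoosePath.freeNeed_two_le hk (by omega) hn') (le_trans ?_ hn')
    have := Nat.mul_le_mul_right ℓ (show k ≤ 2 * k - 2 by omega)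
    omega
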